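/- Let $k\ge 3$ and $n-k\ge 2$ be integers. The $(n,k)$-star graph $S_{n,k}$ has as nodes the words $u=u_1u_2\cdots u_k$ of $k$ distinct symbols from $\{1,\dots,n\}$. The node $u$ is joined by a star edge with label $i$ ($2\le i\le k$) to the node obtained from $u$ by interchanging $u_1$ and $u_i$, and by a clique edge to every node $x u_2\cdots u_k$ with $x\in\{1,\dots,n\}\setminus\{u_1,\dots,u_k\}$. The extended label of $u$ is the permutation $\sigma_u=u_1\cdots u_k u_{k+1}\cdots u_n$ of $\{1,\dots,n\}$, where $u_{k+1}<\cdots<u_n$ are the symbols not occurring in $u$; the node $u$ is even or odd according to the sign of $\sigma_u$. The labels $2\le i\le\lceil (k-1)/2\rceil+1$ form the left half, and the labels $\lceil (k-1)/2\rceil+2\le i\le k$ the right half. Orient $S_{n,k}$ as follows. A star edge $uv$ with label $i$ is directed from $u$ to $v$ if $u$ is even and $i$ lies in the left half, or if $u$ is odd and $i$ lies in the right half. A clique edge $uv$ between nodes of the same sign is directed from the node with the larger first symbol to the node with the smaller one; a clique edge between nodes of different signs is directed from the node with the smaller first symbol to the node with the larger one. Then each edge receives exactly one direction, the resulting digraph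 $\overrightarrow{S_{n,k}}$ is strongly connected, and its diameter (the maximum of the directed distances over all ordered pairs of nodes) satisfies $$\mathrm{diam}(\overrightarrow{S_{n,k}})\le\left\lfloor\frac{n+k}{2}\right\rfloor+2k+6-\delta(n,k),$$ where $$\delta(n,k)=\begin{cases}2k-n,& k>n/2,\\ 0,& n/3<k\le n/2,\\ \left\lfloor\frac{n-3k}{2}\right\rfloor,& k\le n/3.\end{cases}$$ Consequently the oriented diameter of $S_{n,k}$, i.e. the minimum of the diameters of all strong orientations of $S_{n,k}$, satisfies $$\overrightarrow{\mathrm{diam}}(S_{n,k})\le\left\lfloor\frac{n+k}{2}\right\rfloor+2k+6-\delta(n,k).$$ -/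

import Mathlib

/-! ### Orientations, directed distance and oriented diameter -/

section Orientation

variable {V : Type*}

/-- `HasDirectedWalk D m u v`: there is a directed walk with exactly `m` arcs from `u` to `v`. -/
inductive HasDirectedWalk (D : Digraph V) : ℕ → V → V → Prop
  | nil (u : V) : HasDirectedWalk D 0 u u
  | cons {m : ℕ} {u v w : V} (h : D.Adj u v) (p : HasDirectedWalk D m v w) :
      HasDirectedWalk D (m + 1) u w

/-- `D` arises from `G` by giving every edge exactly one of its two directions. -/
def IsOrientationOf (D : Digraph V) (G : SimpleGraph V) : Prop :=
  (∀ u v, D.Adj u v → G.Adj u v) ∧ ∀ u v, G.Adj u v → Xor (D.Adj u v) (D.Adj v u)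

/-- Every vertex is reachable from every other one along arcs. -/
def IsStronglyConnected (D : Digraph V) : Prop :=
  ∀ u v, ∃ m, HasDirectedWalk D m u v

/-- The directed distance, the least number of arcs on a directed walk from `u` to `v`
(`⊤` if there is none; a shortest walk is a path). -/
noncomputable def directedDist (D : Digraph V) (u v : V) : ℕ∞ :=
  ⨅ (m : ℕ) (_ : HasDirectedWalk D m u v), (m : ℕ∞)

/-- The diameter of a digraph, the supremum of all directed distances. -/
noncomputable def directedDiam (D : Digraph V) : ℕ∞ :=
  ⨆ (u : V) (v : V), directedDist D u v

/-- The oriented diameter of `G`: the least diameter of a strong orientation of `G`. -/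
noncomputable def orientedDiam (G : SimpleGraph V) : ℕ∞ :=
  ⨅ (D : Digraph V) (_ : IsOrientationOf D G) (_ : IsStronglyConnected D), directedDiam D

end Orientation

/-! ### The `(n,k)`-star graph

Symbols and positions are counted from `0`: the symbols are the elements of `Fin n`, a node is an
injective word `u : Fin k ↪ Fin n`, and position `0` is the head of the word. -/

/-- The nodes of the `(n,k)`-star graph: `k`-permutations of `n` symbols. -/
abbrev NKNode (n k : ℕ) : Type := Fin k ↪ Fin n

namespace NKNode

variable {n k : ℕ}

theorem le_of_node (u : NKNode n k) : k ≤ n := by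
  simpa using Fintype.card_le_of_embedding u

/-- The symbols that do not occur in `u`. -/
def missing (u : NKNode n k) : Finset (Fin n) := (Finset.univ.map u)ᶜ

theorem card_missing (u : NKNode n k) : u.missing.card = n - k := by
  simp [missing, Finset.card_compl]

/-- The word `u` followed by the symbols missing from it in increasing order. -/
def extendedFun (u : NKNode n k) (j : Fin n) : Fin n :=
  if h : (j : ℕ) < k then u ⟨j, h⟩
  else u.missing.orderEmbOfFin u.card_missing ⟨j - k, by omega⟩

theorem extendedFun_injective (u : NKNode n k) : Function.Injective u.extendedFun := by
  have hm : ∀ (i : Fin k) (a : Fin (n - k)),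
      u i ≠ u.missing.orderEmbOfFin u.card_missing a := by
    intro i a h
    have h1 := Finset.orderEmbOfFin_mem u.missing u.card_missing a
    rw [← h] at h1
    simp [missing] at h1
  intro a b hab
  unfold extendedFun at hab
  split_ifs at hab with ha hb hb
  · have := u.injective hab
    simp only [Fin.mk.injEq] at this
    exact Fin.ext this
  · exact absurd hab (hm _ _)
  · exact absurd hab.symm (hm _ _)
  · have := (u.missing.orderEmbOfFin u.card_missing).injective hab
    simp only [Fin.mk.injEq] at this
    exact Fin.ext (by omega)

/-- The extended permutation label of a node. -/
noncomputable def extended (u : NKNode n k) : Equiv.Perm (Fin n) :=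
  Equiv.ofBijective u.extendedFun (Finite.injective_iff_bijective.mp u.extendedFun_injective)

/-- A node is even if its extended permutation label is an even permutation. -/
def IsEven (u : NKNode n k) : Prop := Equiv.Perm.sign u.extended = 1

variable [NeZero k]

/-- The word obtained from `u` by interchanging the head and the symbol at position `i`. -/
def swapHead (u : NKNode n k) (i : Fin k) : NKNode n k :=
  (Equiv.swap 0 i).toEmbedding.trans u

/-- `v` is the star neighbour of `u` along the edge with label `i`. -/
def StarEdge (u v : NKNode n k) (i : Fin k) : Prop := i ≠ 0 ∧ v = u.swapHead i

/-- `v` is a clique neighbour of `u`: its head is a symbol that does not occur in `u`, and the two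
words agree in all the other positions. -/
def CliqueEdge (u v : NKNode n k) : Prop :=
  v 0 ∉ Set.range u ∧ ∀ i : Fin k, i ≠ 0 → v i = u i

theorem StarEdge.symm {u v : NKNode n k} {i : Fin k} (h : StarEdge u v i) : StarEdge v u i := by
  refine ⟨h.1, ?_⟩
  rw [h.2]
  ext j
  simp [swapHead]

theorem CliqueEdge.symm {u v : NKNode n k} (h : CliqueEdge u v) : CliqueEdge v u := by
  refine ⟨?_, fun i hi => (h.2 i hi).symm⟩
  rintro ⟨i, hi⟩
  by_cases h0 : i = 0
  · subst h0
    exact h.1 ⟨0, hi.symm⟩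
  · rw [h.2 i h0] at hi
    exact h0 (u.injective hi)

/-- The left half of the arm consists of the first `⌈(k-1)/2⌉ = ⌊k/2⌋` positions after the head. -/
def InLeftHalf (i : Fin k) : Prop := i ≠ 0 ∧ (i : ℕ) ≤ k / 2

/-- The right half of the arm consists of the remaining positions. -/
def InRightHalf (i : Fin k) : Prop := k / 2 < (i : ℕ)

/-- Orientation of the star edges: out of even nodes along labels in the left half, out of odd
nodes along labels in the right half. -/
def StarArc (u v : NKNode n k) : Prop :=
  ∃ i : Fin k, StarEdge u v i ∧ ((u.IsEven ∧ InLeftHalf i) ∨ (¬ u.IsEven ∧ InRightHalf i))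

/-- Orientation of the clique edges: from the larger to the smaller head between nodes of the same
sign, from the smaller to the larger head between nodes of different signs. -/
def CliqueArc (u v : NKNode n k) : Prop :=
  CliqueEdge u v ∧
    (((u.IsEven ↔ v.IsEven) ∧ v 0 < u 0) ∨ (¬ (u.IsEven ↔ v.IsEven) ∧ u 0 < v 0))

end NKNode

/-- The `(n,k)`-star graph. -/
def nkStarGraph (n k : ℕ) [NeZero k] : SimpleGraph (NKNode n k) where
  Adj u v := (∃ i : Fin k, NKNode.StarEdge u v i) ∨ NKNode.CliqueEdge u v
  symm := ⟨by
    rintro u v (⟨i, h⟩ | h)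
    · exact Or.inl ⟨i, h.symm⟩
    · exact Or.inr h.symm⟩
  loopless := ⟨by
    rintro u (⟨i, hi, h⟩ | h)
    · have h0 := DFunLike.congr_fun h (0 : Fin k)
      simp only [NKNode.swapHead, Function.Embedding.trans_apply, Equiv.coe_toEmbedding,
        Equiv.swap_apply_left] at h0
      exact hi (u.injective h0).symm
    · exact h.1 ⟨0, rfl⟩⟩

/-- The orientation of the `(n,k)`-star graph with the star edges and the clique edges directed by
`NKNode.StarArc` and `NKNode.CliqueArc`. -/
def nkStarOrientation (n k : ℕ) [NeZero k] : Digraph (NKNode n k) where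
  Adj u v := NKNode.StarArc u v ∨ NKNode.CliqueArc u v

/-- The correction term `δ(n,k)`; the three cases are `k > n/2`, `n/3 < k ≤ n/2`, `k ≤ n/3`. -/
def nkDelta (n k : ℕ) : ℕ :=
  if n < 2 * k then 2 * k - n else if n < 3 * k then 0 else (n - 3 * k) / 2

/-- The subtraction in the bound on the diameter never truncates. -/
theorem nkDelta_le (n k : ℕ) : nkDelta n k ≤ (n + k) / 2 + 2 * k + 6 := by
  unfold nkDelta
  split_ifs <;> omega

/-! Fix a target. Up to one final walk inside a clique, which corrects the head, the task is to sort
the slots. A star arc at a slot is usable exactly when the sign matches the half of that slot, and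
it reverses the sign, so consecutive star moves alternate between the halves. A head symbol bound
for the half of the current sign goes straight home. If the displaced symbol is bound for the other
half (a crossed slot), it can go home next, and so on: this is a run (`exists_run`), which stops
when the displaced content is bound for its own half or is a blank. A head symbol bound for the half
opposite to the sign has to be parked in the other half, where it becomes crossed.

This suggests a price for sorting: 1 for a crossed content; 2 for a content bound for another slot
of its own half (once to park, once to go home); 2 for an outside symbol or a head symbol that has a
destination; and 1 more for every cycle of crossed slots, which has to be opened. Cycles are not
counted directly: a hitting set `T`, meeting every closed set of crossed slots, is carried along,
and its size is the price. The sum is `pot`. Since moves alternate, a surplus of unsorted slots in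
one half may force moves into the other half when it is already sorted, so `val` adds the difference
of the two sizes.

With `T` the set of all crossed slots, `balance` turns `pot` into twice the number of unsorted
slots, and since the halves differ by at most one slot, `val` is at most 2(k-1)+1. It remains to see
that at most three further star moves are ever needed. `Cap` lists the kinds of states with the
surcharge of each, and `claim` proves by strong induction on the number of moves that every listed
state has a move, a run or a three-move detour into a listed state with a sufficient rest. The
delicate points are to place symbols so that no new cycle closes (`Hitting.star_choice`), and to
avoid that the symbols left on one side merely permute their own slots (`ClosedSame`) while the
other side is sorted. The outcome is `good_of_card`: 2(k-1)+4 star moves, one fewer if outside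
symbols are present.

Clique moves are counted apart. Sorted by head, the nodes of a clique alternate in sign
(`isEven_setHead_succ`), so its arcs form an explicit tournament on the ranks 0, …, m with m = n-k.
Distances there are at most 2, except for 3 from m to 0 when m is odd, and a node fails to reach at
most (m+1)/2 others by an arc. Thus while more than (m+1)/2 outside symbols are wanted, one of them
is fetched by a single arc. This is why the game must succeed for every fetched symbol and every
resulting sign. Adding the fetches of w ≤ min(k-1, n-k) symbols and the correction of the head gives
the bound; the cases of δ record which of k-1, n-k and (m+1)/2 limits the cost. -/

/-! ### A sorting game on slots

The positions of a word other than the head are *slots*.  With a target word fixed, the content of a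
slot matters only through its *destination*, the slot where the target has that symbol; symbols that
the target keeps out of the slots are *blanks*. -/

/-- A state of the sorting game: the destinations of the contents of the slots and of the head
(`none` for a blank), and the current sign. -/
structure SortState (ι : Type*) where
  nx : ι → Option ι
  hd : Option ι
  sg : Bool

/-- The four kinds of content a slot can have. -/
inductive SlotKind
  | home
  | same
  | cross
  | blank
  deriving DecidableEq

set_option linter.unusedSectionVars false

namespace SortState

variable {ι : Type*} [Fintype ι] [DecidableEq ι]

/-- Interchange the head with the content of slot `i`. -/
def star (σ : SortState ι) (i : ι) : SortState ι :=
  ⟨Function.update σ.nx i σ.hd, σ.nx i, !σ.sg⟩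

/-- No two symbols have the same destination. -/
def Valid (σ : SortState ι) : Prop :=
  (∀ i j t, σ.nx i = some t → σ.nx j = some t → i = j) ∧ ∀ i t, σ.nx i = some t → σ.hd ≠ some t

/-- The destinations of the symbols that are neither in a slot nor at the head. -/
def ext (σ : SortState ι) : Finset ι :=
  {t | (∀ i, σ.nx i ≠ some t) ∧ σ.hd ≠ some t}

variable (side : ι → Bool)

/-- `Good side σ N`: the slots can be sorted from `σ` with at most `N` star moves, whatever symbols
and signs come up when a blank head is exchanged for an outside symbol. -/
inductive Good : SortState ι → ℕ → Prop
  | done {σ N} (h : ∀ i, σ.nx i = some i) : Good σ N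
  | star {σ N} (i : ι) (hi : side i = σ.sg) (h : Good (σ.star i) N) : Good σ (N + 1)
  -- A fetch is free here, since clique arcs are counted separately. The symbol and the sign are
  -- left to an adversary, so that the walk may later take whichever symbol is cheapest.
  | fetch {σ N} (hd : σ.hd = none) (hw : σ.ext.Nonempty)
      (h : ∀ t ∈ σ.ext, ∀ s, Good ⟨σ.nx, some t, s⟩ N) : Good σ N

variable {side} in
theorem Good.mono {σ : SortState ι} {N M : ℕ} (h : Good side σ N) (hNM : N ≤ M) :
    Good side σ M := by
  induction h generalizing M with
  | done h => exact .done h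
  | star i hi _ ih =>
    obtain ⟨M, rfl⟩ : ∃ M', M = M' + 1 := ⟨M - 1, by omega⟩
    exact .star i hi (ih (by omega))
  | fetch hd hw _ ih => exact .fetch hd hw fun t ht s => ih t ht s hNM

/-- The kind of a content with destination `o` in slot `i`. -/
def kind (i : ι) : Option ι → SlotKind
  | none => .blank
  | some j => if j = i then .home else if side j = side i then .same else .cross

@[simp] theorem kind_none (i : ι) : kind side i none = .blank := rfl

theorem kind_eq_blank {i : ι} {o : Option ι} : kind side i o = .blank ↔ o = none := by
  cases o with
  | none => simp
  | some j => simp only [kind]; split_ifs <;> simp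

theorem kind_eq_home {i : ι} {o : Option ι} : kind side i o = .home ↔ o = some i := by
  cases o with
  | none => simp
  | some j => simp only [kind]; split_ifs <;> simp_all

theorem kind_eq_same {i : ι} {o : Option ι} :
    kind side i o = .same ↔ ∃ j, o = some j ∧ j ≠ i ∧ side j = side i := by
  cases o with
  | none => simp
  | some j => simp only [kind]; split_ifs <;> simp_all

theorem kind_eq_cross {i : ι} {o : Option ι} :
    kind side i o = .cross ↔ ∃ j, o = some j ∧ side j = !side i := by
  cases o with
  | none => simp
  | some j =>
    simp only [kind]
    split_ifs with h1 h2
    · simp [h1]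
    · simp [h2]
    · simpa using Bool.eq_not.2 h2

/-- The slots on side `a` whose content is of kind `κ`. -/
def slots (σ : SortState ι) (a : Bool) (κ : SlotKind) : Finset ι :=
  {i | side i = a ∧ kind side i (σ.nx i) = κ}

/-- The number of slots on side `a` whose content is of kind `κ`. -/
def cnt (σ : SortState ι) (a : Bool) (κ : SlotKind) : ℕ := (slots side σ a κ).card

/-- The number of outside symbols with destination on side `a`. -/
def extCnt (σ : SortState ι) (a : Bool) : ℕ := {t ∈ σ.ext | side t = a}.card

/-- Whether the head has its destination on side `a`, as a number. -/
def hdCnt (σ : SortState ι) (a : Bool) : ℕ := if ∃ t, σ.hd = some t ∧ side t = a then 1 else 0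

theorem mem_slots {σ : SortState ι} {a : Bool} {κ : SlotKind} {i : ι} :
    i ∈ slots side σ a κ ↔ side i = a ∧ kind side i (σ.nx i) = κ := by
  simp [slots]

theorem mem_ext {σ : SortState ι} {t : ι} :
    t ∈ σ.ext ↔ (∀ i, σ.nx i ≠ some t) ∧ σ.hd ≠ some t := by
  simp [ext]

/-- Written with indicators on both sides to avoid truncated subtraction. Head and sign do not enter
the counts and may differ on the two sides. -/
theorem cnt_update (f : ι → Option ι) (h h' : Option ι) (s s' : Bool) (i : ι) (o : Option ι)
    (a : Bool) (κ : SlotKind) :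
    cnt side ⟨Function.update f i o, h, s⟩ a κ +
        (if side i = a ∧ kind side i (f i) = κ then 1 else 0) =
      cnt side ⟨f, h', s'⟩ a κ + (if side i = a ∧ kind side i o = κ then 1 else 0) := by
  have key : ∀ g : ι → Option ι, (slots side ⟨g, h, s⟩ a κ).card =
      ((slots side ⟨g, h, s⟩ a κ).erase i).card +
        (if side i = a ∧ kind side i (g i) = κ then 1 else 0) := by
    intro g
    split_ifs with hc
    · rw [Finset.card_erase_add_one]
      rwa [mem_slots]
    · rw [Finset.erase_eq_of_notMem]
      · rfl
      · rwa [mem_slots]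
  have e : (slots side ⟨Function.update f i o, h, s⟩ a κ).erase i =
      (slots side ⟨f, h, s⟩ a κ).erase i := by
    ext j
    simp only [Finset.mem_erase, mem_slots]
    refine and_congr_right fun hj => ?_
    simp [Function.update_of_ne hj]
  have h1 := key (Function.update f i o)
  have h2 := key f
  rw [e] at h1
  simp only [Function.update_self] at h1
  have h3 : cnt side ⟨f, h', s'⟩ a κ = (slots side ⟨f, h, s⟩ a κ).card := rfl
  unfold cnt at *
  omega

variable {side}

theorem Valid.star {σ : SortState ι} (hσ : σ.Valid) (i : ι) : (σ.star i).Valid := by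
  obtain ⟨h1, h2⟩ := hσ
  refine ⟨fun j l t hj hl => ?_, fun j t hj hd => ?_⟩
  · simp only [SortState.star, Function.update_apply] at hj hl
    split_ifs at hj hl with ha hb hb
    · rw [ha, hb]
    · exact absurd hj (h2 _ _ hl)
    · exact absurd hl (h2 _ _ hj)
    · exact h1 _ _ _ hj hl
  · simp only [SortState.star, Function.update_apply] at hj hd
    split_ifs at hj with ha
    · exact h2 _ _ hd hj
    · exact ha (h1 _ _ _ hj hd)

theorem Valid.fetch {σ : SortState ι} (hσ : σ.Valid) {t : ι} (ht : t ∈ σ.ext) (s : Bool) :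
    (⟨σ.nx, some t, s⟩ : SortState ι).Valid :=
  ⟨hσ.1, fun i u hi hu => (mem_ext.1 ht).1 i (by rw [hi]; exact hu.symm)⟩

theorem ext_star (σ : SortState ι) (i : ι) : (σ.star i).ext = σ.ext := by
  ext t
  simp only [mem_ext, SortState.star, Function.update_apply]
  constructor
  · rintro ⟨h1, h2⟩
    refine ⟨fun j hj => ?_, fun hd => ?_⟩
    · by_cases hji : j = i
      · exact h2 (hji ▸ hj)
      · exact h1 j (by simp [hji, hj])
    · exact h1 i (by simp [hd])
  · rintro ⟨h1, h2⟩
    refine ⟨fun j hj => ?_, h1 i⟩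
    split_ifs at hj
    · exact h2 hj
    · exact h1 j hj

/-- Counting the slots on side `a` by kind. -/
theorem card_side (σ : SortState ι) (a : Bool) :
    (Finset.univ.filter fun i => side i = a).card =
      cnt side σ a .home + cnt side σ a .same + cnt side σ a .cross + cnt side σ a .blank := by
  have : (Finset.univ.filter fun i => side i = a) =
      ((slots side σ a .home ∪ slots side σ a .same) ∪ slots side σ a .cross) ∪
        slots side σ a .blank := by
    ext i
    simp only [Finset.mem_filter, Finset.mem_univ, true_and, Finset.mem_union, mem_slots]
    cases h : kind side i (σ.nx i) <;> simp
  rw [this, Finset.card_union_of_disjoint, Finset.card_union_of_disjoint,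
    Finset.card_union_of_disjoint]
  · rfl
  all_goals
    rw [Finset.disjoint_left]
    intro i hi hi'
    simp only [Finset.mem_union, mem_slots] at hi hi'
    rcases hi' with ⟨_, hi'⟩
    rw [hi'] at hi
    simp at hi

/-- Counting the symbols with destination on side `a` by destination and by location. -/
theorem balance {σ : SortState ι} (hσ : σ.Valid) (a : Bool) :
    cnt side σ (!a) .cross + extCnt side σ a + hdCnt side σ a =
      cnt side σ a .cross + cnt side σ a .blank := by
  classical
  obtain ⟨h1, h2⟩ := hσ
  have e1 := card_side (side := side) σ a
  -- slots whose content has its destination on side `a`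
  set D := Finset.univ.filter fun i => ∃ t, σ.nx i = some t ∧ side t = a with hD
  have e2 : D.card = cnt side σ a .home + cnt side σ a .same + cnt side σ (!a) .cross := by
    have : D = (slots side σ a .home ∪ slots side σ a .same) ∪ slots side σ (!a) .cross := by
      ext i
      simp only [hD, Finset.mem_filter, Finset.mem_univ, true_and, Finset.mem_union, mem_slots,
        kind_eq_home, kind_eq_same, kind_eq_cross]
      constructor
      · rintro ⟨t, ht, rfl⟩
        by_cases hti : t = i
        · subst hti; simp [ht]
        · by_cases hs : side i = side t
          · left; right; exact ⟨hs, t, ht, hti, hs.symm⟩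
          · right
            have := Bool.eq_not.2 hs
            exact ⟨this, t, ht, by simp [this]⟩
      · rintro ((⟨hi, h⟩ | ⟨hi, t, ht, _, hs⟩) | ⟨hi, t, ht, hs⟩)
        · exact ⟨i, h, hi⟩
        · exact ⟨t, ht, hs.trans hi⟩
        · exact ⟨t, ht, by simp [hs, hi]⟩
    rw [this, Finset.card_union_of_disjoint, Finset.card_union_of_disjoint]
    · rfl
    · rw [Finset.disjoint_left]
      intro i hi hi'
      simp only [mem_slots] at hi hi'
      rw [hi'.2] at hi
      simp at hi
    · rw [Finset.disjoint_left]
      intro i hi hi'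
      simp only [Finset.mem_union, mem_slots] at hi hi'
      rw [hi'.2] at hi
      simp at hi
  -- the destinations
  have e3 : (Finset.univ.filter fun i => side i = a).card =
      D.card + extCnt side σ a + hdCnt side σ a := by
    set Q := Finset.univ.filter fun t => side t = a ∧ ∃ i, σ.nx i = some t with hQ
    set Hd := Finset.univ.filter fun t => side t = a ∧ σ.hd = some t with hHd
    have q1 : Q.card = D.card := by
      symm
      refine Finset.card_bij (fun i hi => (Finset.mem_filter.1 hi).2.choose) ?_ ?_ ?_
      · intro i hi
        have := (Finset.mem_filter.1 hi).2.choose_spec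
        simp only [hQ, Finset.mem_filter, Finset.mem_univ, true_and]
        exact ⟨this.2, i, this.1⟩
      · intro i hi j hj hij
        have a1 := (Finset.mem_filter.1 hi).2.choose_spec
        have a2 := (Finset.mem_filter.1 hj).2.choose_spec
        exact h1 _ _ _ a1.1 (hij ▸ a2.1)
      · intro t ht
        obtain ⟨hs, i, hi⟩ := (Finset.mem_filter.1 ht).2
        have hiD : i ∈ D := Finset.mem_filter.2 ⟨Finset.mem_univ _, t, hi, hs⟩
        refine ⟨i, hiD, ?_⟩
        have := (Finset.mem_filter.1 hiD).2.choose_spec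
        exact Option.some_injective _ (this.1.symm.trans hi)
    have q2 : Hd.card = hdCnt side σ a := by
      unfold hdCnt
      split_ifs with h
      · obtain ⟨t, ht, hs⟩ := h
        rw [Finset.card_eq_one]
        refine ⟨t, ?_⟩
        ext u
        simp only [hHd, Finset.mem_filter, Finset.mem_univ, true_and, Finset.mem_singleton, ht,
          Option.some.injEq]
        constructor
        · rintro ⟨_, h⟩; exact h.symm
        · rintro rfl; exact ⟨hs, rfl⟩
      · rw [Finset.card_eq_zero, Finset.filter_eq_empty_iff]
        rintro t - ⟨hs, ht⟩
        exact h ⟨t, ht, hs⟩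
    have q3 : (Finset.univ.filter fun i => side i = a) =
        (Q ∪ σ.ext.filter fun t => side t = a) ∪ Hd := by
      ext t
      simp only [hQ, hHd, Finset.mem_filter, Finset.mem_univ, true_and, Finset.mem_union, mem_ext]
      constructor
      · intro hs
        by_cases hq : ∃ i, σ.nx i = some t
        · exact .inl (.inl ⟨hs, hq⟩)
        · by_cases hh : σ.hd = some t
          · exact .inr ⟨hs, hh⟩
          · push Not at hq
            exact .inl (.inr ⟨⟨hq, hh⟩, hs⟩)
      · rintro ((h | h) | h)
        · exact h.1
        · exact h.2
        · exact h.1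
    rw [q3, Finset.card_union_of_disjoint, Finset.card_union_of_disjoint, q1, q2]
    · rfl
    · rw [Finset.disjoint_left]
      intro t ht ht'
      obtain ⟨_, i, hi⟩ := (Finset.mem_filter.1 ht).2
      exact (mem_ext.1 (Finset.mem_filter.1 ht').1).1 i hi
    · rw [Finset.disjoint_left]
      intro t ht ht'
      have hh := (Finset.mem_filter.1 ht').2.2
      rcases Finset.mem_union.1 ht with ht | ht
      · obtain ⟨_, i, hi⟩ := (Finset.mem_filter.1 ht).2
        exact h2 i t hi hh
      · exact (mem_ext.1 (Finset.mem_filter.1 ht).1).2 hh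
  omega

end SortState

/-! ### Star moves, hitting sets of crossed cycles, and runs -/

namespace SortState

variable {ι : Type*} [Fintype ι] [DecidableEq ι] {side : ι → Bool}

theorem hdCnt_none {σ : SortState ι} (h : σ.hd = none) (a : Bool) : hdCnt side σ a = 0 := by
  simp [hdCnt, h]

theorem hdCnt_some {σ : SortState ι} {x : ι} {a : Bool} (h : σ.hd = some x) (hx : side x = a) :
    hdCnt side σ a = 1 ∧ ∀ b, b = (!a) → hdCnt side σ b = 0 := by
  simp [hdCnt, h, hx]

theorem balance_both {σ : SortState ι} (hσ : σ.Valid) {a b : Bool} (hab : b = !a) :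
    cnt side σ b .cross + extCnt side σ a + hdCnt side σ a =
        cnt side σ a .cross + cnt side σ a .blank ∧
      cnt side σ a .cross + extCnt side σ b + hdCnt side σ b =
        cnt side σ b .cross + cnt side σ b .blank := by
  subst hab
  exact ⟨balance hσ a, by simpa using balance (side := side) hσ (!a)⟩

/-- The effect of a star move on the counts. -/
theorem star_counts (σ : SortState ι) {i : ι} {a b : Bool} (hab : b = !a) (hi : side i = a)
    {κ κ' : SlotKind}
    (h : kind side i (σ.nx i) = κ) (h' : kind side i σ.hd = κ') :
    (cnt side (σ.star i) a .same + (if κ = .same then 1 else 0) =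
        cnt side σ a .same + (if κ' = .same then 1 else 0)) ∧
    (cnt side (σ.star i) a .cross + (if κ = .cross then 1 else 0) =
        cnt side σ a .cross + (if κ' = .cross then 1 else 0)) ∧
    (cnt side (σ.star i) a .blank + (if κ = .blank then 1 else 0) =
        cnt side σ a .blank + (if κ' = .blank then 1 else 0)) ∧
    cnt side (σ.star i) b .same = cnt side σ b .same ∧
    cnt side (σ.star i) b .cross = cnt side σ b .cross ∧
    cnt side (σ.star i) b .blank = cnt side σ b .blank ∧
    extCnt side (σ.star i) a = extCnt side σ a ∧
    extCnt side (σ.star i) b = extCnt side σ b := by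
  have key : ∀ c κ₀, cnt side (σ.star i) c κ₀ + (if side i = c ∧ κ = κ₀ then 1 else 0) =
      cnt side σ c κ₀ + (if side i = c ∧ κ' = κ₀ then 1 else 0) := by
    intro c κ₀
    have := cnt_update side σ.nx (σ.nx i) σ.hd (!σ.sg) σ.sg i σ.hd c κ₀
    rw [h, h'] at this
    exact this
  have hn : ¬ side i = b := by simp [hi, hab]
  refine ⟨?_, ?_, ?_, ?_, ?_, ?_, ?_, ?_⟩
  · simpa [hi] using key a .same
  · simpa [hi] using key a .cross
  · simpa [hi] using key a .blank
  · simpa [hn] using key b .same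
  · simpa [hn] using key b .cross
  · simpa [hn] using key b .blank
  · simp [extCnt, ext_star]
  · simp [extCnt, ext_star]

variable (side) in
/-- `T` is a set of crossed slots that meets every closed set of crossed slots. -/
def Hitting (σ : SortState ι) (T : Finset ι) : Prop :=
  (∀ t ∈ T, kind side t (σ.nx t) = .cross) ∧
    ∀ C : Finset ι, (∀ c ∈ C, kind side c (σ.nx c) = .cross ∧ c ∉ T ∧ ∃ c' ∈ C, σ.nx c = some c') →
      C = ∅

/-- A closed set that the move creates passes through the changed slot, so adding that slot to `T`
meets it. -/
theorem Hitting.star_insert {σ : SortState ι} {T : Finset ι} (h : Hitting side σ T) {i : ι}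
    (hi : kind side i σ.hd = .cross) : Hitting side (σ.star i) (insert i T) := by
  refine ⟨fun t ht => ?_, fun C hC => h.2 C fun c hc => ?_⟩
  · by_cases hti : t = i
    · subst hti; simpa [star] using hi
    · rw [Finset.mem_insert] at ht
      simpa [star, Function.update_of_ne hti] using h.1 t (ht.resolve_left hti)
  · obtain ⟨h1, h2, h3⟩ := hC c hc
    rw [Finset.mem_insert, not_or] at h2
    simp only [star, Function.update_of_ne h2.1] at h1 h3
    exact ⟨h1, h2.2, h3⟩

/-- The changed slot is no longer crossed, hence lies in no closed set and is not needed in `T`. -/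
theorem Hitting.star_erase {σ : SortState ι} {T : Finset ι} (h : Hitting side σ T) {i : ι}
    (hi : kind side i σ.hd ≠ .cross) : Hitting side (σ.star i) (T.erase i) := by
  refine ⟨fun t ht => ?_, fun C hC => h.2 C fun c hc => ?_⟩
  · rw [Finset.mem_erase] at ht
    simpa [star, Function.update_of_ne ht.1] using h.1 t ht.2
  · obtain ⟨h1, h2, h3⟩ := hC c hc
    have hci : c ≠ i := by
      rintro rfl
      exact hi (by simpa [star] using h1)
    simp only [star, Function.update_of_ne hci] at h1 h3
    exact ⟨h1, fun hT => h2 (Finset.mem_erase.2 ⟨hci, hT⟩), h3⟩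

/-- If there are two uncrossed slots to move a symbol to, then at least one of them does not close
a cycle of crossed slots off `T`. -/
theorem Hitting.star_choice {σ : SortState ι} {T : Finset ι} (h : Hitting side σ T) {i j : ι}
    (hij : i ≠ j) (hi : kind side i σ.hd = .cross) (hj : kind side j σ.hd = .cross)
    (hi' : kind side i (σ.nx i) ≠ .cross) (hj' : kind side j (σ.nx j) ≠ .cross) :
    Hitting side (σ.star i) T ∨ Hitting side (σ.star j) T := by
  by_contra hcon
  rw [not_or] at hcon
  have key : ∀ p, kind side p σ.hd = .cross → kind side p (σ.nx p) ≠ .cross →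
      ¬ Hitting side (σ.star p) T → ∃ C : Finset ι, p ∈ C ∧ (∃ x ∈ C, σ.hd = some x) ∧
        ∀ c ∈ C, c ≠ p → kind side c (σ.nx c) = .cross ∧ c ∉ T ∧ ∃ c' ∈ C, σ.nx c = some c' := by
    intro p hp hp' hn
    simp only [Hitting, not_and_or, not_forall] at hn
    rcases hn with ⟨t, ht, hn⟩ | ⟨C, hC, hne⟩
    · exfalso
      have htp : t ≠ p := by rintro rfl; exact hp' (h.1 _ ht)
      exact hn (by simpa [star, Function.update_of_ne htp] using h.1 t ht)
    · have hout : ∀ c ∈ C, c ≠ p →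
          kind side c (σ.nx c) = .cross ∧ c ∉ T ∧ ∃ c' ∈ C, σ.nx c = some c' := by
        intro c hc hcp
        simpa [star, Function.update_of_ne hcp] using hC c hc
      have hpC : p ∈ C := by
        by_contra hpC
        exact hne (h.2 C fun c hc => hout c hc (by rintro rfl; exact hpC hc))
      refine ⟨C, hpC, ?_, hout⟩
      obtain ⟨x, hx, e⟩ := (hC p hpC).2.2
      exact ⟨x, hx, by simpa [star] using e⟩
  obtain ⟨C, hiC, ⟨x, hxC, hx⟩, hC⟩ := key i hi hi' hcon.1
  obtain ⟨D, hjD, ⟨y, hyD, hy⟩, hD⟩ := key j hj hj' hcon.2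
  have hxy : x = y := Option.some_injective _ (hx.symm.trans hy)
  subst hxy
  have hjC : j ∉ C := fun hjC => hj' (hC j hjC (Ne.symm hij)).1
  have hiD : i ∉ D := fun hiD => hi' (hD i hiD hij).1
  -- The closed sets completed by `i` and by `j` both contain the destination of the head. Neither
  -- contains the other slot, so their intersection was closed before the move.
  have : C ∩ D = ∅ := by
    refine h.2 _ fun c hc => ?_
    rw [Finset.mem_inter] at hc
    have hci : c ≠ i := by rintro rfl; exact hiD hc.2
    have hcj : c ≠ j := by rintro rfl; exact hjC hc.1
    obtain ⟨h1, h2, c', hc', e⟩ := hC c hc.1 hci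
    obtain ⟨-, -, c'', hc'', e'⟩ := hD c hc.2 hcj
    have : c' = c'' := Option.some_injective _ (e.symm.trans e')
    exact ⟨h1, h2, c', Finset.mem_inter.2 ⟨hc', this ▸ hc''⟩, e⟩
  exact Finset.notMem_empty x (this ▸ Finset.mem_inter.2 ⟨hxC, hyD⟩)

/-- An element of a hitting set may be replaced by its successor. -/
theorem Hitting.swap {σ : SortState ι} {T : Finset ι} (h : Hitting side σ T) {t l : ι}
    (ht : t ∈ T) (hl : σ.nx t = some l) (hlc : kind side l (σ.nx l) = .cross) :
    Hitting side σ (insert l (T.erase t)) := by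
  refine ⟨fun u hu => ?_, fun C hC => h.2 C fun c hc => ?_⟩
  · rcases Finset.mem_insert.1 hu with rfl | hu
    · exact hlc
    · exact h.1 u (Finset.mem_of_mem_erase hu)
  · obtain ⟨h1, h2, c', hc', e⟩ := hC c hc
    rw [Finset.mem_insert, Finset.mem_erase, not_or, not_and] at h2
    refine ⟨h1, h2.2 ?_, c', hc', e⟩
    rintro rfl
    have : c' = l := Option.some_injective _ (e.symm.trans hl)
    exact (hC c' hc').2.1 (by simp [this])

/-- An element of a hitting set with an uncrossed successor may be dropped. -/
theorem Hitting.drop {σ : SortState ι} {T : Finset ι} (h : Hitting side σ T) {t l : ι}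
    (hl : σ.nx t = some l) (hlc : kind side l (σ.nx l) ≠ .cross) :
    Hitting side σ (T.erase t) := by
  refine ⟨fun u hu => h.1 u (Finset.mem_of_mem_erase hu), fun C hC => h.2 C fun c hc => ?_⟩
  obtain ⟨h1, h2, c', hnext, e⟩ := hC c hc
  rw [Finset.mem_erase, not_and] at h2
  refine ⟨h1, h2 ?_, c', hnext, e⟩
  rintro rfl
  have : c' = l := Option.some_injective _ (e.symm.trans hl)
  exact hlc (this ▸ (hC c' hnext).1)

/-- The state after the slots of `H` have been filled with their symbols, `e` being the last. -/
def fill (σ : SortState ι) (side : ι → Bool) (H : Finset ι) (e : ι) : SortState ι :=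
  ⟨fun i => if i ∈ H then some i else σ.nx i, σ.nx e, !side e⟩

variable (side) in
/-- `H` is the set of slots passed by moving the head symbol home, the displaced symbol home, and
so on up to the first uncrossed slot `e`. -/
structure IsRun (σ : SortState ι) (H : Finset ι) (e : ι) : Prop where
  end_mem : e ∈ H
  hd_mem : ∃ t ∈ H, σ.hd = some t
  end_kind : kind side e (σ.nx e) = .same ∨ kind side e (σ.nx e) = .blank
  step : ∀ h ∈ H, h ≠ e → kind side h (σ.nx h) = .cross ∧ ∃ h' ∈ H, σ.nx h = some h'
  minimal : ∀ D : Finset ι, (∀ t, σ.hd = some t → t ∈ D) →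
    (∀ d ∈ D, d ≠ e → ∀ d', σ.nx d = some d' → d' ∈ D) → H ⊆ D

/-- A crossed content displaced from `t` is bound for the other side, which is the side of the
reversed sign, so it can go home at once. Every such move lowers the number of crossed slots by one;
this drives the induction. -/
theorem exists_run {σ : SortState ι} (hσ : σ.Valid) {t : ι} (ht : σ.hd = some t)
    (hs : side t = σ.sg) :
    ∃ H e, IsRun side σ H e ∧ (σ.fill side H e).Valid ∧ (σ.fill side H e).ext = σ.ext ∧
      (∀ N, Good side (σ.fill side H e) N → Good side σ (N + H.card)) ∧
      (∀ a κ, κ = .same ∨ κ = .blank → cnt side (σ.fill side H e) a κ +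
        (if side e = a ∧ kind side e (σ.nx e) = κ then 1 else 0) = cnt side σ a κ) ∧
      cnt side (σ.fill side H e) true .cross + cnt side (σ.fill side H e) false .cross + H.card =
        cnt side σ true .cross + cnt side σ false .cross + 1 := by
  induction hn : cnt side σ true .cross + cnt side σ false .cross using Nat.strong_induction_on
    generalizing σ t with
  | _ n ih =>
  have hk' : kind side t σ.hd = .home := by simp [kind_eq_home, ht]
  have hne : σ.nx t ≠ some t := fun h => hσ.2 t t h ht
  have hc : ∀ a κ, cnt side (σ.star t) a κ +
      (if side t = a ∧ kind side t (σ.nx t) = κ then 1 else 0) =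
      cnt side σ a κ + (if side t = a ∧ SlotKind.home = κ then 1 else 0) := by
    intro a κ
    have := cnt_update side σ.nx (σ.nx t) σ.hd (!σ.sg) σ.sg t σ.hd a κ
    rw [hk'] at this
    exact this
  by_cases hcr : kind side t (σ.nx t) = .cross
  · obtain ⟨u, hu, hus⟩ := (kind_eq_cross side).1 hcr
    have hdec : cnt side (σ.star t) true .cross + cnt side (σ.star t) false .cross + 1 = n := by
      have h1 := hc true .cross
      have h2 := hc false .cross
      rw [hcr] at h1 h2
      rw [← hn]
      cases hst : side t <;> simp [hst] at h1 h2 <;> omega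
    obtain ⟨H, e, hR, hV, hE, hG, hS, hC⟩ := ih _ (by omega) (hσ.star t) (t := u)
      (by simp [star, hu]) (by simp [star, hus, hs]) rfl
    -- After the first move `t` is home, while the rest of the run passes only slots that are not.
    have htH : t ∉ H := by
      intro htH
      have hh : kind side t ((σ.star t).nx t) = .home := by simp [star, hk']
      by_cases hte : t = e
      · have := hR.end_kind
        rw [← hte, hh] at this
        simp at this
      · have := (hR.step t htH hte).1
        rw [hh] at this
        simp at this
    have hnx : ∀ i ∈ H, (σ.star t).nx i = σ.nx i := by
      intro i hi
      have : i ≠ t := by rintro rfl; exact htH hi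
      simp [star, Function.update_of_ne this]
    have hfill : σ.fill side (insert t H) e = (σ.star t).fill side H e := by
      simp only [fill, hnx e hR.end_mem, SortState.mk.injEq, and_true]
      funext i
      by_cases hit : i = t
      · subst hit; simp [htH, star, ht]
      · simp [hit, star]
    refine ⟨insert t H, e, ⟨Finset.mem_insert_of_mem hR.end_mem, ⟨t, by simp, ht⟩, ?_, ?_, ?_⟩, ?_,
      ?_, ?_, ?_, ?_⟩
    · rw [← hnx e hR.end_mem]; exact hR.end_kind
    · intro h hh hhe
      by_cases hht : h = t
      · subst hht
        obtain ⟨v, hv, e'⟩ := hR.hd_mem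
        refine ⟨hcr, v, Finset.mem_insert_of_mem hv, ?_⟩
        simpa [star] using e'
      · have hhH : h ∈ H := (Finset.mem_insert.1 hh).resolve_left hht
        obtain ⟨h1, h', hh', e'⟩ := hR.step h hhH hhe
        rw [hnx h hhH] at h1 e'
        exact ⟨h1, h', Finset.mem_insert_of_mem hh', e'⟩
    · intro D hD hstep
      have htD := hD t ht
      have hte : t ≠ e := by rintro rfl; exact htH hR.end_mem
      refine Finset.insert_subset htD (hR.minimal D ?_ ?_)
      · intro v hv
        exact hstep t htD hte v (by simpa [star] using hv)
      · intro d hd hde d' hd'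
        by_cases hdt : d = t
        · subst hdt
          simp only [star, Function.update_self, ht, Option.some.injEq] at hd'
          exact hd' ▸ htD
        · exact hstep d hd hde d' (by simpa [star, Function.update_of_ne hdt] using hd')
    · rw [hfill]; exact hV
    · rw [hfill, hE, ext_star]
    · intro N hN
      rw [hfill] at hN
      rw [Finset.card_insert_of_notMem htH]
      exact .star t hs (hG N hN)
    · intro a κ hκ
      rw [hfill, ← hnx e hR.end_mem]
      have h1 := hS a κ hκ
      have h2 := hc a κ
      rw [hcr] at h2
      rcases hκ with rfl | rfl <;> simp at h2 <;> omega
    · rw [hfill, Finset.card_insert_of_notMem htH]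
      omega
  · have hfill : σ.fill side {t} t = σ.star t := by
      simp only [fill, star, hs, SortState.mk.injEq, and_true]
      funext i
      by_cases hit : i = t
      · subst hit; simp [ht]
      · simp [hit]
    have hk : kind side t (σ.nx t) = .same ∨ kind side t (σ.nx t) = .blank := by
      have : kind side t (σ.nx t) ≠ .home := by rwa [Ne, kind_eq_home]
      revert hcr this
      cases kind side t (σ.nx t) <;> simp
    refine ⟨{t}, t, ⟨by simp, ⟨t, by simp, ht⟩, hk, ?_, ?_⟩, ?_, ?_, ?_, ?_, ?_⟩
    · intro h hh hne'
      exact absurd (Finset.mem_singleton.1 hh) hne'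
    · intro D hD _
      simpa using hD t ht
    · rw [hfill]; exact hσ.star t
    · rw [hfill, ext_star]
    · intro N hN
      rw [hfill] at hN
      exact .star t hs (by simpa using hN)
    · intro a κ hκ
      rw [hfill]
      have := hc a κ
      rcases hκ with rfl | rfl <;> simpa using this
    · rw [hfill]
      have h1 := hc true .cross
      have h2 := hc false .cross
      simp [hcr] at h1 h2
      simp
      omega

/-- The slots of `H` are home afterwards, so a closed set of crossed slots avoids `H` and was closed
before the run. -/
theorem Hitting.fill {σ : SortState ι} {T : Finset ι} (h : Hitting side σ T) (H : Finset ι) (e : ι) :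
    Hitting side (σ.fill side H e) (T \ H) := by
  refine ⟨fun t ht => ?_, fun C hC => h.2 C fun c hc => ?_⟩
  · rw [Finset.mem_sdiff] at ht
    simpa [SortState.fill, ht.2] using h.1 t ht.1
  · obtain ⟨h1, h2, h3⟩ := hC c hc
    have hcH : c ∉ H := by
      intro hcH
      have : kind side c ((σ.fill side H e).nx c) = .home := by
        simp [SortState.fill, hcH, kind_eq_home]
      rw [this] at h1
      simp at h1
    rw [Finset.mem_sdiff, not_and_not_right] at h2
    simp only [SortState.fill, hcH, if_false] at h1 h3
    exact ⟨h1, fun hT => hcH (h2 hT), h3⟩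

end SortState

/-! ### The potential, the list of cases, and tools for the induction -/

namespace SortState

variable {ι : Type*} [Fintype ι] [DecidableEq ι] {side : ι → Bool}

variable (side) in
/-- The number of slots on side `a` that are not home. -/
def size (σ : SortState ι) (a : Bool) : ℕ :=
  cnt side σ a .same + cnt side σ a .cross + cnt side σ a .blank

variable (side) in
/-- The basic number of star moves that a state with a hitting set `T` calls for. -/
def pot (σ : SortState ι) (T : Finset ι) : ℕ :=
  2 * (extCnt side σ true + extCnt side σ false + cnt side σ true .same + cnt side σ false .same) +
    (cnt side σ true .cross + cnt side σ false .cross) +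
    2 * (hdCnt side σ true + hdCnt side σ false) + T.card

variable (side) in
/-- The basic number of star moves plus the difference of the sizes of the two sides. -/
def val (σ : SortState ι) (T : Finset ι) : ℕ :=
  pot side σ T + (size side σ true - size side σ false) + (size side σ false - size side σ true)

variable (side) in
/-- The cost of entering side `a`: it is saved if only crossed slots are left there and `T` provides
an entry. -/
def entry (σ : SortState ι) (T : Finset ι) (a : Bool) : ℕ :=
  if cnt side σ a .same + cnt side σ a .blank = 0 ∧ ∃ t ∈ T, side t = a then 0 else 1

variable (side) in
/-- The symbols that stay on side `a` permute their slots. -/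
def ClosedSame (σ : SortState ι) (a : Bool) : Prop :=
  ∀ q ∈ slots side σ a .same, ∃ q' ∈ slots side σ a .same, σ.nx q = some q'

theorem pot_eq (σ : SortState ι) (T : Finset ι) {a b : Bool} (hab : b = !a) :
    pot side σ T = 2 * (extCnt side σ a + extCnt side σ b + cnt side σ a .same +
      cnt side σ b .same) + (cnt side σ a .cross + cnt side σ b .cross) +
      2 * (hdCnt side σ a + hdCnt side σ b) + T.card := by
  subst hab
  cases a
  · simp only [pot, Bool.not_false]; omega
  · simp only [pot, Bool.not_true]

theorem val_eq (σ : SortState ι) (T : Finset ι) {a b : Bool} (hab : b = !a) :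
    val side σ T = pot side σ T +
      (cnt side σ a .same + cnt side σ a .cross + cnt side σ a .blank -
        (cnt side σ b .same + cnt side σ b .cross + cnt side σ b .blank)) +
      (cnt side σ b .same + cnt side σ b .cross + cnt side σ b .blank -
        (cnt side σ a .same + cnt side σ a .cross + cnt side σ a .blank)) := by
  subst hab
  cases a
  · simp only [val, size, Bool.not_false]; omega
  · simp only [val, size, Bool.not_true]

theorem entry_add (σ : SortState ι) (T : Finset ι) {a b : Bool} (hab : b = !a) :
    entry side σ T true + entry side σ T false = entry side σ T a + entry side σ T b := by
  subst hab
  cases a <;> simp [add_comm]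

theorem entry_le_one (σ : SortState ι) (T : Finset ι) (a : Bool) : entry side σ T a ≤ 1 := by
  unfold entry; split_ifs <;> simp

theorem entry_eq_one {σ : SortState ι} {T : Finset ι} {a : Bool}
    (h : 0 < cnt side σ a .same + cnt side σ a .blank) : entry side σ T a = 1 := by
  unfold entry; rw [if_neg]; omega

theorem entry_eq_one_of_card {σ : SortState ι} {T : Finset ι} {a : Bool}
    (h : T.card = 0) : entry side σ T a = 1 := by
  rw [Finset.card_eq_zero] at h
  simp [entry, h]

theorem entry_eq_zero {σ : SortState ι} {T : Finset ι} {t : ι} {a : Bool}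
    (h : cnt side σ a .same + cnt side σ a .blank = 0) (ht : t ∈ T) (hta : side t = a) :
    entry side σ T a = 0 := if_pos ⟨h, t, ht, hta⟩

theorem extCnt_eq_zero {σ : SortState ι} (h : σ.ext = ∅) (a : Bool) : extCnt side σ a = 0 := by
  simp [extCnt, h]

theorem extCnt_add (σ : SortState ι) {a b : Bool} (hab : b = !a) :
    extCnt side σ a + extCnt side σ b = σ.ext.card := by
  unfold extCnt
  rw [← Finset.card_filter_add_card_filter_not (s := σ.ext) (fun t => side t = a)]
  congr 2
  ext t
  simp [hab, Bool.eq_not]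

theorem extCnt_pos {σ : SortState ι} {t : ι} (h : t ∈ σ.ext) : 0 < extCnt side σ (side t) :=
  Finset.card_pos.2 ⟨t, by simp [h]⟩

theorem exists_of_cnt_pos {σ : SortState ι} {a : Bool} {κ : SlotKind} (h : 0 < cnt side σ a κ) :
    ∃ i, side i = a ∧ kind side i (σ.nx i) = κ := by
  obtain ⟨i, hi⟩ := Finset.card_pos.1 h
  exact ⟨i, (mem_slots side).1 hi⟩

theorem cnt_pos {σ : SortState ι} {a : Bool} {κ : SlotKind} {i : ι} (h : side i = a)
    (h' : kind side i (σ.nx i) = κ) : 0 < cnt side σ a κ :=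
  Finset.card_pos.2 ⟨i, (mem_slots side).2 ⟨h, h'⟩⟩

theorem kind_ne_of_cnt {σ : SortState ι} {a : Bool} {κ : SlotKind} {i : ι}
    (h : cnt side σ a κ = 0) (hi : side i = a) : kind side i (σ.nx i) ≠ κ := fun h' =>
  (cnt_pos hi h').ne' h

variable (side) in
/-- Cases in which `N` star moves are enough.  Unless there are outside symbols left, `a` and `b`
are the two sides in a suitable order. -/
inductive Cap (σ : SortState ι) (T : Finset ι) (N : ℕ) : Prop
  | outside (hd : ∀ x, σ.hd = some x → side x = !σ.sg) (hw : σ.ext.Nonempty)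
      (h : val side σ T + entry side σ T true + entry side σ T false ≤ N)
  -- Blank head and no outside symbols: by `balance` no slot is blank. Contents of kind `same` occur
  -- nowhere (Pure), only on side `a` (One if `b` has crossed slots, Solo if `b` is sorted), or on
  -- both sides (Both). Opp marks that the sign is that of `b`.
  | blankPure (hd : σ.hd = none) (hw : σ.ext = ∅) {a b : Bool} (hab : b = !a)
      (ha : cnt side σ a .same = 0) (hb : cnt side σ b .same = 0) (h : pot side σ T ≤ N)
  | blankOne (hd : σ.hd = none) (hw : σ.ext = ∅) {a b : Bool} (hab : b = !a)
      (hs : σ.sg = a) (hb : cnt side σ b .same = 0) (ha : 0 < cnt side σ a .same)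
      (hc : 0 < cnt side σ b .cross) (h : val side σ T + 1 ≤ N)
  | blankOneOpp (hd : σ.hd = none) (hw : σ.ext = ∅) {a b : Bool} (hab : b = !a)
      (hs : σ.sg = b) (hb : cnt side σ b .same = 0) (ha : 0 < cnt side σ a .same)
      (hc : 0 < cnt side σ b .cross) (h : val side σ T + 1 ≤ N)
      (h' : T.card = 0 ∨ ClosedSame side σ a → val side σ T + 2 ≤ N)
  | blankSolo (hd : σ.hd = none) (hw : σ.ext = ∅) {a b : Bool} (hab : b = !a)
      (hs : σ.sg = a) (hb : cnt side σ b .same = 0) (ha : 0 < cnt side σ a .same)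
      (hc : cnt side σ b .cross = 0) (h : val side σ T + 2 ≤ N)
  | blankSoloOpp (hd : σ.hd = none) (hw : σ.ext = ∅) {a b : Bool} (hab : b = !a)
      (hs : σ.sg = b) (hb : cnt side σ b .same = 0) (ha : 0 < cnt side σ a .same)
      (hc : cnt side σ b .cross = 0) (h : val side σ T + 3 ≤ N)
  | blankBoth (hd : σ.hd = none) (hw : σ.ext = ∅) {a b : Bool} (hab : b = !a)
      (hs : σ.sg = a) (ha : 0 < cnt side σ a .same) (hb : 0 < cnt side σ b .same)
      (h : val side σ T + 2 ≤ N) (h' : size side σ a ≤ size side σ b → val side σ T + 3 ≤ N)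
  -- A symbol at the head and no outside symbols: by `balance` exactly one slot is blank. The sign
  -- always forbids the head to go home. The head is bound for the side `a` that has contents of
  -- kind `same` (fwd), or for the other side `b` (back); the blank lies on `b` (Near) or on `a`
  -- (Far). An empty `T` is charged extra, since entering a side may force an element into `T`.
  | pure {x : ι} (hd : σ.hd = some x) (hw : σ.ext = ∅) {a b : Bool} (hab : b = !a)
      (hx : side x = a) (hs : σ.sg = b) (ha : cnt side σ a .same = 0) (hb : cnt side σ b .same = 0)
      (hc : 0 < cnt side σ b .cross + cnt side σ b .blank) (h : pot side σ T ≤ N)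
      (h' : T.card = 0 → pot side σ T + 1 ≤ N)
  | solo {x : ι} (hd : σ.hd = some x) (hw : σ.ext = ∅) {a b : Bool} (hab : b = !a)
      (hx : side x = a) (hs : σ.sg = b) (hb : size side σ b = 0) (h : val side σ T + 2 ≤ N)
  | fwdFar {x : ι} (hd : σ.hd = some x) (hw : σ.ext = ∅) {a b : Bool} (hab : b = !a)
      (hx : side x = a) (hs : σ.sg = b) (hb : cnt side σ b .same = 0) (ha : 0 < cnt side σ a .same)
      (hB : cnt side σ b .blank = 0) (hc : 0 < cnt side σ b .cross) (h : val side σ T ≤ N)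
      (h1 : T.card = 0 ∨ ClosedSame side σ a → val side σ T + 1 ≤ N)
      (h2 : T.card = 0 → ClosedSame side σ a → val side σ T + 2 ≤ N)
  | fwdNear {x : ι} (hd : σ.hd = some x) (hw : σ.ext = ∅) {a b : Bool} (hab : b = !a)
      (hx : side x = a) (hs : σ.sg = b) (hb : cnt side σ b .same = 0) (ha : 0 < cnt side σ a .same)
      (hB : 0 < cnt side σ b .blank) (h : val side σ T + 1 ≤ N)
      (h' : T.card = 0 → val side σ T + 2 ≤ N)
  | backFar {x : ι} (hd : σ.hd = some x) (hw : σ.ext = ∅) {a b : Bool} (hab : b = !a)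
      (hx : side x = b) (hs : σ.sg = a) (hb : cnt side σ b .same = 0) (ha : 0 < cnt side σ a .same)
      (hB : cnt side σ b .blank = 0) (h : val side σ T ≤ N)
      (h' : T.card = 0 → 2 ≤ cnt side σ a .same → val side σ T + 1 ≤ N)
  | backNear {x : ι} (hd : σ.hd = some x) (hw : σ.ext = ∅) {a b : Bool} (hab : b = !a)
      (hx : side x = b) (hs : σ.sg = a) (hb : cnt side σ b .same = 0) (ha : 0 < cnt side σ a .same)
      (hB : 0 < cnt side σ b .blank) (h : val side σ T + 1 ≤ N)
      (h' : T.card = 0 → val side σ T + 2 ≤ N)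
  | both {x : ι} (hd : σ.hd = some x) (hw : σ.ext = ∅) {a b : Bool} (hab : b = !a)
      (hs : side x = !σ.sg) (ha : 0 < cnt side σ a .same) (hb : 0 < cnt side σ b .same)
      (hB : 0 < cnt side σ a .blank) (h : val side σ T + 1 ≤ N)
      (h' : size side σ a ≤ size side σ b → val side σ T + 2 ≤ N)

variable (side) in
/-- Every state that falls under one of the cases for `N` can be sorted with `N` star moves. -/
def Claim (N : ℕ) : Prop :=
  ∀ (σ : SortState ι) (T : Finset ι), σ.Valid → Hitting side σ T → Cap side σ T N → Good side σ N

theorem Good.of_star {σ : SortState ι} {i : ι} {N : ℕ} (hN : 1 ≤ N) (hi : side i = σ.sg)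
    (h : Good side (σ.star i) (N - 1)) : Good side σ N := by
  obtain ⟨M, rfl⟩ : ∃ M, N = M + 1 := ⟨N - 1, by omega⟩
  exact .star i hi h

/-- The successor of a crossed slot is not home. -/
theorem Valid.kind_succ {σ : SortState ι} (hσ : σ.Valid) {t l : ι} (h : σ.nx t = some l)
    (ht : kind side t (σ.nx t) ≠ .home) : kind side l (σ.nx l) ≠ .home := by
  intro hl
  rw [kind_eq_home] at hl
  have := hσ.1 _ _ _ h hl
  subst this
  exact ht ((kind_eq_home side).2 h)

theorem Valid.kind_head {σ : SortState ι} (hσ : σ.Valid) {x : ι} (h : σ.hd = some x) :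
    kind side x (σ.nx x) ≠ .home := by
  intro hl
  rw [kind_eq_home] at hl
  exact hσ.2 _ _ hl h

/-- A hitting set can be rearranged to provide an entry on side `b`. -/
theorem Hitting.shift {σ : SortState ι} {T : Finset ι} (hσ : σ.Valid) (hT : Hitting side σ T)
    (hne : 0 < T.card) {b : Bool} (hS : cnt side σ b .same = 0) :
    ∃ p T', side p = b ∧ Hitting side σ T' ∧ (insert p T').card ≤ T.card ∧
      (kind side p (σ.nx p) = .cross ∧ p ∈ T' ∨ kind side p (σ.nx p) = .blank) := by
  obtain ⟨t, ht⟩ := Finset.card_pos.1 hne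
  by_cases hb : side t = b
  · exact ⟨t, T, hb, hT, by simp [ht], .inl ⟨hT.1 t ht, ht⟩⟩
  -- The successor of a crossed slot lies on the other side, thus on `b`. It takes the place of `t`
  -- if it is crossed; otherwise it is blank and `t` lies on no cycle.
  · obtain ⟨l, hl, hls⟩ := (kind_eq_cross side).1 (hT.1 t ht)
    have hlb : side l = b := by rw [hls]; simpa [Bool.eq_not] using hb
    have h1 : kind side l (σ.nx l) ≠ .home := hσ.kind_succ hl (by rw [hT.1 t ht]; simp)
    have h2 := kind_ne_of_cnt hS hlb
    have hc : (insert l (T.erase t)).card ≤ T.card := by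
      refine (Finset.card_insert_le _ _).trans ?_
      rw [Finset.card_erase_of_mem ht]; omega
    by_cases h3 : kind side l (σ.nx l) = .cross
    · refine ⟨l, _, hlb, hT.swap ht hl h3, by simpa using hc, .inl ⟨h3, by simp⟩⟩
    · refine ⟨l, _, hlb, hT.drop hl h3, hc, .inr ?_⟩
      revert h1 h2 h3
      cases kind side l (σ.nx l) <;> simp

/-- A slot for entering side `b` with a head that belongs on side `a`. -/
theorem Hitting.acquire {σ : SortState ι} {T : Finset ι} (hσ : σ.Valid) (hT : Hitting side σ T)
    {a b : Bool} (hab : b = !a) {x : ι} (hx : σ.hd = some x) (hxa : side x = a)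
    (hS : cnt side σ b .same = 0) (hpos : 0 < cnt side σ b .cross + cnt side σ b .blank) :
    ∃ p T', side p = b ∧ p ∈ T' ∧ Hitting side (σ.star p) T' ∧ (T'.card ≤ 1 ∨ T'.card ≤ T.card) ∧
      kind side p σ.hd = .cross ∧
      (kind side p (σ.nx p) = .cross ∨ kind side p (σ.nx p) = .blank) ∧
      (T.card = 0 → 0 < cnt side σ b .blank → kind side p (σ.nx p) = .blank) := by
  have hk : ∀ p, side p = b → kind side p σ.hd = .cross := by
    intro p hp
    rw [kind_eq_cross]
    exact ⟨x, hx, by simp [hp, hab, hxa]⟩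
  by_cases hT0 : T.card = 0
  · have : ∃ p, side p = b ∧ (kind side p (σ.nx p) = .cross ∨ kind side p (σ.nx p) = .blank) ∧
        (0 < cnt side σ b .blank → kind side p (σ.nx p) = .blank) := by
      -- A blank slot is preferred when `T` is empty: filling it sends no further symbol to the
      -- head, and the new element of `T` is paid for by the surcharge.
      by_cases hB : 0 < cnt side σ b .blank
      · obtain ⟨p, h1, h2⟩ := exists_of_cnt_pos hB
        exact ⟨p, h1, .inr h2, fun _ => h2⟩
      · obtain ⟨p, h1, h2⟩ := exists_of_cnt_pos (side := side) (σ := σ) (a := b) (κ := .cross)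
          (by omega)
        exact ⟨p, h1, .inl h2, fun h => absurd h hB⟩
    obtain ⟨p, h1, h2, h3⟩ := this
    rw [Finset.card_eq_zero] at hT0
    subst hT0
    exact ⟨p, {p}, h1, by simp, by simpa using hT.star_insert (hk p h1), .inl (by simp), hk p h1,
      h2, fun _ => h3⟩
  · obtain ⟨p, T', h1, h2, h3, h4⟩ := hT.shift hσ (by omega) hS
    exact ⟨p, insert p T', h1, by simp, h2.star_insert (hk p h1), .inr h3, hk p h1,
      h4.imp (·.1) id, fun h => absurd h hT0⟩

/-- The outcome of a run, with the effect on the counts. -/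
structure RunResult (side : ι → Bool) (σ : SortState ι) (T : Finset ι) (a b : Bool)
    (H : Finset ι) (e : ι) (φ : SortState ι) : Prop where
  run : IsRun side σ H e
  eq : φ = σ.fill side H e
  valid : φ.Valid
  hitting : Hitting side φ (T \ H)
  ext_eq : φ.ext = σ.ext
  good : ∀ N M, M + H.card ≤ N → Good side φ M → Good side σ N
  one_le : 1 ≤ H.card
  ext_a : extCnt side φ a = extCnt side σ a
  ext_b : extCnt side φ b = extCnt side σ b
  cross : cnt side φ a .cross + cnt side φ b .cross + H.card =
    cnt side σ a .cross + cnt side σ b .cross + 1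
  card_le : (T \ H).card ≤ T.card
  card_lt : ∀ p ∈ T, p ∈ H → (T \ H).card + 1 ≤ T.card
  bal : cnt side φ b .cross + extCnt side φ a + hdCnt side φ a =
        cnt side φ a .cross + cnt side φ a .blank ∧
      cnt side φ a .cross + extCnt side φ b + hdCnt side φ b =
        cnt side φ b .cross + cnt side φ b .blank
  ends :
    (∃ y, φ.hd = some y ∧ side y = a ∧ φ.sg = b ∧ side e = a ∧ kind side e (σ.nx e) = .same ∧
      cnt side φ a .same + 1 = cnt side σ a .same ∧ cnt side φ b .same = cnt side σ b .same ∧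
      cnt side φ a .blank = cnt side σ a .blank ∧ cnt side φ b .blank = cnt side σ b .blank ∧
      hdCnt side φ a = 1 ∧ hdCnt side φ b = 0) ∨
    (∃ y, φ.hd = some y ∧ side y = b ∧ φ.sg = a ∧ side e = b ∧ kind side e (σ.nx e) = .same ∧
      cnt side φ a .same = cnt side σ a .same ∧ cnt side φ b .same + 1 = cnt side σ b .same ∧
      cnt side φ a .blank = cnt side σ a .blank ∧ cnt side φ b .blank = cnt side σ b .blank ∧
      hdCnt side φ a = 0 ∧ hdCnt side φ b = 1) ∨
    (φ.hd = none ∧ φ.sg = b ∧ side e = a ∧ kind side e (σ.nx e) = .blank ∧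
      cnt side φ a .same = cnt side σ a .same ∧ cnt side φ b .same = cnt side σ b .same ∧
      cnt side φ a .blank + 1 = cnt side σ a .blank ∧ cnt side φ b .blank = cnt side σ b .blank ∧
      hdCnt side φ a = 0 ∧ hdCnt side φ b = 0) ∨
    (φ.hd = none ∧ φ.sg = a ∧ side e = b ∧ kind side e (σ.nx e) = .blank ∧
      cnt side φ a .same = cnt side σ a .same ∧ cnt side φ b .same = cnt side σ b .same ∧
      cnt side φ a .blank = cnt side σ a .blank ∧ cnt side φ b .blank + 1 = cnt side σ b .blank ∧
      hdCnt side φ a = 0 ∧ hdCnt side φ b = 0)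

theorem exists_runResult {σ : SortState ι} {T : Finset ι} (hσ : σ.Valid) (hT : Hitting side σ T)
    {a b : Bool} (hab : b = !a) {t : ι} (ht : σ.hd = some t) (hs : side t = σ.sg) :
    ∃ H e φ, RunResult side σ T a b H e φ := by
  obtain ⟨H, e, hR, hV, hE, hG, hS, hC⟩ := exists_run hσ ht hs
  have hba : a = !b := by simp [hab]
  refine ⟨H, e, σ.fill side H e, hR, rfl, hV, hT.fill H e, hE,
    fun N M hNM h => (hG M h).mono hNM, Finset.card_pos.2 ⟨e, hR.end_mem⟩, by simp [extCnt, hE],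
    by simp [extCnt, hE], ?_, Finset.card_le_card Finset.sdiff_subset, ?_, balance_both hV hab, ?_⟩
  · subst hab
    cases a <;> simp only [Bool.not_false, Bool.not_true] <;> omega
  · intro p hp hpH
    have : T \ H ⊆ T.erase p := by
      intro i hi
      rw [Finset.mem_sdiff] at hi
      exact Finset.mem_erase.2 ⟨by rintro rfl; exact hi.2 hpH, hi.1⟩
    have := Finset.card_le_card this
    rw [Finset.card_erase_of_mem hp] at this
    have := Finset.card_pos.2 ⟨p, hp⟩
    omega
  · have s1 := hS a .same (.inl rfl)
    have s2 := hS b .same (.inl rfl)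
    have s3 := hS a .blank (.inr rfl)
    have s4 := hS b .blank (.inr rfl)
    have hhd : (σ.fill side H e).hd = σ.nx e := rfl
    have hsg : (σ.fill side H e).sg = !side e := rfl
    have hside : side e = a ∨ side e = b := by
      subst hab; cases side e <;> cases a <;> simp
    have hne : a ≠ b := by subst hab; cases a <;> simp
    rcases hR.end_kind with hk | hk
    · obtain ⟨y, hy, -, hys⟩ := (kind_eq_same side).1 hk
      rw [hk] at s1 s2 s3 s4
      rcases hside with he | he
      · have := hdCnt_some (side := side) (a := a) (hhd.trans hy) (hys.trans he)
        simp [he, hne] at s1 s2 s3 s4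
        exact .inl ⟨y, hhd.trans hy, hys.trans he, by rw [hsg, he, hab], he, hk, s1, s2, s3, s4,
          this.1, this.2 b hab⟩
      · have := hdCnt_some (side := side) (a := b) (hhd.trans hy) (hys.trans he)
        simp [he, hne.symm] at s1 s2 s3 s4
        exact .inr (.inl ⟨y, hhd.trans hy, hys.trans he, by rw [hsg, he, hba], he, hk, s1, s2, s3,
          s4, this.2 a hba, this.1⟩)
    · have hn := (kind_eq_blank side).1 hk
      have := fun c => hdCnt_none (side := side) (hhd.trans hn) c
      rw [hk] at s1 s2 s3 s4
      rcases hside with he | he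
      · simp [he, hne] at s1 s2 s3 s4
        exact .inr (.inr (.inl ⟨hhd.trans hn, by rw [hsg, he, hab], he, hk, s1, s2, s3, s4,
          this _, this _⟩))
      · simp [he, hne.symm] at s1 s2 s3 s4
        exact .inr (.inr (.inr ⟨hhd.trans hn, by rw [hsg, he, hba], he, hk, s1, s2, s3, s4,
          this _, this _⟩))

/-- The outcome of a star move, with the effect on the counts. -/
theorem star_result {σ : SortState ι} (hσ : σ.Valid) {a b : Bool} (hab : b = !a) {i : ι}
    (hi : side i = a) (hs : σ.sg = a) {κ κ' : SlotKind}
    (h : kind side i (σ.nx i) = κ) (h' : kind side i σ.hd = κ') :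
    ((σ.star i).Valid ∧ (σ.star i).ext = σ.ext ∧ (σ.star i).sg = b ∧ (σ.star i).hd = σ.nx i) ∧
    (cnt side (σ.star i) b .cross + extCnt side (σ.star i) a + hdCnt side (σ.star i) a =
        cnt side (σ.star i) a .cross + cnt side (σ.star i) a .blank ∧
      cnt side (σ.star i) a .cross + extCnt side (σ.star i) b + hdCnt side (σ.star i) b =
        cnt side (σ.star i) b .cross + cnt side (σ.star i) b .blank) ∧
    (cnt side (σ.star i) a .same + (if κ = .same then 1 else 0) =
        cnt side σ a .same + (if κ' = .same then 1 else 0)) ∧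
    (cnt side (σ.star i) a .cross + (if κ = .cross then 1 else 0) =
        cnt side σ a .cross + (if κ' = .cross then 1 else 0)) ∧
    (cnt side (σ.star i) a .blank + (if κ = .blank then 1 else 0) =
        cnt side σ a .blank + (if κ' = .blank then 1 else 0)) ∧
    cnt side (σ.star i) b .same = cnt side σ b .same ∧
    cnt side (σ.star i) b .cross = cnt side σ b .cross ∧
    cnt side (σ.star i) b .blank = cnt side σ b .blank ∧
    extCnt side (σ.star i) a = extCnt side σ a ∧
    extCnt side (σ.star i) b = extCnt side σ b := by
  refine ⟨⟨hσ.star i, ext_star σ i, ?_, rfl⟩, balance_both (hσ.star i) hab,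
    star_counts σ hab hi h h'⟩
  simp [star, hs, hab]

/-- If no successor within `A` were the sole successor of another element for an arbitrary `q`,
follow any other element one step: its successor serves as `q`. Emptying slot `q` then leaves a
`same` content whose home slot is no longer in the set, so the rest cannot permute its slots. -/
theorem exists_erase_not_closed {A : Finset ι} (hA : A.Nonempty) {f : ι → Option ι}
    (hf : ∀ i ∈ A, f i ≠ some i) :
    ∃ q ∈ A, A = {q} ∨ ∃ q' ∈ A, q' ≠ q ∧ ∀ q'' ∈ A, f q' = some q'' → q'' = q := by
  obtain ⟨q, hq⟩ := hA
  by_cases h1 : A = {q}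
  · exact ⟨q, hq, .inl h1⟩
  by_cases h2 : ∃ q' ∈ A, q' ≠ q ∧ ∀ q'' ∈ A, f q' = some q'' → q'' = q
  · exact ⟨q, hq, .inr h2⟩
  push Not at h2
  obtain ⟨q', hq', hne⟩ : ∃ q' ∈ A, q' ≠ q := by
    by_contra hcon
    push Not at hcon
    exact h1 (Finset.eq_singleton_iff_unique_mem.2 ⟨hq, hcon⟩)
  obtain ⟨r, hr, hfr, -⟩ := h2 q' hq' hne
  refine ⟨r, hr, .inr ⟨q', hq', ?_, fun s _ hs => ?_⟩⟩
  · rintro rfl; exact hf _ hq' hfr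
  · exact Option.some_injective _ (hs.symm.trans hfr)

/-- Slot `q` stops being of kind `same`, but the content of `q'` is bound for `q` or for no slot of
kind `same` at all. -/
theorem not_closedSame_star {σ : SortState ι} {a : Bool} {q q' : ι}
    (hq' : q' ∈ slots side σ a .same) (hne : q' ≠ q)
    (h : ∀ r ∈ slots side σ a .same, σ.nx q' = some r → r = q)
    (hk : kind side q σ.hd ≠ .same) :
    ¬ ClosedSame side (σ.star q) a := by
  intro hcl
  rw [mem_slots] at hq'
  obtain ⟨r, hr, e⟩ := hcl q' ((mem_slots side).2 ⟨hq'.1, by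
    simpa [star, Function.update_of_ne hne] using hq'.2⟩)
  rw [mem_slots] at hr
  have hrq : r ≠ q := by
    rintro rfl
    exact hk (by simpa [star] using hr.2)
  refine hrq (h r ((mem_slots side).2 ⟨hr.1, by
    simpa [star, Function.update_of_ne hrq] using hr.2⟩) ?_)
  simpa [star, Function.update_of_ne hne] using e

/-- The destination of a `same` content is on the same side and, by injectivity, not home; nothing
but kind `same` is left for it. -/
theorem closedSame_of_cnt {σ : SortState ι} (hσ : σ.Valid) {a : Bool}
    (hc : cnt side σ a .cross = 0) (hb : cnt side σ a .blank = 0) : ClosedSame side σ a := by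
  intro q hq
  rw [mem_slots] at hq
  obtain ⟨l, hl, -, hls⟩ := (kind_eq_same side).1 hq.2
  refine ⟨l, (mem_slots side).2 ⟨hls.trans hq.1, ?_⟩, hl⟩
  have h1 := hσ.kind_succ (side := side) hl (by rw [hq.2]; simp)
  have h2 := kind_ne_of_cnt hc (hls.trans hq.1)
  have h3 := kind_ne_of_cnt hb (hls.trans hq.1)
  revert h1 h2 h3
  cases kind side l (σ.nx l) <;> simp

/-- Away from a run that ends in a blank slot, nothing of kind `same` changes. -/
theorem slots_same_fill {σ : SortState ι} {H : Finset ι} {e : ι} (hR : IsRun side σ H e) (a : Bool) :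
    slots side (σ.fill side H e) a .same = (slots side σ a .same).erase e := by
  ext q
  simp only [Finset.mem_erase, mem_slots, fill]
  by_cases hq : q ∈ H
  · by_cases hqe : q = e
    · subst hqe; simp [hq, kind_eq_same]
    · have := (hR.step q hq hqe).1
      have hh : kind side q (some q) = .home := by simp [kind]
      simp [hq, hqe, this, hh]
  · have : q ≠ e := by rintro rfl; exact hq hR.end_mem
    simp [hq, this]

/-- A run ending in a blank passes only crossed slots and that blank, so the slots of kind `same`
and their contents are untouched. -/
theorem closedSame_of_fill {σ : SortState ι} {H : Finset ι} {e : ι} (hR : IsRun side σ H e)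
    (he : kind side e (σ.nx e) = .blank) {a : Bool} (h : ClosedSame side (σ.fill side H e) a) :
    ClosedSame side σ a := by
  have hs : slots side (σ.fill side H e) a .same = slots side σ a .same := by
    rw [slots_same_fill hR, Finset.erase_eq_of_notMem]
    rw [mem_slots, he]; simp
  intro q hq
  obtain ⟨q', hq', hfill⟩ := h q (hs ▸ hq)
  refine ⟨q', hs ▸ hq', ?_⟩
  have : q ∉ H := by
    intro hqH
    rw [mem_slots] at hq
    by_cases hqe : q = e
    · rw [hqe, he] at hq; simp at hq
    · rw [(hR.step q hqH hqe).1] at hq; simp at hq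
  simpa [fill, this] using hfill

theorem closedSame_of_star {σ : SortState ι} {a : Bool} {p : ι}
    (hp : side p ≠ a) (h : ClosedSame side (σ.star p) a) : ClosedSame side σ a := by
  have key : ∀ q, side q = a → (σ.star p).nx q = σ.nx q := by
    intro q hq
    have : q ≠ p := by rintro rfl; exact hp hq
    simp [star, Function.update_of_ne this]
  intro q hq
  rw [mem_slots] at hq
  obtain ⟨q', hq', hfill⟩ := h q ((mem_slots side).2 ⟨hq.1, by rw [key q hq.1]; exact hq.2⟩)
  rw [mem_slots] at hq'
  refine ⟨q', (mem_slots side).2 ⟨hq'.1, ?_⟩, ?_⟩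
  · rw [← key q' hq'.1]; exact hq'.2
  · rw [← key q hq.1]; exact hfill

/-- A crossed slot that stays crossed is passed by the run if no crossed slot of its side is left. -/
theorem RunResult.mem_of_cnt {σ φ : SortState ι} {T H : Finset ι} {a b : Bool} {e p : ι}
    (h : RunResult side σ T a b H e φ) (hp : kind side p (σ.nx p) = .cross)
    (hc : cnt side φ (side p) .cross = 0) : p ∈ H := by
  by_contra hpH
  refine kind_ne_of_cnt hc rfl ?_
  rw [h.eq]
  simpa [fill, hpH] using hp

end SortState

/-! ### Induction step: a symbol at the head, no outside symbols -/

namespace SortState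

variable {ι : Type*} [Fintype ι] [DecidableEq ι] {side : ι → Bool}

/-- Moving the head symbol to the other side and, if that brings up another symbol, running. -/
theorem Hitting.enter {σ : SortState ι} {T : Finset ι} (hσ : σ.Valid) (hT : Hitting side σ T)
    {a b : Bool} (hab : b = !a) {x : ι} (hx : σ.hd = some x) (hxa : side x = a) (hs : σ.sg = b)
    (hS : cnt side σ b .same = 0) (hpos : 0 < cnt side σ b .cross + cnt side σ b .blank) :
    ∃ p T', side p = b ∧ p ∈ T' ∧ 0 < T'.card ∧ (T'.card ≤ 1 ∨ T'.card ≤ T.card) ∧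
      (((σ.star p).Valid ∧ Hitting side (σ.star p) T' ∧ (σ.star p).ext = σ.ext ∧
          (σ.star p).sg = a ∧ (σ.star p).hd = none ∧
          cnt side (σ.star p) a .same = cnt side σ a .same ∧
          cnt side (σ.star p) a .cross = cnt side σ a .cross ∧
          cnt side (σ.star p) a .blank = cnt side σ a .blank ∧
          cnt side (σ.star p) b .same = cnt side σ b .same ∧
          cnt side (σ.star p) b .cross = cnt side σ b .cross + 1 ∧
          cnt side (σ.star p) b .blank + 1 = cnt side σ b .blank ∧
          extCnt side (σ.star p) a = extCnt side σ a ∧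
          extCnt side (σ.star p) b = extCnt side σ b ∧
          hdCnt side (σ.star p) a = 0 ∧ hdCnt side (σ.star p) b = 0) ∨
        (T.card = 0 → cnt side σ b .blank = 0) ∧
        ∃ H e φ, RunResult side (σ.star p) T' a b H e φ ∧
          kind side p ((σ.star p).nx p) = .cross ∧
          (σ.star p).ext = σ.ext ∧
          cnt side (σ.star p) a .same = cnt side σ a .same ∧
          cnt side (σ.star p) a .cross = cnt side σ a .cross ∧
          cnt side (σ.star p) a .blank = cnt side σ a .blank ∧
          cnt side (σ.star p) b .same = cnt side σ b .same ∧
          cnt side (σ.star p) b .cross = cnt side σ b .cross ∧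
          cnt side (σ.star p) b .blank = cnt side σ b .blank ∧
          extCnt side (σ.star p) a = extCnt side σ a ∧
          extCnt side (σ.star p) b = extCnt side σ b) := by
  have hba : a = !b := by simp [hab]
  obtain ⟨p, T', hp, hpT, hT', hcard, hk', hk, hbl⟩ := hT.acquire hσ hab hx hxa hS hpos
  refine ⟨p, T', hp, hpT, Finset.card_pos.2 ⟨p, hpT⟩, hcard, ?_⟩
  rcases hk with hk | hk
  · right
    obtain ⟨⟨hV, hE, hsg, hhd⟩, -, h1, h2, h3, h4, h5, h6, h7, h8⟩ := star_result hσ hba hp hs hk hk'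
    simp at h1 h2 h3
    obtain ⟨t, ht, hts⟩ := (kind_eq_cross side).1 hk
    obtain ⟨H, e, φ, hR⟩ := exists_runResult hV hT' hab (hhd.trans ht)
      (by rw [hts, hp, hsg, hba])
    refine ⟨fun h0 => ?_, H, e, φ, hR, by simpa [star] using hk', hE, h4, h5, h6, h1, h2, h3, h8,
      h7⟩
    by_contra hB
    have := hbl h0 (by omega)
    rw [hk] at this
    simp at this
  · left
    obtain ⟨⟨hV, hE, hsg, hhd⟩, -, h1, h2, h3, h4, h5, h6, h7, h8⟩ := star_result hσ hba hp hs hk hk'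
    simp at h1 h2 h3
    have hn := hhd.trans ((kind_eq_blank side).1 hk)
    exact ⟨hV, hT', hE, hsg, hn, h4, h5, h6, h1, h2, h3, h8, h7, hdCnt_none hn a, hdCnt_none hn b⟩

variable {N : ℕ} {σ : SortState ι} {T : Finset ι}

/-- Parking the head either fills the blank at once or starts a run, which can only end in the blank
as there is no content of kind `same`. Afterwards only cycles are left. The extra move for empty `T`
pays for the cycle that the parking may close. -/
theorem good_pure (IH : ∀ M < N, Claim side M) (hσ : σ.Valid) (hT : Hitting side σ T)
    {x : ι} (hd : σ.hd = some x) (hw : σ.ext = ∅) {a b : Bool} (hab : b = !a)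
    (hx : side x = a) (hs : σ.sg = b) (ha : cnt side σ a .same = 0) (hb : cnt side σ b .same = 0)
    (hc : 0 < cnt side σ b .cross + cnt side σ b .blank) (h : pot side σ T ≤ N)
    (h' : T.card = 0 → pot side σ T + 1 ≤ N) : Good side σ N := by
  have hh := hdCnt_some (side := side) hd hx
  have hh1 := hh.1
  have hh2 := hh.2 b hab
  have hp := pot_eq (side := side) σ T hab
  obtain ⟨p, T', hpb, hpT, hpos, hcard, hcase⟩ := hT.enter hσ hab hd hx hs hb hc
  rcases hcase with ⟨hV, hT', hE, hsg, hn, h1, h2, h3, h4, h5, h6, h7, h8, h9, h10⟩ |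
    ⟨hbl, H, e, φ, hR, hk, hE, h1, h2, h3, h4, h5, h6, h7, h8⟩
  · have hp' := pot_eq (side := side) (σ.star p) T' hab
    refine .of_star (i := p) (by omega) (by rw [hpb, hs]) (IH _ (by omega) _ _ hV hT' ?_)
    exact .blankPure hn (hE.trans hw) hab (by omega) (by omega) (by omega)
  · have hp' := pot_eq (side := side) φ (T' \ H) hab
    have b1 := hR.one_le
    have b2 := hR.ext_a
    have b3 := hR.ext_b
    have b4 := hR.cross
    have b5 := hR.card_le
    refine .of_star (i := p) (by omega) (by rw [hpb, hs])
      (hR.good _ (N - 1 - H.card) (by rcases hR.ends with h | h | h | h <;> omega) ?_)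
    refine IH _ (by omega) _ _ hR.valid hR.hitting ?_
    rcases hR.ends with ⟨y, hy⟩ | ⟨y, hy⟩ | hy | hy
    · omega
    · omega
    · exact .blankPure hy.1 (hR.ext_eq.trans (hE.trans hw)) hab (by omega) (by omega) (by omega)
    · exact .blankPure hy.1 (hR.ext_eq.trans (hE.trans hw)) hab (by omega) (by omega) (by omega)

set_option maxHeartbeats 800000 in
-- Side `b` has only crossed slots, so parking starts a run, and the run ends on `a`. In either
-- ending `val` falls by one more than the moves spent, because the surplus of `a` shrinks. If `b`
-- comes out sorted, the parking slot was passed and `T` loses it, which frees a second move;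
-- together they pay for re-entering `b`. Only an ending in the blank with closed `same` contents
-- needs the extra charge.
theorem good_fwdFar (IH : ∀ M < N, Claim side M) (hσ : σ.Valid) (hT : Hitting side σ T)
    {x : ι} (hd : σ.hd = some x) (hw : σ.ext = ∅) {a b : Bool} (hab : b = !a)
    (hx : side x = a) (hs : σ.sg = b) (hb : cnt side σ b .same = 0) (ha : 0 < cnt side σ a .same)
    (hB : cnt side σ b .blank = 0) (hc : 0 < cnt side σ b .cross) (h : val side σ T ≤ N)
    (h1 : T.card = 0 ∨ ClosedSame side σ a → val side σ T + 1 ≤ N)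
    (h2 : T.card = 0 → ClosedSame side σ a → val side σ T + 2 ≤ N) : Good side σ N := by
  have hh := hdCnt_some (side := side) hd hx
  have hh1 := hh.1
  have hh2 := hh.2 b hab
  have hp := pot_eq (side := side) σ T hab
  have hbal := balance_both (side := side) hσ hab
  have w1 := extCnt_eq_zero (side := side) hw a
  have w2 := extCnt_eq_zero (side := side) hw b
  have hv : val side σ T = pot side σ T + cnt side σ a .same + 1 := by
    rw [val_eq σ T hab]; omega
  obtain ⟨p, T', hpb, hpT, hpos, hcard, hcase⟩ := hT.enter hσ hab hd hx hs hb (by omega)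
  -- If `T` is empty, the parking slot may enlarge it to one element, which the surcharge covers.
  have hA : val side σ T + T'.card ≤ N + T.card := by
    clear hp hbal
    by_cases h0 : T.card = 0
    · have := h1 (.inl h0); omega
    · omega
  have hA' : ClosedSame side σ a → val side σ T + T'.card + 1 ≤ N + T.card := by
    intro hcl
    clear hp hbal
    have := h1 (.inr hcl)
    by_cases h0 : T.card = 0
    · have := h2 h0 hcl; omega
    · omega
  clear h h1 h2 hcard
  rcases hcase with ⟨hV, hT', hE, hsg, hn, k1, k2, k3, k4, k5, k6, k7, k8, k9, k10⟩ |
    ⟨hbl, H, e, φ, hR, hk, hE, k1, k2, k3, k4, k5, k6, k7, k8⟩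
  · omega
  · have hp' := pot_eq (side := side) φ (T' \ H) hab
    have b1 := hR.one_le
    have b2 := hR.ext_a
    have b3 := hR.ext_b
    have b4 := hR.cross
    have b5 := hR.card_le
    have b6 := hR.bal
    have hw' := hR.ext_eq.trans (hE.trans hw)
    clear hbl
    -- The parking slot is crossed after the parking; if no crossed slot of `b` survives the run, it
    -- was passed.
    have refund : cnt side φ b .cross = 0 → (T' \ H).card + 1 ≤ T'.card := fun h0 =>
      hR.card_lt p hpT (hR.mem_of_cnt hk (by rw [hpb]; exact h0))
    have hcl : kind side e ((σ.star p).nx e) = .blank → ClosedSame side φ a → ClosedSame side σ a := by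
      intro hke hcl
      rw [hR.eq] at hcl
      exact closedSame_of_star (by rw [hpb, hab]; simp) (closedSame_of_fill hR.run hke hcl)
    have hv' : val side φ (T' \ H) = pot side φ (T' \ H) + cnt side φ a .same + hdCnt side φ a := by
      rw [val_eq φ _ hab]
      rcases hR.ends with ⟨y, hy⟩ | ⟨y, hy⟩ | hy | hy <;> omega
    refine .of_star (i := p) (by omega) (by rw [hpb, hs])
      (hR.good _ (N - 1 - H.card) (by rcases hR.ends with h | h | h | h <;> omega) ?_)
    refine IH _ (by omega) _ _ hR.valid hR.hitting ?_
    rcases hR.ends with ⟨y, hy⟩ | ⟨y, hy⟩ | hy | hy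
    · by_cases hs0 : cnt side φ b .cross = 0
      · have := refund hs0
        clear refund
        exact .solo hy.1 hw' hab hy.2.1 hy.2.2.1 (by unfold size; omega) (by omega)
      · clear refund
        by_cases hsa : cnt side φ a .same = 0
        · exact .pure hy.1 hw' hab hy.2.1 hy.2.2.1 hsa (by omega) (by omega) (by omega)
            (fun _ => by omega)
        · refine .fwdFar hy.1 hw' hab hy.2.1 hy.2.2.1 (by omega) (by omega) (by omega) (by omega)
            (by omega) (fun _ => by omega) (fun _ _ => by omega)
    · omega
    · by_cases hs0 : cnt side φ b .cross = 0
      · have := refund hs0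
        have hc2 : ClosedSame side σ a := hcl hy.2.2.2.1 (closedSame_of_cnt hR.valid (by omega)
          (by omega))
        have := hA' hc2
        clear refund
        exact .blankSoloOpp hy.1 hw' hab hy.2.1 (by omega) (by omega) (by omega) (by omega)
      · clear refund
        refine .blankOneOpp hy.1 hw' hab hy.2.1 (by omega) (by omega) (by omega) (by omega) ?_
        rintro (h0 | h0)
        · omega
        · have hc2 := hcl hy.2.2.2.1 h0
          have := hA' hc2
          omega
    · omega

/-- Parking in the blank yields a blank head with the sign of `a`. Parking in a crossed slot starts
a run ending at a `same` content of `a` or at the blank of `b`; if the latter leaves `b` sorted, the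
parking slot is refunded. -/
theorem good_fwdNear (IH : ∀ M < N, Claim side M) (hσ : σ.Valid) (hT : Hitting side σ T)
    {x : ι} (hd : σ.hd = some x) (hw : σ.ext = ∅) {a b : Bool} (hab : b = !a)
    (hx : side x = a) (hs : σ.sg = b) (hb : cnt side σ b .same = 0) (ha : 0 < cnt side σ a .same)
    (hB : 0 < cnt side σ b .blank) (h : val side σ T + 1 ≤ N)
    (h' : T.card = 0 → val side σ T + 2 ≤ N) : Good side σ N := by
  have hh := hdCnt_some (side := side) hd hx
  have hh1 := hh.1
  have hh2 := hh.2 b hab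
  have hp := pot_eq (side := side) σ T hab
  have hbal := balance_both (side := side) hσ hab
  have w1 := extCnt_eq_zero (side := side) hw a
  have w2 := extCnt_eq_zero (side := side) hw b
  have hv : val side σ T = pot side σ T + cnt side σ a .same := by
    rw [val_eq σ T hab]; omega
  obtain ⟨p, T', hpb, hpT, hpos, hcard, hcase⟩ := hT.enter hσ hab hd hx hs hb (by omega)
  have hA : val side σ T + T'.card + 1 ≤ N + T.card := by
    clear hp hbal
    by_cases h0 : T.card = 0
    · have := h' h0; omega
    · omega
  rcases hcase with ⟨hV, hT', hE, hsg, hn, k1, k2, k3, k4, k5, k6, k7, k8, k9, k10⟩ |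
    ⟨hbl, H, e, φ, hR, hk, hE, k1, k2, k3, k4, k5, k6, k7, k8⟩
  · clear h h' hcard
    have hp' := pot_eq (side := side) (σ.star p) T' hab
    have hv' : val side (σ.star p) T' = pot side (σ.star p) T' + cnt side σ a .same := by
      rw [val_eq _ _ hab]; omega
    refine .of_star (i := p) (by omega) (by rw [hpb, hs]) (IH _ (by omega) _ _ hV hT' ?_)
    exact .blankOne hn (hE.trans hw) hab hsg (by omega) (by omega) (by omega) (by omega)
  -- With `T` empty the blank of `b` would have been chosen, so here `T` is nonempty and does not
  -- grow.
  · replace hbl : T'.card ≤ T.card := by clear hp hbal; omega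
    clear h h' hcard
    have hp' := pot_eq (side := side) φ (T' \ H) hab
    have b1 := hR.one_le
    have b2 := hR.ext_a
    have b3 := hR.ext_b
    have b4 := hR.cross
    have b5 := hR.card_le
    have b6 := hR.bal
    have hw' := hR.ext_eq.trans (hE.trans hw)
    have hv' : val side φ (T' \ H) = pot side φ (T' \ H) + cnt side φ a .same := by
      rw [val_eq φ _ hab]
      rcases hR.ends with ⟨y, hy⟩ | ⟨y, hy⟩ | hy | hy <;> omega
    refine .of_star (i := p) (by omega) (by rw [hpb, hs])
      (hR.good _ (N - 1 - H.card) (by rcases hR.ends with h | h | h | h <;> omega) ?_)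
    refine IH _ (by omega) _ _ hR.valid hR.hitting ?_
    rcases hR.ends with ⟨y, hy⟩ | ⟨y, hy⟩ | hy | hy
    · by_cases hsa : cnt side φ a .same = 0
      · exact .pure hy.1 hw' hab hy.2.1 hy.2.2.1 hsa (by omega) (by omega) (by omega)
          (fun _ => by omega)
      · exact .fwdNear hy.1 hw' hab hy.2.1 hy.2.2.1 (by omega) (by omega) (by omega) (by omega)
          (fun _ => by omega)
    · omega
    · omega
    · by_cases hs0 : cnt side φ b .cross = 0
      · have := hR.card_lt p hpT (hR.mem_of_cnt hk (by rw [hpb]; exact hs0))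
        exact .blankSolo hy.1 hw' hab hy.2.1 (by omega) (by omega) hs0 (by omega)
      · exact .blankOne hy.1 hw' hab hy.2.1 (by omega) (by omega) (by omega) (by omega)

/-- Side `b` is sorted, so a home slot has to be disturbed. Its symbol comes to the head bound for
`b`, with the sign of `a`. The move and the new crossed content cost two; no cycle arises, since the
slot is the only crossed one and its content is bound for the other side. -/
theorem good_solo (IH : ∀ M < N, Claim side M) (hside : ∀ a, ∃ i, side i = a)
    (hσ : σ.Valid)
    {x : ι} (hd : σ.hd = some x) (hw : σ.ext = ∅) {a b : Bool} (hab : b = !a)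
    (hx : side x = a) (hs : σ.sg = b) (hb : size side σ b = 0) (h : val side σ T + 2 ≤ N) :
    Good side σ N := by
  have hba : a = !b := by simp [hab]
  have hh := hdCnt_some (side := side) hd hx
  have hh1 := hh.1
  have hh2 := hh.2 b hab
  have hp := pot_eq (side := side) σ T hab
  have hv := val_eq (side := side) σ T hab
  have hbal := balance_both (side := side) hσ hab
  have w1 := extCnt_eq_zero (side := side) hw a
  have w2 := extCnt_eq_zero (side := side) hw b
  unfold size at hb
  obtain ⟨p, hpb⟩ := hside b
  have hk : kind side p (σ.nx p) = .home := by
    have h1 := kind_ne_of_cnt (side := side) (σ := σ) (κ := .same) (by omega) hpb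
    have h2 := kind_ne_of_cnt (side := side) (σ := σ) (κ := .cross) (by omega) hpb
    have h3 := kind_ne_of_cnt (side := side) (σ := σ) (κ := .blank) (by omega) hpb
    revert h1 h2 h3
    cases kind side p (σ.nx p) <;> simp
  have hk' : kind side p σ.hd = .cross := by
    rw [kind_eq_cross]; exact ⟨x, hd, by rw [hx, hpb, hab]; simp⟩
  have hncr : ∀ c, kind side c (σ.nx c) ≠ .cross := by
    intro c
    rcases Bool.eq_or_eq_not (side c) b with hc | hc
    · exact kind_ne_of_cnt (by omega) hc
    · exact kind_ne_of_cnt (a := a) (by omega) (by rw [hc, hba])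
  have hT' : Hitting side (σ.star p) ∅ := by
    refine ⟨by simp, fun C hC => ?_⟩
    have hall : ∀ c ∈ C, c = p := by
      intro c hc
      by_contra hcp
      exact hncr c (by simpa [star, Function.update_of_ne hcp] using (hC c hc).1)
    by_contra hne
    obtain ⟨c, hc⟩ := Finset.nonempty_iff_ne_empty.2 hne
    obtain rfl := hall c hc
    obtain ⟨-, -, c', hc', e⟩ := hC c hc
    obtain rfl := hall c' hc'
    simp only [star, Function.update_self, hd, Option.some.injEq] at e
    rw [e, hpb, hab] at hx
    simp at hx
  obtain ⟨⟨hV, hE, hsg, hhd⟩, hbal', k1, k2, k3, k4, k5, k6, k7, k8⟩ := star_result hσ hba hpb hs hk hk'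
  simp at k1 k2 k3
  have hhd' : (σ.star p).hd = some p := hhd.trans ((kind_eq_home side).1 hk)
  have hh' := hdCnt_some (side := side) hhd' hpb
  have hh1' := hh'.1
  have hh2' := hh'.2 a hba
  have hp' := pot_eq (side := side) (σ.star p) ∅ hab
  have hv' := val_eq (side := side) (σ.star p) ∅ hab
  simp only [Finset.card_empty] at hp'
  refine .of_star (i := p) (by omega) (by rw [hpb, hs]) (IH _ (by omega) _ _ hV hT' ?_)
  by_cases hsa : cnt side σ a .same = 0
  · exact .pure hhd' (hE.trans hw) hba hpb hsg (by omega) (by omega) (by omega) (by omega)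
      (fun _ => by omega)
  · exact .backFar hhd' (hE.trans hw) hab hpb hsg (by omega) (by omega) (by omega) (by omega)
      (fun _ _ => by omega)

/-- A slot of kind `same` for a head that belongs on the other side, keeping `T`. -/
theorem Hitting.same_choice (hT : Hitting side σ T) {a b : Bool} (hab : b = !a)
    {x : ι} (hd : σ.hd = some x) (hx : side x = b) {i j : ι} (hi : side i = a) (hj : side j = a)
    (hij : i ≠ j) (hi' : kind side i (σ.nx i) ≠ .cross) (hj' : kind side j (σ.nx j) ≠ .cross) :
    Hitting side (σ.star i) T ∨ Hitting side (σ.star j) T := by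
  refine hT.star_choice hij ?_ ?_ hi' hj'
  all_goals
    rw [kind_eq_cross]
    exact ⟨x, hd, by simp [*]⟩

/-- The effect of putting a head that belongs on side `b` into a slot of kind `same` on side `a`. -/
theorem star_same (hσ : σ.Valid) {a b : Bool} (hab : b = !a)
    {x : ι} (hd : σ.hd = some x) (hx : side x = b) (hs : σ.sg = a) {q : ι}
    (hq : side q = a) (hk : kind side q (σ.nx q) = .same) :
    (σ.star q).Valid ∧ (σ.star q).ext = σ.ext ∧ (σ.star q).sg = b ∧
    (∃ y, (σ.star q).hd = some y ∧ side y = a) ∧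
    kind side q σ.hd = .cross ∧
    hdCnt side (σ.star q) a = 1 ∧ hdCnt side (σ.star q) b = 0 ∧
    cnt side (σ.star q) a .same + 1 = cnt side σ a .same ∧
    cnt side (σ.star q) a .cross = cnt side σ a .cross + 1 ∧
    cnt side (σ.star q) a .blank = cnt side σ a .blank ∧
    cnt side (σ.star q) b .same = cnt side σ b .same ∧
    cnt side (σ.star q) b .cross = cnt side σ b .cross ∧
    cnt side (σ.star q) b .blank = cnt side σ b .blank ∧
    extCnt side (σ.star q) a = extCnt side σ a ∧
    extCnt side (σ.star q) b = extCnt side σ b := by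
  have hk' : kind side q σ.hd = .cross := by
    rw [kind_eq_cross]; exact ⟨x, hd, by rw [hx, hq, hab]⟩
  obtain ⟨⟨hV, hE, hsg, hhd⟩, -, k1, k2, k3, k4, k5, k6, k7, k8⟩ := star_result hσ hab hq hs hk hk'
  simp at k1 k2 k3
  obtain ⟨y, hy, -, hys⟩ := (kind_eq_same side).1 hk
  have hh := hdCnt_some (side := side) (hhd.trans hy) (hys.trans hq)
  exact ⟨hV, hE, hsg, ⟨y, hhd.trans hy, hys.trans hq⟩, hk', hh.1, hh.2 b hab, k1, k2, k3, k4, k5, k6,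
    k7, k8⟩

theorem exists_two_of_cnt {a : Bool} {κ : SlotKind} (h : 2 ≤ cnt side σ a κ) :
    ∃ i j, side i = a ∧ side j = a ∧ i ≠ j ∧ kind side i (σ.nx i) = κ ∧
      kind side j (σ.nx j) = κ := by
  obtain ⟨i, hi, j, hj, hij⟩ := Finset.one_lt_card.1 (Nat.lt_of_succ_le h)
  rw [mem_slots] at hi hj
  exact ⟨i, j, hi.1, hj.1, hij, hi.2, hj.2⟩

/-- The head takes the only slot of kind `same`, which leaves a pure state. Adding this slot to `T`
is paid for by the extra move. -/
theorem good_back_single (IH : ∀ M < N, Claim side M) (hσ : σ.Valid) (hT : Hitting side σ T)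
    {x : ι} (hd : σ.hd = some x) (hw : σ.ext = ∅) {a b : Bool} (hab : b = !a)
    (hx : side x = b) (hs : σ.sg = a) (hb : cnt side σ b .same = 0) (ha : cnt side σ a .same = 1)
    (h : pot side σ T + 1 ≤ N) : Good side σ N := by
  have hba : a = !b := by simp [hab]
  have hh := hdCnt_some (side := side) hd hx
  have hh1 := hh.1
  have hh2 := hh.2 a hba
  have hp := pot_eq (side := side) σ T hab
  have hbal := balance_both (side := side) hσ hab
  obtain ⟨q, hq, hk⟩ := exists_of_cnt_pos (side := side) (σ := σ) (a := a) (κ := .same) (by omega)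
  obtain ⟨hV, hE, hsg, ⟨y, hy, hys⟩, hk', k⟩ := star_same hσ hab hd hx hs hq hk
  have hp' := pot_eq (side := side) (σ.star q) (insert q T) hab
  have hc := Finset.card_insert_le q T
  have hc' : 0 < (insert q T).card := Finset.card_pos.2 ⟨q, by simp⟩
  refine .of_star (i := q) (by omega) (by rw [hq, hs])
    (IH _ (by omega) _ _ hV (hT.star_insert hk') ?_)
  exact .pure hy (hE.trans hw) hab hys hsg (by omega) (by omega) (by omega) (by omega)
    (fun _ => by omega)

/-- With two slots of kind `same` to choose from, one of them closes no cycle, so the head is parked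
without enlarging `T`. -/
theorem good_backNear (IH : ∀ M < N, Claim side M) (hσ : σ.Valid) (hT : Hitting side σ T)
    {x : ι} (hd : σ.hd = some x) (hw : σ.ext = ∅) {a b : Bool} (hab : b = !a)
    (hx : side x = b) (hs : σ.sg = a) (hb : cnt side σ b .same = 0) (ha : 0 < cnt side σ a .same)
    (hB : 0 < cnt side σ b .blank) (h : val side σ T + 1 ≤ N)
    (h' : T.card = 0 → val side σ T + 2 ≤ N) : Good side σ N := by
  have hba : a = !b := by simp [hab]
  have hh := hdCnt_some (side := side) hd hx
  have hh1 := hh.1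
  have hh2 := hh.2 a hba
  have hp := pot_eq (side := side) σ T hab
  have hv := val_eq (side := side) σ T hab
  by_cases h2 : 2 ≤ cnt side σ a .same
  · obtain ⟨i, j, hi, hj, hij, ki, kj⟩ := exists_two_of_cnt h2
    obtain ⟨q, hq, hk, hTq⟩ : ∃ q, side q = a ∧ kind side q (σ.nx q) = .same ∧
        Hitting side (σ.star q) T := by
      rcases hT.same_choice hab hd hx hi hj hij (by rw [ki]; simp) (by rw [kj]; simp) with h | h
      · exact ⟨i, hi, ki, h⟩
      · exact ⟨j, hj, kj, h⟩
    obtain ⟨hV, hE, hsg, ⟨y, hy, hys⟩, hk', k⟩ := star_same hσ hab hd hx hs hq hk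
    have hp' := pot_eq (side := side) (σ.star q) T hab
    have hv' := val_eq (side := side) (σ.star q) T hab
    refine .of_star (i := q) (by omega) (by rw [hq, hs]) (IH _ (by omega) _ _ hV hTq ?_)
    exact .fwdNear hy (hE.trans hw) hab hys hsg (by omega) (by omega) (by omega) (by omega)
      (fun _ => by omega)
  · exact good_back_single IH hσ hT hd hw hab hx hs hb (by omega) (by omega)

/-- As the next state may be charged for `ClosedSame`, the slot must both close no cycle and leave
the remaining `same` contents not closed under successors. -/
theorem good_backFar (IH : ∀ M < N, Claim side M) (hσ : σ.Valid) (hT : Hitting side σ T)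
    {x : ι} (hd : σ.hd = some x) (hw : σ.ext = ∅) {a b : Bool} (hab : b = !a)
    (hx : side x = b) (hs : σ.sg = a) (hb : cnt side σ b .same = 0) (ha : 0 < cnt side σ a .same)
    (hB : cnt side σ b .blank = 0) (h : val side σ T ≤ N)
    (h' : T.card = 0 → 2 ≤ cnt side σ a .same → val side σ T + 1 ≤ N) : Good side σ N := by
  have hba : a = !b := by simp [hab]
  have hh := hdCnt_some (side := side) hd hx
  have hh1 := hh.1
  have hh2 := hh.2 a hba
  have hp := pot_eq (side := side) σ T hab
  have hv := val_eq (side := side) σ T hab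
  have hbal := balance_both (side := side) hσ hab
  have w1 := extCnt_eq_zero (side := side) hw a
  have w2 := extCnt_eq_zero (side := side) hw b
  by_cases h2 : 2 ≤ cnt side σ a .same
  · have choice : ∀ i j, i ∈ slots side σ a .same → j ∈ slots side σ a .same → i ≠ j →
        Hitting side (σ.star i) T ∨ Hitting side (σ.star j) T := by
      intro i j hi hj hij
      rw [mem_slots] at hi hj
      exact hT.same_choice hab hd hx hi.1 hj.1 hij (by rw [hi.2]; simp) (by rw [hj.2]; simp)
    have hks : ∀ i, i ∈ slots side σ a .same → kind side i σ.hd ≠ .same := by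
      intro i hi
      rw [mem_slots] at hi
      rw [(star_same hσ hab hd hx hs hi.1 hi.2).2.2.2.2.1]
      simp
    have hne : ∀ i, i ∈ slots side σ a .same → σ.nx i ≠ some i := by
      intro i hi hii
      rw [mem_slots, kind_eq_same, hii] at hi
      obtain ⟨-, j, hj, hji, -⟩ := hi
      exact hji (Option.some_injective _ hj).symm
    obtain ⟨q, hq, hTq, hncl⟩ : ∃ q ∈ slots side σ a .same, Hitting side (σ.star q) T ∧
        ¬ ClosedSame side (σ.star q) a := by
      obtain ⟨i, hi, j, hj, hij⟩ := Finset.one_lt_card.1 (Nat.lt_of_succ_le h2)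
      obtain ⟨q₁, hq₁, hTq₁⟩ : ∃ q ∈ slots side σ a .same, Hitting side (σ.star q) T := by
        rcases choice i j hi hj hij with h | h
        exacts [⟨i, hi, h⟩, ⟨j, hj, h⟩]
      by_cases hcl : ClosedSame side (σ.star q₁) a
      -- If the cycle-free choice `q₁` leaves the others closed, walk two steps among them, `q₂` to
      -- `q₃` to `q₄`. One of `q₃`, `q₄` closes no cycle, and the predecessor of either remains
      -- behind as a witness against closedness.
      · have step : ∀ q ∈ slots side σ a .same, q ≠ q₁ →
            ∃ q' ∈ slots side σ a .same, q' ≠ q₁ ∧ σ.nx q = some q' := by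
          intro q hq hne₁
          by_contra hcon
          push Not at hcon
          refine not_closedSame_star hq hne₁ (fun r hr e => ?_) (hks _ hq₁) hcl
          by_contra hr1
          exact hcon r hr hr1 e
        obtain ⟨q₂, hq₂, h21⟩ : ∃ q ∈ slots side σ a .same, q ≠ q₁ := by
          by_cases hi1 : i = q₁
          · exact ⟨j, hj, by rw [← hi1]; exact hij.symm⟩
          · exact ⟨i, hi, hi1⟩
        obtain ⟨q₃, hq₃, h31, e23⟩ := step q₂ hq₂ h21
        obtain ⟨q₄, hq₄, h41, e34⟩ := step q₃ hq₃ h31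
        have h34 : q₃ ≠ q₄ := by rintro rfl; exact hne _ hq₃ e34
        have h23 : q₂ ≠ q₃ := by rintro rfl; exact hne _ hq₂ e23
        rcases choice q₃ q₄ hq₃ hq₄ h34 with h | h
        · exact ⟨q₃, hq₃, h, not_closedSame_star hq₂ h23
            (fun r _ e => Option.some_injective _ (e.symm.trans e23)) (hks _ hq₃)⟩
        · exact ⟨q₄, hq₄, h, not_closedSame_star hq₃ h34
            (fun r _ e => Option.some_injective _ (e.symm.trans e34)) (hks _ hq₄)⟩
      · exact ⟨q₁, hq₁, hTq₁, hcl⟩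
    rw [mem_slots] at hq
    obtain ⟨hV, hE, hsg, ⟨y, hy, hys⟩, hk', k⟩ := star_same hσ hab hd hx hs hq.1 hq.2
    have hp' := pot_eq (side := side) (σ.star q) T hab
    have hv' := val_eq (side := side) (σ.star q) T hab
    have h'' := fun h => h' h h2
    refine .of_star (i := q) (by omega) (by rw [hq.1, hs]) (IH _ (by omega) _ _ hV hTq ?_)
    refine .fwdFar hy (hE.trans hw) hab hys hsg (by omega) (by omega) (by omega) (by omega)
      (by omega) (fun h => ?_) (fun _ h => absurd h hncl)
    have := h.resolve_right hncl
    omega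
  · exact good_back_single IH hσ hT hd hw hab hx hs hb (by omega) (by omega)

/-- Each move parks the head in a `same` slot on the side of the sign and brings up a symbol that is
again on the wrong sign, so the two sides are used up alternately. `T` grows only when the last such
slot of a side is taken; then a back state with that side as `b` remains. -/
theorem good_both (IH : ∀ M < N, Claim side M) (hσ : σ.Valid) (hT : Hitting side σ T)
    {x : ι} (hd : σ.hd = some x) (hw : σ.ext = ∅) {a b : Bool} (hab : b = !a)
    (hs : side x = !σ.sg) (ha : 0 < cnt side σ a .same) (hb : 0 < cnt side σ b .same)
    (hB : 0 < cnt side σ a .blank) (h : val side σ T + 1 ≤ N)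
    (h' : size side σ a ≤ size side σ b → val side σ T + 2 ≤ N) : Good side σ N := by
  have hba : a = !b := by simp [hab]
  have hv := val_eq (side := side) σ T hab
  have hp := pot_eq (side := side) σ T hab
  unfold size at h'
  obtain ⟨c, d, hcd, hsc, hxd, hor⟩ : ∃ c d, d = (!c) ∧ σ.sg = c ∧ side x = d ∧
      (c = a ∧ d = b ∨ c = b ∧ d = a) := by
    refine ⟨σ.sg, side x, hs, rfl, rfl, ?_⟩
    rw [hs, hab]
    cases σ.sg <;> cases a <;> simp
  have hpc : 0 < cnt side σ c .same := by rcases hor with ⟨rfl, rfl⟩ | ⟨rfl, rfl⟩ <;> assumption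
  have hpd : 0 < cnt side σ d .same := by rcases hor with ⟨rfl, rfl⟩ | ⟨rfl, rfl⟩ <;> assumption
  have hdc : c = !d := by simp [hcd]
  have hh := hdCnt_some (side := side) hd hxd
  have hh1 := hh.1
  have hh2 := hh.2 c hdc
  have hpd' := pot_eq (side := side) σ T hcd
  by_cases h2 : 2 ≤ cnt side σ c .same
  · obtain ⟨i, j, hi, hj, hij, ki, kj⟩ := exists_two_of_cnt h2
    obtain ⟨q, hq, hk, hTq⟩ : ∃ q, side q = c ∧ kind side q (σ.nx q) = .same ∧
        Hitting side (σ.star q) T := by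
      rcases hT.same_choice hcd hd hxd hi hj hij (by rw [ki]; simp) (by rw [kj]; simp) with h | h
      · exact ⟨i, hi, ki, h⟩
      · exact ⟨j, hj, kj, h⟩
    obtain ⟨hV, hE, hsg, ⟨y, hy, hys⟩, hk', k⟩ := star_same hσ hcd hd hxd hsc hq hk
    have hp' := pot_eq (side := side) (σ.star q) T hcd
    have hp'' := pot_eq (side := side) (σ.star q) T hab
    have hv' := val_eq (side := side) (σ.star q) T hab
    refine .of_star (i := q) (by omega) (by rw [hq, hsc]) (IH _ (by omega) _ _ hV hTq ?_)
    refine .both hy (hE.trans hw) hab (by rw [hys, hsg, hdc]) ?_ ?_ ?_ ?_ ?_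
    all_goals try unfold size
    all_goals rcases hor with ⟨rfl, rfl⟩ | ⟨rfl, rfl⟩ <;> omega
  · obtain ⟨q, hq, hk⟩ := exists_of_cnt_pos hpc
    obtain ⟨hV, hE, hsg, ⟨y, hy, hys⟩, hk', k⟩ := star_same hσ hcd hd hxd hsc hq hk
    have hp' := pot_eq (side := side) (σ.star q) (insert q T) hcd
    have hv' := val_eq (side := side) (σ.star q) (insert q T) hcd
    have hvc := val_eq (side := side) σ T hcd
    have hbal := balance_both (side := side) hV hcd
    have w1 := extCnt_eq_zero (side := side) hw c
    have w2 := extCnt_eq_zero (side := side) hw d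
    have hc := Finset.card_insert_le q T
    have hc' : 0 < (insert q T).card := Finset.card_pos.2 ⟨q, by simp⟩
    refine .of_star (i := q) (by omega) (by rw [hq, hsc])
      (IH _ (by omega) _ _ hV (hT.star_insert hk') ?_)
    by_cases hB0 : cnt side σ c .blank = 0
    · exact .backFar hy (hE.trans hw) hdc hys hsg (by omega) (by omega) (by omega) (by omega)
        (fun _ => by omega)
    -- Either the blank is on `a` = `c`, which then is not the larger side and carries the extra
    -- move, or the blank count of `c` = `b` contradicts that only one slot is blank.
    · have hv2 : val side σ T + 2 ≤ N := by
        rcases hor with ⟨rfl, rfl⟩ | ⟨rfl, rfl⟩ <;> omega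
      exact .backNear hy (hE.trans hw) hdc hys hsg (by omega) (by omega) (by omega) (by omega)
        (fun _ => by omega)

end SortState

/-! ### Induction step: a symbol at the head, outside symbols left -/

namespace SortState

variable {ι : Type*} [Fintype ι] [DecidableEq ι] {side : ι → Bool}
variable {N : ℕ} {σ : SortState ι} {T : Finset ι}

theorem Hitting.card_eq_zero (hT : Hitting side σ T) {a b : Bool} (hab : b = !a)
    (ha : cnt side σ a .cross = 0) (hb : cnt side σ b .cross = 0) : T.card = 0 := by
  rw [Finset.card_eq_zero, Finset.eq_empty_iff_forall_notMem]
  intro t ht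
  rcases Bool.eq_or_eq_not (side t) a with h | h
  · exact kind_ne_of_cnt ha h (hT.1 t ht)
  · exact kind_ne_of_cnt hb (h.trans hab.symm) (hT.1 t ht)

theorem not_cross_of_cnt {a b : Bool} (hab : b = !a) (ha : cnt side σ a .cross = 0)
    (hb : cnt side σ b .cross = 0) (c : ι) : kind side c (σ.nx c) ≠ .cross := by
  rcases Bool.eq_or_eq_not (side c) a with h | h
  · exact kind_ne_of_cnt ha h
  · exact kind_ne_of_cnt hb (h.trans hab.symm)

theorem entry_mono {σ' : SortState ι} {T' : Finset ι} {a : Bool}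
    (h : cnt side σ' a .same + cnt side σ' a .blank ≤ cnt side σ a .same + cnt side σ a .blank)
    (hT : T ⊆ T') : entry side σ' T' a ≤ entry side σ T a := by
  by_cases h0 : cnt side σ a .same + cnt side σ a .blank = 0 ∧ ∃ t ∈ T, side t = a
  · obtain ⟨h1, t, ht, hta⟩ := h0
    rw [entry_eq_zero (σ := σ') (by omega) (hT ht) hta]
    exact Nat.zero_le _
  · have : entry side σ T a = 1 := if_neg h0
    rw [this]
    exact entry_le_one _ _ _

/-- A saved entry on a side is lost only when all elements of `T` on that side are gone, and this
lowers the size of `T` by at least as much. -/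
theorem entry_add_card_le {σ' : SortState ι} {T' : Finset ι} {a b : Bool} (hab : b = !a)
    (ha : cnt side σ' a .same + cnt side σ' a .blank ≤ cnt side σ a .same + cnt side σ a .blank)
    (hb : cnt side σ' b .same + cnt side σ' b .blank ≤ cnt side σ b .same + cnt side σ b .blank)
    (hT : T' ⊆ T) :
    entry side σ' T' a + entry side σ' T' b + T'.card ≤
      entry side σ T a + entry side σ T b + T.card := by
  have key : ∀ c, cnt side σ' c .same + cnt side σ' c .blank ≤
        cnt side σ c .same + cnt side σ c .blank →
      entry side σ' T' c + (T'.filter (side · = c)).card ≤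
        entry side σ T c + (T.filter (side · = c)).card := by
    intro c hc
    have hm := Finset.card_le_card (Finset.filter_subset_filter (side · = c) hT)
    by_cases h0 : cnt side σ c .same + cnt side σ c .blank = 0 ∧ ∃ t ∈ T, side t = c
    · obtain ⟨h1, t, ht, htc⟩ := h0
      have h2 : 0 < (T.filter (side · = c)).card := Finset.card_pos.2 ⟨t, by simp [ht, htc]⟩
      rcases Nat.eq_zero_or_pos (T'.filter (side · = c)).card with h3 | h3
      · have := entry_le_one (side := side) σ' T' c
        omega
      · obtain ⟨u, hu⟩ := Finset.card_pos.1 h3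
        rw [Finset.mem_filter] at hu
        rw [entry_eq_zero (σ := σ') (by omega) hu.1 hu.2]
        omega
    · have h1 : entry side σ T c = 1 := if_neg h0
      have := entry_le_one (side := side) σ' T' c
      omega
  have split : ∀ U : Finset ι,
      U.card = (U.filter (side · = a)).card + (U.filter (side · = b)).card := by
    intro U
    rw [← Finset.card_filter_add_card_filter_not (s := U) (fun t => side t = a)]
    congr 2
    ext t
    simp [hab, Bool.eq_not]
  have h1 := key a ha
  have h2 := key b hb
  rw [split T, split T']
  omega

/-- With no outside symbols left, the bound with entry costs falls under the other cases. -/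
theorem Cap.of_entry (hσ : σ.Valid) (hT : Hitting side σ T) {x : ι} (hd : σ.hd = some x)
    (hs : side x = !σ.sg) (hw : σ.ext = ∅)
    (h : val side σ T + entry side σ T true + entry side σ T false ≤ N) : Cap side σ T N := by
  obtain ⟨a, b, hab, hx, hsb⟩ : ∃ a b, b = (!a) ∧ side x = a ∧ σ.sg = b :=
    ⟨side x, σ.sg, by simp [hs], rfl, rfl⟩
  have hba : a = !b := by simp [hab]
  have hh := hdCnt_some (side := side) hd hx
  have hh1 := hh.1
  have hh2 := hh.2 b hab
  have hbal := balance_both (side := side) hσ hab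
  have hv := val_eq (side := side) σ T hab
  have w1 := extCnt_eq_zero (side := side) hw a
  have w2 := extCnt_eq_zero (side := side) hw b
  have he := entry_add (side := side) σ T hab
  rw [add_assoc, he] at h
  have t1 : T.card = 0 → entry side σ T a = 1 := entry_eq_one_of_card
  have t2 : T.card = 0 → entry side σ T b = 1 := entry_eq_one_of_card
  have sa : 0 < cnt side σ a .same + cnt side σ a .blank → entry side σ T a = 1 := entry_eq_one
  have sb : 0 < cnt side σ b .same + cnt side σ b .blank → entry side σ T b = 1 := entry_eq_one
  by_cases hSb : cnt side σ b .same = 0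
  · by_cases hcb : cnt side σ b .cross + cnt side σ b .blank = 0
    · have := hT.card_eq_zero hab (by omega) (by omega)
      exact .solo hd hw hab hx hsb (by unfold size; omega) (by have := t1 this; have := t2 ‹_›; omega)
    · by_cases hSa : cnt side σ a .same = 0
      · exact .pure hd hw hab hx hsb hSa hSb (by omega) (by omega) (fun h0 => by
          have := t1 h0; omega)
      · have := sa (by omega)
        by_cases hB : cnt side σ b .blank = 0
        · exact .fwdFar hd hw hab hx hsb hSb (by omega) hB (by omega) (by omega) (fun _ => by omega)
            (fun h0 _ => by have := t2 h0; omega)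
        · have := sb (by omega)
          exact .fwdNear hd hw hab hx hsb hSb (by omega) (by omega) (by omega) (fun _ => by omega)
  · have := sb (by omega)
    by_cases hSa : cnt side σ a .same = 0
    · by_cases hB : cnt side σ a .blank = 0
      · exact .backFar hd hw hba hx hsb hSa (by omega) hB (by omega) (fun _ => by omega)
      · have := sa (by omega)
        exact .backNear hd hw hba hx hsb hSa (by omega) (by omega) (by omega) (fun _ => by omega)
    · have := sa (by omega)
      by_cases hB : cnt side σ a .blank = 0
      · exact .both hd hw hba hs (by omega) (by omega) (by omega) (by omega) (fun _ => by omega)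
      · exact .both hd hw hab hs (by omega) (by omega) (by omega) (by omega) (fun _ => by omega)

/-- Three star moves that bring a home slot `p` into play. -/
theorem detour (hσ : σ.Valid) {a b : Bool} (hab : b = !a) (hs : σ.sg = b) {p q : ι}
    (hp : side p = b) (hpk : kind side p (σ.nx p) = .home) (hq : side q = a)
    (hqk : kind side q (σ.nx q) = .same) :
    ∃ τ : SortState ι, (τ.Valid ∧ τ.ext = σ.ext ∧ τ.hd = σ.hd ∧ τ.sg = a ∧
      (∀ i, i ≠ p → i ≠ q → τ.nx i = σ.nx i) ∧ τ.nx q = some p ∧ τ.nx p = σ.nx q ∧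
      (∀ M N, M + 3 ≤ N → Good side τ M → Good side σ N)) ∧
      hdCnt side τ a = hdCnt side σ a ∧ hdCnt side τ b = hdCnt side σ b ∧
      cnt side τ a .same + 1 = cnt side σ a .same ∧
      cnt side τ a .cross = cnt side σ a .cross + 1 ∧
      cnt side τ a .blank = cnt side σ a .blank ∧
      cnt side τ b .same = cnt side σ b .same ∧
      cnt side τ b .cross = cnt side σ b .cross + 1 ∧
      cnt side τ b .blank = cnt side σ b .blank ∧
      extCnt side τ a = extCnt side σ a ∧ extCnt side τ b = extCnt side σ b := by
  have hba : a = !b := by simp [hab]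
  have hpq : p ≠ q := by
    rintro rfl
    rw [hp, hab] at hq
    simp at hq
  have hpp := (kind_eq_home side).1 hpk
  obtain ⟨l, hl, hlq, hls⟩ := (kind_eq_same side).1 hqk
  obtain ⟨κ, hκ⟩ : ∃ κ, kind side p σ.hd = κ := ⟨_, rfl⟩
  have c1 := star_counts σ hba hp hpk hκ
  have c2 := star_counts (σ.star p) hab hq (κ := .same) (κ' := .cross)
    (by simpa [star, Function.update_of_ne hpq.symm] using hqk)
    (by simp [star, hpp, kind_eq_cross, hp, hq, hab])
  have c3 := star_counts ((σ.star p).star q) hba hp (κ := κ) (κ' := .cross)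
    (by simpa [star, Function.update_of_ne hpq] using hκ)
    (by simp [star, Function.update_of_ne hpq.symm, hl, kind_eq_cross, hls, hp, hq, hab])
  -- The moves are at `p`, `q`, `p`: slot `q` receives the symbol of `p`, slot `p` receives the
  -- content of `q`, and the head returns with the sign reversed. The basic price is unchanged, as
  -- one `same` content has become two crossed ones.
  have hhd : (((σ.star p).star q).star p).hd = σ.hd := by
    simp [star, Function.update_of_ne hpq]
  have hcnt : ∀ c, hdCnt side (((σ.star p).star q).star p) c = hdCnt side σ c := by
    intro c; simp [hdCnt, hhd]
  refine ⟨((σ.star p).star q).star p, ⟨((hσ.star p).star q).star p, by simp [ext_star], hhd,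
    by simp [star, hs, hab], ?_, ?_, ?_, ?_⟩, hcnt a, hcnt b, ?_⟩
  · intro i hip hiq
    simp [star, Function.update_of_ne hip, Function.update_of_ne hiq]
  · simp [star, Function.update_of_ne hpq.symm, hpp]
  · simp [star, Function.update_of_ne hpq.symm]
  · intro M N hMN hG
    exact Good.mono (.star p (by rw [hp, hs]) (.star q (by simp [star, hq, hs, hab])
      (.star p (by simp [star, hp, hs]) hG))) hMN
  · cases κ <;> simp at c1 c2 c3 <;> omega

/-- A detour from a state without crossed slots creates no closed set of crossed slots. -/
theorem detour_hitting {a b : Bool} (hab : b = !a) {p q : ι} {τ : SortState ι}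
    (hp : side p = b) (hq : side q = a) (hqk : kind side q (σ.nx q) = .same)
    (hncr : ∀ c, kind side c (σ.nx c) ≠ .cross)
    (h1 : ∀ i, i ≠ p → i ≠ q → τ.nx i = σ.nx i) (h2 : τ.nx q = some p) (h3 : τ.nx p = σ.nx q) :
    Hitting side τ ∅ := by
  obtain ⟨l, hl, hlq, hls⟩ := (kind_eq_same side).1 hqk
  refine ⟨by simp, fun C hC => ?_⟩
  have hall : ∀ c ∈ C, c = p ∨ c = q := by
    intro c hc
    by_contra hcon
    rw [not_or] at hcon
    exact hncr c (by rw [← h1 c hcon.1 hcon.2]; exact (hC c hc).1)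
  -- The only crossed slots are `p` and `q`, and the content of `p` is bound for a slot different
  -- from both, so the chain from `q` through `p` leaves them.
  have hpC : p ∉ C := by
    intro hpC
    obtain ⟨-, -, c, hc, e⟩ := hC p hpC
    rw [h3, hl, Option.some.injEq] at e
    rcases hall c hc with rfl | rfl
    · rw [e, hp, hq, hab] at hls
      simp at hls
    · exact hlq e
  rw [Finset.eq_empty_iff_forall_notMem]
  intro c hc
  rcases hall c hc with rfl | rfl
  · exact hpC hc
  · obtain ⟨-, -, c', hc', e⟩ := hC c hc
    rw [h2, Option.some.injEq] at e
    exact hpC (e ▸ hc')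

theorem kind_eq_home_of_size {b : Bool} (hb : size side σ b = 0) {p : ι} (hp : side p = b) :
    kind side p (σ.nx p) = .home := by
  unfold size at hb
  have h1 := kind_ne_of_cnt (side := side) (σ := σ) (κ := .same) (by omega) hp
  have h2 := kind_ne_of_cnt (side := side) (σ := σ) (κ := .cross) (by omega) hp
  have h3 := kind_ne_of_cnt (side := side) (σ := σ) (κ := .blank) (by omega) hp
  revert h1 h2 h3
  cases kind side p (σ.nx p) <;> simp

/-- Two slots on side `a` with contents of kind `same` or blank. -/
theorem exists_two_uncrossed {a : Bool} (h : 2 ≤ cnt side σ a .same + cnt side σ a .blank) :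
    ∃ i j, side i = a ∧ side j = a ∧ i ≠ j ∧
      (kind side i (σ.nx i) = .same ∨ kind side i (σ.nx i) = .blank) ∧
      (kind side j (σ.nx j) = .same ∨ kind side j (σ.nx j) = .blank) := by
  have hd : Disjoint (slots side σ a .same) (slots side σ a .blank) := by
    rw [Finset.disjoint_left]
    intro i hi hi'
    rw [mem_slots] at hi hi'
    rw [hi.2] at hi'
    simp at hi'
  have : 1 < (slots side σ a .same ∪ slots side σ a .blank).card := by
    rw [Finset.card_union_of_disjoint hd]; exact h
  obtain ⟨i, hi, j, hj, hij⟩ := Finset.one_lt_card.1 this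
  simp only [Finset.mem_union, mem_slots] at hi hj
  refine ⟨i, j, ?_, ?_, hij, hi.imp (·.2) (·.2), hj.imp (·.2) (·.2)⟩
  · rcases hi with h | h <;> exact h.1
  · rcases hj with h | h <;> exact h.1

/-- The effect of putting a head that belongs on side `a` into an uncrossed slot on side `b`. -/
theorem star_uncrossed (hσ : σ.Valid) {a b : Bool} (hab : b = !a)
    {x : ι} (hd : σ.hd = some x) (hx : side x = a) (hs : σ.sg = b) {q : ι} (hq : side q = b)
    (hk : kind side q (σ.nx q) = .same ∨ kind side q (σ.nx q) = .blank) :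
    (σ.star q).Valid ∧ (σ.star q).ext = σ.ext ∧ kind side q σ.hd = .cross ∧
    (∀ y, (σ.star q).hd = some y → side y = !(σ.star q).sg) ∧
    cnt side (σ.star q) b .same + cnt side (σ.star q) b .blank + 1 =
      cnt side σ b .same + cnt side σ b .blank ∧
    cnt side (σ.star q) b .cross = cnt side σ b .cross + 1 ∧
    cnt side (σ.star q) b .same + hdCnt side (σ.star q) a + hdCnt side (σ.star q) b =
      cnt side σ b .same ∧
    cnt side (σ.star q) a .same = cnt side σ a .same ∧
    cnt side (σ.star q) a .cross = cnt side σ a .cross ∧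
    cnt side (σ.star q) a .blank = cnt side σ a .blank ∧
    extCnt side (σ.star q) a = extCnt side σ a ∧
    extCnt side (σ.star q) b = extCnt side σ b := by
  have hba : a = !b := by simp [hab]
  have hk' : kind side q σ.hd = .cross := by
    rw [kind_eq_cross]; exact ⟨x, hd, by rw [hx, hq, hba]⟩
  rcases hk with hk | hk
  · obtain ⟨⟨hV, hE, hsg, hhd⟩, -, k1, k2, k3, k4, k5, k6, k7, k8⟩ := star_result hσ hba hq hs hk hk'
    simp at k1 k2 k3
    obtain ⟨y, hy, -, hys⟩ := (kind_eq_same side).1 hk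
    have hh := hdCnt_some (side := side) (hhd.trans hy) (hys.trans hq)
    have hh1 := hh.1
    have hh2 := hh.2 a hba
    refine ⟨hV, hE, hk', fun z hz => ?_, by omega, by omega, by omega, k4, k5, k6, k8, k7⟩
    rw [hhd, hy, Option.some.injEq] at hz
    rw [← hz, hys, hq, hsg, hab]
  · obtain ⟨⟨hV, hE, hsg, hhd⟩, -, k1, k2, k3, k4, k5, k6, k7, k8⟩ := star_result hσ hba hq hs hk hk'
    simp at k1 k2 k3
    have hn := hhd.trans ((kind_eq_blank side).1 hk)
    have hh1 := hdCnt_none (side := side) hn a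
    have hh2 := hdCnt_none (side := side) hn b
    refine ⟨hV, hE, hk', fun z hz => ?_, by omega, by omega, by omega, k4, k5, k6, k8, k7⟩
    rw [hn] at hz
    simp at hz

/-- While two uncrossed slots are left on `b`, one can be used without closing a cycle. The last one
is put into `T`; from then on `b` has only crossed slots and an entry in `T`, so its entry cost pays
for the new element. -/
theorem good_outside_uncrossed (IH : ∀ M < N, Claim side M) (hσ : σ.Valid) (hT : Hitting side σ T)
    {x : ι} (hd : σ.hd = some x) (hw : σ.ext.Nonempty) {a b : Bool} (hab : b = !a)
    (hx : side x = a) (hs : σ.sg = b) (hU : 0 < cnt side σ b .same + cnt side σ b .blank)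
    (h : val side σ T + entry side σ T a + entry side σ T b ≤ N) : Good side σ N := by
  have hba : a = !b := by simp [hab]
  have hh := hdCnt_some (side := side) hd hx
  have hh1 := hh.1
  have hh2 := hh.2 b hab
  have hp := pot_eq (side := side) σ T hab
  have hv := val_eq (side := side) σ T hab
  have e1 := entry_eq_one (T := T) hU
  by_cases h2 : 2 ≤ cnt side σ b .same + cnt side σ b .blank
  · obtain ⟨i, j, hi, hj, hij, ki, kj⟩ := exists_two_uncrossed h2
    obtain ⟨q, hq, hk, hTq⟩ : ∃ q, side q = b ∧
        (kind side q (σ.nx q) = .same ∨ kind side q (σ.nx q) = .blank) ∧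
        Hitting side (σ.star q) T := by
      rcases hT.same_choice hba hd hx hi hj hij (by rcases ki with k | k <;> simp [k])
        (by rcases kj with k | k <;> simp [k]) with h | h
      · exact ⟨i, hi, ki, h⟩
      · exact ⟨j, hj, kj, h⟩
    obtain ⟨hV, hE, hk', hhd, k⟩ := star_uncrossed hσ hab hd hx hs hq hk
    have hp' := pot_eq (side := side) (σ.star q) T hab
    have hv' := val_eq (side := side) (σ.star q) T hab
    have e2 := entry_mono (side := side) (σ := σ) (σ' := σ.star q) (T := T) (T' := T) (a := a)
      (by omega) subset_rfl
    have e3 := entry_le_one (side := side) (σ.star q) T b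
    refine .of_star (i := q) (by omega) (by rw [hq, hs]) (IH _ (by omega) _ _ hV hTq ?_)
    refine .outside hhd (hE ▸ hw) ?_
    rw [add_assoc, entry_add _ _ hab]
    omega
  · obtain ⟨q, hq, hk⟩ : ∃ q, side q = b ∧
        (kind side q (σ.nx q) = .same ∨ kind side q (σ.nx q) = .blank) := by
      rcases Nat.eq_zero_or_pos (cnt side σ b .same) with h0 | h0
      · obtain ⟨q, hq, hk⟩ := exists_of_cnt_pos (side := side) (σ := σ) (a := b) (κ := .blank)
          (by omega)
        exact ⟨q, hq, .inr hk⟩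
      · obtain ⟨q, hq, hk⟩ := exists_of_cnt_pos h0
        exact ⟨q, hq, .inl hk⟩
    obtain ⟨hV, hE, hk', hhd, k⟩ := star_uncrossed hσ hab hd hx hs hq hk
    have hp' := pot_eq (side := side) (σ.star q) (insert q T) hab
    have hv' := val_eq (side := side) (σ.star q) (insert q T) hab
    have hc := Finset.card_insert_le q T
    have e2 := entry_mono (side := side) (σ := σ) (σ' := σ.star q) (T := T) (T' := insert q T)
      (a := a) (by omega) (Finset.subset_insert _ _)
    have e3 := entry_eq_zero (side := side) (σ := σ.star q) (T := insert q T) (a := b)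
      (by omega) (Finset.mem_insert_self _ _) hq
    refine .of_star (i := q) (by omega) (by rw [hq, hs])
      (IH _ (by omega) _ _ hV (hT.star_insert hk') ?_)
    refine .outside hhd (hE ▸ hw) ?_
    rw [add_assoc, entry_add _ _ hab]
    omega

theorem RunResult.head_side {φ : SortState ι} {H : Finset ι} {a b : Bool} {e : ι} (hab : b = !a)
    (hR : RunResult side σ T a b H e φ) : ∀ y, φ.hd = some y → side y = !φ.sg := by
  intro y hy
  rcases hR.ends with ⟨z, h1, h2, h3, -⟩ | ⟨z, h1, h2, h3, -⟩ | ⟨h1, -⟩ | ⟨h1, -⟩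
  · rw [h1, Option.some.injEq] at hy
    rw [← hy, h2, h3, hab]; simp
  · rw [h1, Option.some.injEq] at hy
    rw [← hy, h2, h3, hab]
  · simp [h1] at hy
  · simp [h1] at hy

set_option maxHeartbeats 800000 in
-- Parking in a crossed slot `p` of `b` starts a run. Either the run passes `p` and `T` loses it, or
-- `p` stays in `T`, which makes the entry on `b` free if no uncrossed slot is there.
theorem good_outside_crossed (IH : ∀ M < N, Claim side M) (hσ : σ.Valid) (hT : Hitting side σ T)
    {x : ι} (hd : σ.hd = some x) (hw : σ.ext.Nonempty) {a b : Bool} (hab : b = !a)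
    (hx : side x = a) (hs : σ.sg = b) (hS : cnt side σ b .same = 0) (hB : cnt side σ b .blank = 0)
    (hc : 0 < cnt side σ b .cross)
    (h : val side σ T + entry side σ T a + entry side σ T b ≤ N) : Good side σ N := by
  have hh := hdCnt_some (side := side) hd hx
  have hh1 := hh.1
  have hh2 := hh.2 b hab
  have hp := pot_eq (side := side) σ T hab
  have hbal := balance_both (side := side) hσ hab
  have hv : val side σ T = pot side σ T + cnt side σ a .same + extCnt side σ a + 1 := by
    rw [val_eq σ T hab]; omega
  obtain ⟨p, T', hpb, hpT, hpos, hcard, hcase⟩ := hT.enter hσ hab hd hx hs hS (by omega)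
  have e1 : entry side σ T a = 1 := entry_eq_one (by omega)
  have hA : val side σ T + T'.card + 1 ≤ N + T.card := by
    clear hp hbal hv
    by_cases h0 : T.card = 0
    · have := entry_eq_one_of_card (side := side) (σ := σ) (a := b) h0
      omega
    · omega
  clear hcard
  rcases hcase with ⟨hV, hT', hE, hsg, hn, k1, k2, k3, k4, k5, k6, k⟩ |
    ⟨hbl, H, e, φ, hR, hk, hE, k1, k2, k3, k4, k5, k6, k7, k8⟩
  · omega
  · clear hbl
    have hp' := pot_eq (side := side) φ (T' \ H) hab
    have b1 := hR.one_le
    have b2 := hR.ext_a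
    have b3 := hR.ext_b
    have b4 := hR.cross
    have b5 := hR.card_le
    have b6 := hR.bal
    have hv' : val side φ (T' \ H) = pot side φ (T' \ H) + cnt side φ a .same + extCnt side φ a +
        hdCnt side φ a := by
      rw [val_eq φ _ hab]
      rcases hR.ends with ⟨y, hy⟩ | ⟨y, hy⟩ | hy | hy <;> omega
    have e2 := entry_le_one (side := side) φ (T' \ H) a
    have e3 := entry_le_one (side := side) φ (T' \ H) b
    have e4 : p ∉ H → cnt side φ b .same + cnt side φ b .blank = 0 → entry side φ (T' \ H) b = 0 :=
      fun h1 h2 => entry_eq_zero h2 (Finset.mem_sdiff.2 ⟨hpT, h1⟩) hpb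
    have e5 := hR.card_lt p hpT
    refine .of_star (i := p) (by omega) (by rw [hpb, hs])
      (hR.good _ (N - 1 - H.card) (by clear e4 e5; rcases hR.ends with h | h | h | h <;> omega) ?_)
    refine IH _ (by omega) _ _ hR.valid hR.hitting ?_
    refine .outside (hR.head_side hab) (by rw [hR.ext_eq, hE]; exact hw) ?_
    rw [add_assoc, entry_add _ _ hab]
    by_cases hpH : p ∈ H
    · have := e5 hpH
      clear e4 e5
      rcases hR.ends with ⟨y, hy⟩ | ⟨y, hy⟩ | hy | hy <;> omega
    · have := e4 hpH
      clear e4 e5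
      rcases hR.ends with ⟨y, hy⟩ | ⟨y, hy⟩ | hy | hy <;> omega

set_option maxHeartbeats 800000 in
-- On the sorted side `b` only home slots can be disturbed. A detour through a `same` slot of `a`
-- reverses the sign, after which the head goes home by a run. No slot is crossed at the start, so
-- both entries are charged and are available for the detour.
theorem good_outside_solo (IH : ∀ M < N, Claim side M) (hside : ∀ a, ∃ i, side i = a)
    (hσ : σ.Valid) (hT : Hitting side σ T)
    {x : ι} (hd : σ.hd = some x) (hw : σ.ext.Nonempty) {a b : Bool} (hab : b = !a)
    (hx : side x = a) (hs : σ.sg = b) (hb : size side σ b = 0) (ha : 0 < cnt side σ a .same)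
    (h : val side σ T + entry side σ T a + entry side σ T b ≤ N) : Good side σ N := by
  have hh := hdCnt_some (side := side) hd hx
  have hh1 := hh.1
  have hh2 := hh.2 b hab
  have hp := pot_eq (side := side) σ T hab
  have hbal := balance_both (side := side) hσ hab
  obtain ⟨p, hpb⟩ := hside b
  have hpk := kind_eq_home_of_size hb hpb
  obtain ⟨q, hq, hqk⟩ := exists_of_cnt_pos ha
  unfold size at hb
  have hv : val side σ T = pot side σ T + cnt side σ a .same + extCnt side σ a + 1 := by
    rw [val_eq σ T hab]; omega
  have hT0 := hT.card_eq_zero hab (by omega) (by omega)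
  have e1 := entry_eq_one_of_card (side := side) (σ := σ) (a := a) hT0
  have e2 := entry_eq_one_of_card (side := side) (σ := σ) (a := b) hT0
  obtain ⟨τ, ⟨hV, hE, hhd, hsg, h1, h2, h3, hG⟩, k⟩ := detour hσ hab hs hpb hpk hq hqk
  have hTτ := detour_hitting hab hpb hq hqk (not_cross_of_cnt hab (by omega) (by omega)) h1 h2 h3
  obtain ⟨H, e, φ, hR⟩ := exists_runResult hV hTτ hab (hhd.trans hd) (by rw [hx, hsg])
  have hp' := pot_eq (side := side) φ (∅ \ H) hab
  rw [Finset.empty_sdiff, Finset.card_empty] at hp'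
  have b1 := hR.one_le
  have b2 := hR.ext_a
  have b3 := hR.ext_b
  have b4 := hR.cross
  have b6 := hR.bal
  have hends : cnt side φ a .same + hdCnt side φ a + 1 = cnt side σ a .same ∧
      cnt side φ b .same = 0 ∧ hdCnt side φ b = 0 ∧ cnt side φ b .blank = 0 := by
    clear hp' b4 b6 hp hv h e1 e2 hh1
    rcases hR.ends with ⟨y, hy⟩ | ⟨y, hy⟩ | hy | hy <;> omega
  have hv' : val side φ ∅ = pot side φ ∅ + cnt side φ a .same + extCnt side φ a +
      hdCnt side φ a := by
    rw [val_eq φ _ hab]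
    clear hp' b4 hp hv h
    omega
  have e3 := entry_le_one (side := side) φ ∅ a
  have e4 := entry_le_one (side := side) φ ∅ b
  have hTφ := hR.hitting
  rw [Finset.empty_sdiff] at hTφ
  have hval : val side φ ∅ + 2 + H.card + 3 ≤ N := by
    clear b6 e3 e4
    omega
  refine hG (N - 3) N (by omega) (hR.good _ (N - 3 - H.card) (by omega)
    (IH _ (by omega) _ _ hR.valid hTφ ?_))
  refine .outside (hR.head_side hab) (by rw [hR.ext_eq, hE]; exact hw) ?_
  rw [add_assoc, entry_add _ _ hab]
  omega

end SortState

/-! ### Fetching outside symbols when one side is sorted -/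

namespace SortState

variable {ι : Type*} [Fintype ι] [DecidableEq ι] {side : ι → Bool}
variable {N : ℕ} {σ : SortState ι} {T : Finset ι}

/-- The outcome of a fetch, with the effect on the counts. -/
theorem fetch_result (hσ : σ.Valid) (hT : Hitting side σ T) (hd : σ.hd = none) {a b : Bool}
    (hab : b = !a) {z : ι} (hz : z ∈ σ.ext) (hza : side z = a) (s : Bool) :
    ((⟨σ.nx, some z, s⟩ : SortState ι).Valid ∧ Hitting side ⟨σ.nx, some z, s⟩ T ∧
      (⟨σ.nx, some z, s⟩ : SortState ι).ext = σ.ext.erase z) ∧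
    (∀ c κ, cnt side ⟨σ.nx, some z, s⟩ c κ = cnt side σ c κ) ∧
    extCnt side ⟨σ.nx, some z, s⟩ a + 1 = extCnt side σ a ∧
    extCnt side ⟨σ.nx, some z, s⟩ b = extCnt side σ b ∧
    hdCnt side ⟨σ.nx, some z, s⟩ a = 1 ∧ hdCnt side ⟨σ.nx, some z, s⟩ b = 0 := by
  have hE : (⟨σ.nx, some z, s⟩ : SortState ι).ext = σ.ext.erase z := by
    ext t
    simp only [mem_ext, Finset.mem_erase, hd]
    constructor
    · rintro ⟨h1, h2⟩; exact ⟨fun h => h2 (by rw [h]), h1, by simp⟩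
    · rintro ⟨h1, h2, -⟩; exact ⟨h2, fun h => h1 (Option.some_injective _ h).symm⟩
  have hh := hdCnt_some (side := side) (σ := ⟨σ.nx, some z, s⟩) rfl hza
  refine ⟨⟨hσ.fetch hz s, hT, hE⟩, fun _ _ => rfl, ?_, ?_, hh.1, hh.2 b hab⟩
  · unfold extCnt
    rw [hE, Finset.filter_erase, Finset.card_erase_add_one]
    simp [hz, hza]
  · unfold extCnt
    rw [hE, Finset.filter_erase, Finset.erase_eq_of_notMem]
    simp [hza, hab]

/-- If the fetched symbol arrives with the sign of its side, it runs home. Otherwise it is parked in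
`p`, and the symbol held there runs home instead. Without contents of kind `same`, the run ends in a
blank of `a` either way. -/
theorem good_fetch_chain {ρ : SortState ι} (IH : ∀ M < N, Claim side M) (hρV : ρ.Valid)
    (hTρ : Hitting side ρ ∅) (hρd : ρ.hd = none) (hw : ρ.ext.Nonempty) {a b : Bool} (hab : b = !a)
    {p x : ι} (hpb : side p = b) (hx : side x = a) (hρp : ρ.nx p = some x)
    (ca1 : cnt side ρ a .same = 0) (ca2 : cnt side ρ a .cross = 1)
    (ca3 : cnt side ρ a .blank = extCnt side ρ a) (cb1 : cnt side ρ b .same = 0)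
    (cb2 : cnt side ρ b .cross = 1) (cb3 : cnt side ρ b .blank = 0) (wb : extCnt side ρ b = 0)
    (h : 3 * extCnt side ρ a + 3 ≤ N) : Good side ρ N := by
  have hba : a = !b := by simp [hab]
  refine .fetch hρd hw ?_
  intro z hz s
  have hza : side z = a := by
    by_contra hne
    have := extCnt_pos (side := side) hz
    rw [show side z = b by rw [hab]; exact Bool.eq_not.2 hne] at this
    omega
  obtain ⟨⟨hVψ, hTψ, hEψ⟩, hcψ, f1, f2, f3, f4⟩ := fetch_result hρV hTρ hρd hab hz hza s
  have q1 := hcψ a .same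
  have q2 := hcψ a .cross
  have q3 := hcψ a .blank
  have q4 := hcψ b .same
  have q5 := hcψ b .cross
  have q6 := hcψ b .blank
  set ψ : SortState ι := ⟨ρ.nx, some z, s⟩ with hψ
  clear hcψ
  rw [ca1] at q1
  rw [ca2] at q2
  rw [ca3] at q3
  rw [cb1] at q4
  rw [cb2] at q5
  rw [cb3] at q6
  rw [wb] at f2
  clear ca1 ca2 ca3 cb1 cb2 cb3 wb
  rcases Bool.eq_or_eq_not s a with hsa | hsa
  · obtain ⟨H, e, φ, hR⟩ := exists_runResult hVψ hTψ hab (t := z) rfl (by rw [hza, ← hsa])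
    have hp' := pot_eq (side := side) φ (∅ \ H) hab
    rw [Finset.empty_sdiff, Finset.card_empty] at hp'
    have hTφ := hR.hitting
    rw [Finset.empty_sdiff] at hTφ
    have b1 := hR.one_le
    have b2 := hR.ext_a
    have b3 := hR.ext_b
    have b4 := hR.cross
    have b6 := hR.bal
    have hends : cnt side φ a .same = 0 ∧ cnt side φ b .same = 0 ∧ hdCnt side φ a = 0 ∧
        hdCnt side φ b = 0 ∧ φ.hd = none ∧ cnt side φ b .blank = 0 := by
      rcases hR.ends with ⟨y, hy⟩ | ⟨y, hy⟩ | hy | hy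
      · omega
      · omega
      · exact ⟨by omega, by omega, by omega, by omega, hy.1, by omega⟩
      · omega
    refine hR.good _ (N - H.card) (by omega) (IH _ (by omega) _ _ hR.valid hTφ ?_)
    rcases Finset.eq_empty_or_nonempty φ.ext with h0 | h0
    · exact .blankPure hends.2.2.2.2.1 h0 hab hends.1 hends.2.1 (by omega)
    · have hv' : val side φ ∅ = pot side φ ∅ + extCnt side φ a := by
        rw [val_eq φ _ hab]; omega
      have e3 := entry_le_one (side := side) φ ∅ a
      have e4 := entry_le_one (side := side) φ ∅ b
      refine .outside (hR.head_side hab) h0 ?_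
      rw [add_assoc, entry_add _ _ hab]
      omega
  · have hk' : kind side p ψ.hd = .cross := by
      rw [kind_eq_cross]; exact ⟨z, rfl, by rw [hza, hpb, hba]⟩
    obtain ⟨⟨hV3, hE3, hsg3, hhd3⟩, -, c3⟩ := star_result hVψ hba hpb (by rw [hψ, hsa, hab])
      (κ := .cross) (by rw [kind_eq_cross]; exact ⟨x, hρp, by rw [hx, hpb, hba]⟩) hk'
    simp at c3
    have hT3 : Hitting side (ψ.star p) {p} := by simpa using hTψ.star_insert hk'
    obtain ⟨H, e, φ, hR⟩ := exists_runResult hV3 hT3 hab (t := x) (hhd3.trans hρp)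
      (by rw [hx, hsg3])
    have hp' := pot_eq (side := side) φ ({p} \ H) hab
    have b1 := hR.one_le
    have b2 := hR.ext_a
    have b3 := hR.ext_b
    have b4 := hR.cross
    have b5 := hR.card_le
    have b6 := hR.bal
    rw [Finset.card_singleton] at b5
    have hends : cnt side φ a .same = 0 ∧ cnt side φ b .same = 0 ∧ hdCnt side φ a = 0 ∧
        hdCnt side φ b = 0 ∧ φ.hd = none ∧ cnt side φ b .blank = 0 := by
      rcases hR.ends with ⟨y, hy⟩ | ⟨y, hy⟩ | hy | hy
      · omega
      · omega
      · exact ⟨by omega, by omega, by omega, by omega, hy.1, by omega⟩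
      · omega
    refine .of_star (i := p) (by omega) (by rw [hpb, hψ, hsa, hab])
      (hR.good _ (N - 1 - H.card) (by omega) (IH _ (by omega) _ _ hR.valid hR.hitting ?_))
    rcases Finset.eq_empty_or_nonempty φ.ext with h0 | h0
    · exact .blankPure hends.2.2.2.2.1 h0 hab hends.1 hends.2.1 (by omega)
    · have hv' : val side φ ({p} \ H) = pot side φ ({p} \ H) + extCnt side φ a := by
        rw [val_eq φ _ hab]; omega
      have e3 := entry_le_one (side := side) φ ({p} \ H) a
      have e4 := entry_le_one (side := side) φ ({p} \ H) b
      refine .outside (hR.head_side hab) h0 ?_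
      rw [add_assoc, entry_add _ _ hab]
      by_cases hpH : p ∈ H
      · have := hR.card_lt p (by simp) hpH
        rw [Finset.card_singleton] at this
        omega
      · have := entry_eq_zero (side := side) (σ := φ) (T := {p} \ H) (a := b) (by omega)
          (Finset.mem_sdiff.2 ⟨Finset.mem_singleton_self p, hpH⟩) hpb
        omega

set_option maxHeartbeats 1000000 in
-- With `b` sorted and no `same` content, no detour is possible: the unsorted slots of `a` are all
-- blank. The head is parked in a home slot `p`, and the symbol of `p` in a blank slot `r`. The head
-- is then blank, so a fetch can follow, and the parked symbol is at hand should the sign come out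
-- wrong.
theorem good_outside_bare (IH : ∀ M < N, Claim side M) (hside : ∀ a, ∃ i, side i = a)
    (hσ : σ.Valid) (hT : Hitting side σ T)
    {x : ι} (hd : σ.hd = some x) (hw : σ.ext.Nonempty) {a b : Bool} (hab : b = !a)
    (hx : side x = a) (hs : σ.sg = b) (hb : size side σ b = 0) (ha : cnt side σ a .same = 0)
    (h : val side σ T + entry side σ T a + entry side σ T b ≤ N) : Good side σ N := by
  have hba : a = !b := by simp [hab]
  have hh := hdCnt_some (side := side) hd hx
  have hh1 := hh.1
  have hh2 := hh.2 b hab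
  have hp := pot_eq (side := side) σ T hab
  have hbal := balance_both (side := side) hσ hab
  have hwa := extCnt_add (side := side) σ hab
  have hwc := Finset.card_pos.2 hw
  obtain ⟨p, hpb⟩ := hside b
  have hpk := kind_eq_home_of_size hb hpb
  have hpp := (kind_eq_home side).1 hpk
  unfold size at hb
  have hv : val side σ T = pot side σ T + extCnt side σ a + 1 := by
    rw [val_eq σ T hab]; omega
  have hT0 := hT.card_eq_zero hab (by omega) (by omega)
  have e1 := entry_eq_one_of_card (side := side) (σ := σ) (a := a) hT0
  have e2 := entry_eq_one_of_card (side := side) (σ := σ) (a := b) hT0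
  have hncr := not_cross_of_cnt (side := side) (σ := σ) hab (by omega) (by omega)
  have hxk : kind side x (σ.nx x) = .blank := by
    have h1 := hσ.kind_head (side := side) hd
    have h2 := kind_ne_of_cnt ha hx
    have h3 := hncr x
    revert h1 h2 h3
    cases kind side x (σ.nx x) <;> simp
  -- The destination of the head is itself blank and must not be chosen, as it would close a cycle
  -- with `p`. A second blank exists because some outside symbol is bound for `a`.
  obtain ⟨r, hra, hrk, hrx⟩ : ∃ r, side r = a ∧ kind side r (σ.nx r) = .blank ∧ r ≠ x := by
    obtain ⟨i, j, hi, hj, hij, ki, kj⟩ := exists_two_of_cnt (side := side) (σ := σ) (a := a)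
      (κ := .blank) (by omega)
    by_cases hix : i = x
    · exact ⟨j, hj, kj, by rw [← hix]; exact hij.symm⟩
    · exact ⟨i, hi, ki, hix⟩
  have hpr : p ≠ r := by
    rintro rfl
    rw [hpb, hab] at hra
    simp at hra
  have hpx : p ≠ x := by
    rintro rfl
    rw [hpb, hab] at hx
    simp at hx
  have hrn := (kind_eq_blank side).1 hrk
  obtain ⟨⟨hV, hE, hsg, hhd⟩, -, c1⟩ := star_result hσ hba hpb hs hpk (κ' := .cross)
    (by rw [hd, kind_eq_cross]; exact ⟨x, rfl, by rw [hx, hpb, hba]⟩)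
  obtain ⟨⟨hV2, hE2, hsg2, hhd2⟩, -, c2⟩ := star_result hV hab hra hsg (κ := .blank) (κ' := .cross)
    (by simp [star, Function.update_of_ne hpr.symm, hrn])
    (by rw [hhd, hpp, kind_eq_cross]; exact ⟨p, rfl, by rw [hpb, hra, hab]⟩)
  simp at c1 c2
  set ρ := (σ.star p).star r with hρ
  have hρp : ρ.nx p = some x := by simp [hρ, star, Function.update_of_ne hpr, hd]
  have hρr : ρ.nx r = some p := by simp [hρ, star, hpp]
  have hρo : ∀ i, i ≠ p → i ≠ r → ρ.nx i = σ.nx i := by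
    intro i hip hir
    simp [hρ, star, Function.update_of_ne hip, Function.update_of_ne hir]
  have hρd : ρ.hd = none := by rw [hhd2]; simp [star, Function.update_of_ne hpr.symm, hrn]
  have hTρ : Hitting side ρ ∅ := by
    refine ⟨by simp, fun C hC => ?_⟩
    have hall : ∀ c ∈ C, c = p ∨ c = r := by
      intro c hc
      by_contra hcon
      rw [not_or] at hcon
      exact hncr c (by rw [← hρo c hcon.1 hcon.2]; exact (hC c hc).1)
    have hpC : p ∉ C := by
      intro hpC
      obtain ⟨-, -, c, hc, e⟩ := hC p hpC
      rw [hρp, Option.some.injEq] at e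
      rcases hall c hc with rfl | rfl
      · exact hpx e.symm
      · exact hrx e.symm
    rw [Finset.eq_empty_iff_forall_notMem]
    intro c hc
    rcases hall c hc with rfl | rfl
    · exact hpC hc
    · obtain ⟨-, -, c', hc', e⟩ := hC c hc
      rw [hρr, Option.some.injEq] at e
      exact hpC (e ▸ hc')
  have hwc' : 3 * extCnt side ρ a + 5 ≤ N := by omega
  clear_value ρ
  clear hv hp hncr
  have hG : Good side ρ (N - 1 - 1) := by
    refine good_fetch_chain (ρ := ρ) (fun M hM => IH M (by omega)) hV2 hTρ hρd
      (by rw [hE2, hE]; exact hw) hab hpb hx hρp ?_ ?_ ?_ ?_ ?_ ?_ ?_ ?_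
    all_goals omega
  exact .of_star (i := p) (by omega) (by rw [hpb, hs]) (.of_star (i := r) (by omega)
    (by rw [hra, hsg]) (hρ ▸ hG))

/-- The induction step for states with a symbol at the head. -/
theorem good_of_head (IH : ∀ M < N, Claim side M) (hside : ∀ a, ∃ i, side i = a)
    (hσ : σ.Valid) (hT : Hitting side σ T) {x : ι} (hd : σ.hd = some x) (hcap : Cap side σ T N) :
    Good side σ N := by
  cases hcap with
  | outside hd' hw h =>
    obtain ⟨a, b, hab, hx, hs⟩ : ∃ a b, b = (!a) ∧ side x = a ∧ σ.sg = b :=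
      ⟨side x, σ.sg, by simp [hd' x hd], rfl, rfl⟩
    rw [add_assoc, entry_add _ _ hab, ← add_assoc] at h
    by_cases hU : 0 < cnt side σ b .same + cnt side σ b .blank
    · exact good_outside_uncrossed IH hσ hT hd hw hab hx hs hU h
    · by_cases hc : 0 < cnt side σ b .cross
      · exact good_outside_crossed IH hσ hT hd hw hab hx hs (by omega) (by omega) hc h
      · have hb : size side σ b = 0 := by unfold size; omega
        by_cases ha : 0 < cnt side σ a .same
        · exact good_outside_solo IH hside hσ hT hd hw hab hx hs hb ha h
        · exact good_outside_bare IH hside hσ hT hd hw hab hx hs hb (by omega) h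
  | blankPure hd' => simp [hd] at hd'
  | blankOne hd' => simp [hd] at hd'
  | blankOneOpp hd' => simp [hd] at hd'
  | blankSolo hd' => simp [hd] at hd'
  | blankSoloOpp hd' => simp [hd] at hd'
  | blankBoth hd' => simp [hd] at hd'
  | pure hd hw hab hx hs ha hb hc h h' => exact good_pure IH hσ hT hd hw hab hx hs ha hb hc h h'
  | solo hd hw hab hx hs hb h => exact good_solo IH hside hσ hd hw hab hx hs hb h
  | fwdFar hd hw hab hx hs hb ha hB hc h h1 h2 =>
    exact good_fwdFar IH hσ hT hd hw hab hx hs hb ha hB hc h h1 h2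
  | fwdNear hd hw hab hx hs hb ha hB h h' =>
    exact good_fwdNear IH hσ hT hd hw hab hx hs hb ha hB h h'
  | backFar hd hw hab hx hs hb ha hB h h' =>
    exact good_backFar IH hσ hT hd hw hab hx hs hb ha hB h h'
  | backNear hd hw hab hx hs hb ha hB h h' =>
    exact good_backNear IH hσ hT hd hw hab hx hs hb ha hB h h'
  | both hd hw hab hs ha hb hB h h' => exact good_both IH hσ hT hd hw hab hs ha hb hB h h'

end SortState

/-! ### Induction step: blank head, no outside symbols -/

namespace SortState

variable {ι : Type*} [Fintype ι] [DecidableEq ι] {side : ι → Bool}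
variable {N : ℕ} {σ : SortState ι} {T : Finset ι}

/-- Every slot is home or crossed. If `T` is empty, the crossed slots form a closed set, so there
are none. Otherwise an element of `T`, shifted to the side of the sign, is replaced by the blank,
which opens its cycle at the price of that element. -/
theorem good_blankPure (IH : ∀ M < N, Claim side M) (hσ : σ.Valid) (hT : Hitting side σ T)
    (hd : σ.hd = none) (hw : σ.ext = ∅) {a b : Bool} (hab : b = !a)
    (ha : cnt side σ a .same = 0) (hb : cnt side σ b .same = 0) (h : pot side σ T ≤ N) :
    Good side σ N := by
  wlog hs : σ.sg = b generalizing a b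
  · refine this (a := b) (b := a) (by simp [hab]) hb ha ?_
    revert hs
    rw [hab]
    cases σ.sg <;> cases a <;> simp
  have hba : a = !b := by simp [hab]
  have hh1 := hdCnt_none (side := side) hd a
  have hh2 := hdCnt_none (side := side) hd b
  have hp := pot_eq (side := side) σ T hab
  have hbal := balance_both (side := side) hσ hab
  have w1 := extCnt_eq_zero (side := side) hw a
  have w2 := extCnt_eq_zero (side := side) hw b
  by_cases hT0 : T.card = 0
  · rw [Finset.card_eq_zero] at hT0
    subst hT0
    have hk : ∀ i, kind side i (σ.nx i) = .home ∨ kind side i (σ.nx i) = .cross := by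
      intro i
      obtain ⟨c, hc, hc1, hc2⟩ : ∃ c, side i = c ∧ cnt side σ c .same = 0 ∧
          cnt side σ c .blank = 0 := by
        rcases Bool.eq_or_eq_not (side i) a with h | h
        · exact ⟨a, h, ha, by omega⟩
        · exact ⟨b, h.trans hab.symm, hb, by omega⟩
      have h1 := kind_ne_of_cnt hc1 hc
      have h2 := kind_ne_of_cnt hc2 hc
      revert h1 h2
      cases kind side i (σ.nx i) <;> simp
    have hC := hT.2 {i | kind side i (σ.nx i) = .cross} (by
      intro c hc
      simp only [Finset.mem_filter, Finset.mem_univ, true_and] at hc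
      obtain ⟨l, hl, -⟩ := (kind_eq_cross side).1 hc
      refine ⟨hc, by simp, l, ?_, hl⟩
      simp only [Finset.mem_filter, Finset.mem_univ, true_and]
      exact (hk l).resolve_left (hσ.kind_succ hl (by rw [hc]; simp)))
    refine .done fun i => (kind_eq_home side).1 ((hk i).resolve_right fun hi => ?_)
    have : i ∈ ({i | kind side i (σ.nx i) = .cross} : Finset ι) := by simpa using hi
    rw [hC] at this
    simp at this
  · obtain ⟨p, T', hpb, hT', hcard, hpk⟩ := hT.shift hσ (by omega) hb
    have hpk : kind side p (σ.nx p) = .cross ∧ p ∈ T' :=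
      hpk.resolve_right (kind_ne_of_cnt (by omega) hpb)
    rw [Finset.insert_eq_of_mem hpk.2] at hcard
    have hT'' := hT'.star_erase (i := p) (by rw [hd]; simp)
    have hcard' := Finset.card_erase_add_one hpk.2
    obtain ⟨⟨hV, hE, hsg, hhd⟩, -, k⟩ := star_result hσ hba hpb hs hpk.1 (κ' := .blank)
      (by rw [hd]; rfl)
    simp at k
    obtain ⟨l, hl, hls⟩ := (kind_eq_cross side).1 hpk.1
    obtain ⟨H, e, φ, hR⟩ := exists_runResult hV hT'' hab (hhd.trans hl)
      (by rw [hls, hpb, hsg, hba])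
    have hp' := pot_eq (side := side) φ (T'.erase p \ H) hab
    have b1 := hR.one_le
    have b2 := hR.ext_a
    have b3 := hR.ext_b
    have b4 := hR.cross
    have b5 := hR.card_le
    have hends : cnt side φ a .same = 0 ∧ cnt side φ b .same = 0 ∧ hdCnt side φ a = 0 ∧
        hdCnt side φ b = 0 ∧ φ.hd = none := by
      rcases hR.ends with ⟨y, hy⟩ | ⟨y, hy⟩ | hy | hy
      · omega
      · omega
      · exact ⟨by omega, by omega, by omega, by omega, hy.1⟩
      · exact ⟨by omega, by omega, by omega, by omega, hy.1⟩
    refine .of_star (i := p) (by omega) (by rw [hpb, hs])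
      (hR.good _ (N - 1 - H.card) (by omega) (IH _ (by omega) _ _ hR.valid hR.hitting ?_))
    exact .blankPure hends.2.2.2.2 (hR.ext_eq.trans (hE.trans hw)) hab hends.1 hends.2.1 (by omega)

theorem nx_ne_self_of_same {a : Bool} {i : ι} (hi : i ∈ slots side σ a .same) :
    σ.nx i ≠ some i := by
  intro hii
  rw [mem_slots, kind_eq_same, hii] at hi
  obtain ⟨-, j, hj, hji, -⟩ := hi
  exact hji (Option.some_injective _ hj).symm

/-- The effect of exchanging a blank head for a symbol of kind `same` on side `a`. -/
theorem star_blank_same (hσ : σ.Valid) {a b : Bool} (hab : b = !a)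
    (hd : σ.hd = none) (hs : σ.sg = a) {q : ι}
    (hq : side q = a) (hk : kind side q (σ.nx q) = .same) :
    (σ.star q).Valid ∧ (σ.star q).ext = σ.ext ∧ (σ.star q).sg = b ∧
    (∃ y, (σ.star q).hd = some y ∧ side y = a) ∧
    (∀ T, Hitting side σ T → Hitting side (σ.star q) T) ∧
    hdCnt side (σ.star q) a = 1 ∧ hdCnt side (σ.star q) b = 0 ∧
    cnt side (σ.star q) a .same + 1 = cnt side σ a .same ∧
    cnt side (σ.star q) a .cross = cnt side σ a .cross ∧
    cnt side (σ.star q) a .blank = cnt side σ a .blank + 1 ∧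
    cnt side (σ.star q) b .same = cnt side σ b .same ∧
    cnt side (σ.star q) b .cross = cnt side σ b .cross ∧
    cnt side (σ.star q) b .blank = cnt side σ b .blank ∧
    extCnt side (σ.star q) a = extCnt side σ a ∧
    extCnt side (σ.star q) b = extCnt side σ b := by
  obtain ⟨⟨hV, hE, hsg, hhd⟩, -, k1, k2, k3, k4, k5, k6, k7, k8⟩ :=
    star_result hσ hab hq hs hk (κ' := .blank) (by rw [hd]; rfl)
  simp at k1 k2 k3
  obtain ⟨y, hy, -, hys⟩ := (kind_eq_same side).1 hk
  have hh := hdCnt_some (side := side) (hhd.trans hy) (hys.trans hq)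
  refine ⟨hV, hE, hsg, ⟨y, hhd.trans hy, hys.trans hq⟩, fun T hT => ?_, hh.1, hh.2 b hab,
    k1, k2, k3, k4, k5, k6, k7, k8⟩
  have hqT : q ∉ T := fun hqT => by
    have := hT.1 q hqT
    rw [hk] at this
    simp at this
  have := hT.star_erase (i := q) (by rw [hd]; simp)
  rwa [Finset.erase_eq_of_notMem hqT] at this

/-- Lifting a `same` content by the blank lowers neither `pot` nor the sizes, which is why the blank
states carry a larger surcharge. -/
theorem good_blankBoth (IH : ∀ M < N, Claim side M) (hσ : σ.Valid) (hT : Hitting side σ T)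
    (hd : σ.hd = none) (hw : σ.ext = ∅) {a b : Bool} (hab : b = !a)
    (hs : σ.sg = a) (ha : 0 < cnt side σ a .same) (hb : 0 < cnt side σ b .same)
    (h : val side σ T + 2 ≤ N) (h' : size side σ a ≤ size side σ b → val side σ T + 3 ≤ N) :
    Good side σ N := by
  have hba : a = !b := by simp [hab]
  have hh1 := hdCnt_none (side := side) hd a
  have hh2 := hdCnt_none (side := side) hd b
  have hp := pot_eq (side := side) σ T hab
  have hv := val_eq (side := side) σ T hab
  have hbal := balance_both (side := side) hσ hab
  have w1 := extCnt_eq_zero (side := side) hw a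
  have w2 := extCnt_eq_zero (side := side) hw b
  unfold size at h'
  obtain ⟨q, hq, hk⟩ := exists_of_cnt_pos ha
  obtain ⟨hV, hE, hsg, ⟨y, hy, hys⟩, hH, k⟩ := star_blank_same hσ hab hd hs hq hk
  have hp' := pot_eq (side := side) (σ.star q) T hab
  have hv' := val_eq (side := side) (σ.star q) T hab
  refine .of_star (i := q) (by omega) (by rw [hq, hs]) (IH _ (by omega) _ _ hV (hH T hT) ?_)
  by_cases h1 : cnt side σ a .same = 1
  · exact .backNear hy (hE.trans hw) hba hys hsg (by omega) (by omega) (by omega) (by omega)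
      (fun _ => by omega)
  · exact .both hy (hE.trans hw) hab (by rw [hys, hsg, hba]) (by omega) (by omega) (by omega)
      (by omega) (fun hsz => by unfold size at hsz; omega)

/-- The sign is that of the sorted side, so three moves of a detour are spent; they create crossed
slots and provide the sign of `a`. A detour lowers the surplus of `a` by two, so the rest suffices.
-/
theorem good_blankSoloOpp (IH : ∀ M < N, Claim side M) (hside : ∀ a, ∃ i, side i = a)
    (hσ : σ.Valid) (hd : σ.hd = none) (hw : σ.ext = ∅) {a b : Bool} (hab : b = !a)
    (hs : σ.sg = b) (hb : cnt side σ b .same = 0) (ha : 0 < cnt side σ a .same)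
    (hc : cnt side σ b .cross = 0) (h : val side σ T + 3 ≤ N) : Good side σ N := by
  have hh1 := hdCnt_none (side := side) hd a
  have hh2 := hdCnt_none (side := side) hd b
  have hp := pot_eq (side := side) σ T hab
  have hv := val_eq (side := side) σ T hab
  have hbal := balance_both (side := side) hσ hab
  have w1 := extCnt_eq_zero (side := side) hw a
  have w2 := extCnt_eq_zero (side := side) hw b
  obtain ⟨p, hpb⟩ := hside b
  have hpk := kind_eq_home_of_size (side := side) (σ := σ) (by unfold size; omega) hpb
  obtain ⟨q, hq, hqk⟩ := Finset.one_lt_card.1 (show 1 < (slots side σ a .same).card by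
    obtain ⟨q, hq, hqk⟩ := exists_of_cnt_pos ha
    have hq' := (mem_slots side).2 ⟨hq, hqk⟩
    obtain ⟨q', hq'', e⟩ := closedSame_of_cnt hσ (by omega) (by omega) q hq'
    exact Finset.one_lt_card.2 ⟨q, hq', q', hq'', fun h =>
      nx_ne_self_of_same hq' (by rw [e, h])⟩)
  obtain ⟨q', hq', hne⟩ := hqk
  have hcard : 2 ≤ cnt side σ a .same := Finset.one_lt_card.2 ⟨q, hq, q', hq', hne⟩
  rw [mem_slots] at hq
  obtain ⟨τ, ⟨hV, hE, hhd, hsg, h1, h2, h3, hG⟩, k⟩ := detour hσ hab hs hpb hpk hq.1 hq.2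
  have hTτ := detour_hitting hab hpb hq.1 hq.2 (not_cross_of_cnt hab (by omega) (by omega)) h1 h2 h3
  have hp' := pot_eq (side := side) τ ∅ hab
  rw [Finset.card_empty] at hp'
  have hv' := val_eq (side := side) τ ∅ hab
  refine hG (N - 3) N (by omega) (IH _ (by omega) _ _ hV hTτ ?_)
  exact .blankOne (hhd.trans hd) (hE.trans hw) hab hsg (by omega) (by omega) (by omega) (by omega)

set_option maxHeartbeats 1000000 in
-- The sign only allows a move on `b`, where all unsorted slots are crossed. Exchanging the blank
-- for a crossed content opens a cycle of `T`, or a mere chain if `T` is empty, and a run follows.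
theorem good_blankOneOpp (IH : ∀ M < N, Claim side M) (hσ : σ.Valid) (hT : Hitting side σ T)
    (hd : σ.hd = none) (hw : σ.ext = ∅) {a b : Bool} (hab : b = !a)
    (hs : σ.sg = b) (hb : cnt side σ b .same = 0) (ha : 0 < cnt side σ a .same)
    (hc : 0 < cnt side σ b .cross) (h : val side σ T + 1 ≤ N)
    (h' : T.card = 0 ∨ ClosedSame side σ a → val side σ T + 2 ≤ N) : Good side σ N := by
  have hba : a = !b := by simp [hab]
  have hh1 := hdCnt_none (side := side) hd a
  have hh2 := hdCnt_none (side := side) hd b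
  have hp := pot_eq (side := side) σ T hab
  have hbal := balance_both (side := side) hσ hab
  have w1 := extCnt_eq_zero (side := side) hw a
  have w2 := extCnt_eq_zero (side := side) hw b
  have hv : val side σ T = pot side σ T + cnt side σ a .same := by
    rw [val_eq σ T hab]; omega
  obtain ⟨p, T', hpb, hpk, hT', hcard⟩ : ∃ p T', side p = b ∧ kind side p (σ.nx p) = .cross ∧
      Hitting side (σ.star p) T' ∧ (T.card = 0 ∧ T'.card = 0 ∧ T = ∅ ∨ T'.card + 1 ≤ T.card) := by
    by_cases hT0 : T.card = 0
    · obtain ⟨p, hpb, hpk⟩ := exists_of_cnt_pos hc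
      have := hT.star_erase (i := p) (by rw [hd]; simp)
      have h0 := Finset.card_eq_zero.1 hT0
      rw [h0, Finset.erase_empty] at this
      exact ⟨p, ∅, hpb, hpk, this, .inl ⟨hT0, by simp, h0⟩⟩
    · obtain ⟨p, T', hpb, hT', hcard, hpk⟩ := hT.shift hσ (by omega) hb
      have hpk : kind side p (σ.nx p) = .cross ∧ p ∈ T' :=
        hpk.resolve_right (kind_ne_of_cnt (by omega) hpb)
      rw [Finset.insert_eq_of_mem hpk.2] at hcard
      refine ⟨p, T'.erase p, hpb, hpk.1, hT'.star_erase (i := p) (by rw [hd]; simp), .inr ?_⟩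
      rw [Finset.card_erase_add_one hpk.2]
      exact hcard
  obtain ⟨⟨hV, hE, hsg, hhd⟩, -, k⟩ := star_result hσ hba hpb hs hpk (κ' := .blank)
    (by rw [hd]; rfl)
  simp at k
  obtain ⟨l, hl, hls⟩ := (kind_eq_cross side).1 hpk
  obtain ⟨H, e, φ, hR⟩ := exists_runResult hV hT' hab (hhd.trans hl)
    (by rw [hls, hpb, hsg, hba])
  have hp' := pot_eq (side := side) φ (T' \ H) hab
  have b1 := hR.one_le
  have b2 := hR.ext_a
  have b3 := hR.ext_b
  have b4 := hR.cross
  have b5 := hR.card_le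
  have b6 := hR.bal
  have hw' := hR.ext_eq.trans (hE.trans hw)
  have hA : val side σ T + T'.card + 2 ≤ N + T.card := by
    clear hp hbal hv k hp' b2 b3 b4 b5 b6
    rcases hcard with h0 | h0
    · have := h' (.inl h0.1)
      omega
    · omega
  have hv' : val side φ (T' \ H) = pot side φ (T' \ H) + cnt side φ a .same := by
    clear hp' hv hA hp h
    rw [val_eq φ _ hab]
    rcases hR.ends with ⟨y, hy⟩ | ⟨y, hy⟩ | hy | hy <;> omega
  have hroom : (H.card + 1 ≤ N) := by
    rcases hR.ends with h | h | h | h <;> omega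
  refine .of_star (i := p) (by omega) (by rw [hpb, hs])
    (hR.good _ (N - 1 - H.card) (by omega) (IH _ (by omega) _ _ hR.valid hR.hitting ?_))
  rcases hR.ends with ⟨y, hy⟩ | ⟨y, hy⟩ | hy | hy
  · by_cases hsa : cnt side φ a .same = 0
    · exact .pure hy.1 hw' hab hy.2.1 hy.2.2.1 hsa (by omega) (by omega) (by omega)
        (fun _ => by omega)
    · exact .fwdNear hy.1 hw' hab hy.2.1 hy.2.2.1 (by omega) (by omega) (by omega) (by omega)
        (fun _ => by omega)
  · omega
  · omega
  · by_cases hs0 : cnt side φ b .cross = 0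
    · have hcl : ClosedSame side σ a := by
        have := closedSame_of_cnt (side := side) hR.valid (a := a) (by omega) (by omega)
        rw [hR.eq] at this
        exact closedSame_of_star (by rw [hpb, hab]; simp) (closedSame_of_fill hR.run hy.2.2.2.1 this)
      have := h' (.inr hcl)
      rcases hcard with ⟨-, -, h0⟩ | h0
      · exfalso
        -- The only blank of `b` is at `p`, so the run comes back to `p`. Before the move its slots
        -- then formed a closed set of crossed slots, which an empty hitting set excludes.
        have hep : e = p := by
          by_contra hep
          have h1 := hy.2.2.2.1
          simp only [star, Function.update_of_ne hep] at h1
          exact kind_ne_of_cnt (by omega) hy.2.2.1 h1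
        have hH := hT.2 H (fun c hc => by
          refine ⟨?_, by simp [h0], ?_⟩
          · by_cases hcp : c = p
            · rw [hcp]; exact hpk
            · have := (hR.run.step c hc (by rw [hep]; exact hcp)).1
              simpa [star, Function.update_of_ne hcp] using this
          · by_cases hcp : c = p
            · obtain ⟨t, ht, e'⟩ := hR.run.hd_mem
              rw [hcp]
              exact ⟨t, ht, by simpa [star] using e'⟩
            · have := (hR.run.step c hc (by rw [hep]; exact hcp)).2
              simpa [star, Function.update_of_ne hcp] using this)
        have := hR.run.end_mem
        rw [hH] at this
        simp at this
      · exact .blankSolo hy.1 hw' hab hy.2.1 (by omega) (by omega) hs0 (by omega)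
    · exact .blankOne hy.1 hw' hab hy.2.1 (by omega) (by omega) (by omega) (by omega)

end SortState

/-! ### Blank head, contents of kind `same` on the side of the sign only -/

namespace SortState

variable {ι : Type*} [Fintype ι] [DecidableEq ι] {side : ι → Bool}
variable {N : ℕ} {σ : SortState ι} {T : Finset ι}

/-- In a permutation of at least three elements without fixed points, an element off `q` and its
successor can be chosen that, from four elements on, is itself the successor of a fourth element. -/
theorem exists_third {A : Finset ι} {f : ι → Option ι} (hf : ∀ i ∈ A, f i ≠ some i)
    (hinj : ∀ i j t, f i = some t → f j = some t → i = j)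
    (hcl : ∀ i ∈ A, ∃ j ∈ A, f i = some j) {q r : ι} (hqr : f q = some r)
    (hA : 3 ≤ A.card) :
    ∃ u ∈ A, u ≠ q ∧ u ≠ r ∧ (A.card = 3 ∨ ∃ v ∈ A, v ≠ q ∧ v ≠ r ∧ v ≠ u ∧ f v = some u) := by
  have hc : A.card ≤ (A \ {q, r}).card + 2 := by
    have := Finset.le_card_sdiff {q, r} A
    have := Finset.card_le_two (a := q) (b := r)
    omega
  have key : ∀ v ∈ A \ {q, r}, f v ≠ some q → ∃ u ∈ A, u ≠ q ∧ u ≠ r ∧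
      (A.card = 3 ∨ ∃ v ∈ A, v ≠ q ∧ v ≠ r ∧ v ≠ u ∧ f v = some u) := by
    intro v hv hvq
    simp only [Finset.mem_sdiff, Finset.mem_insert, Finset.mem_singleton, not_or] at hv
    obtain ⟨u, hu, e⟩ := hcl v hv.1
    refine ⟨u, hu, ?_, ?_, .inr ⟨v, hv.1, hv.2.1, hv.2.2, ?_, e⟩⟩
    · rintro rfl; exact hvq e
    · rintro rfl; exact hv.2.1 (hinj _ _ _ e hqr)
    · rintro rfl; exact hf _ hv.1 e
  by_cases h3 : A.card = 3
  · obtain ⟨u, hu⟩ := Finset.card_pos.1 (show 0 < (A \ {q, r}).card by omega)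
    simp only [Finset.mem_sdiff, Finset.mem_insert, Finset.mem_singleton, not_or] at hu
    exact ⟨u, hu.1, hu.2.1, hu.2.2, .inl h3⟩
  · obtain ⟨u, hu, v, hv, huv⟩ := Finset.one_lt_card.1 (show 1 < (A \ {q, r}).card by omega)
    -- At most one of the two elements has successor `q`; the other one serves as `v`.
    by_cases h : f u = some q
    · exact key v hv fun h' => huv (hinj _ _ _ h h')
    · exact key u hu h

set_option maxHeartbeats 1000000 in
-- All unsorted slots are on `a` and permuted within `a`. One symbol is lifted from `q`, and a
-- detour at another slot `u` gives it the sign of its side. For two slots, the run clears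
-- everything. For more, `u` avoids the successor `r` of `q`, so the run is the single move to `r`.
theorem good_blankSolo (IH : ∀ M < N, Claim side M) (hside : ∀ a, ∃ i, side i = a)
    (hσ : σ.Valid) (hd : σ.hd = none) (hw : σ.ext = ∅) {a b : Bool} (hab : b = !a)
    (hs : σ.sg = a) (hb : cnt side σ b .same = 0) (ha : 0 < cnt side σ a .same)
    (hc : cnt side σ b .cross = 0) (h : val side σ T + 2 ≤ N) : Good side σ N := by
  have hba : a = !b := by simp [hab]
  have hbal := balance_both (side := side) hσ hab
  rw [hdCnt_none hd a, hdCnt_none hd b, extCnt_eq_zero hw a, extCnt_eq_zero hw b] at hbal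
  have z1 : cnt side σ a .cross = 0 := by omega
  have z2 : cnt side σ a .blank = 0 := by omega
  have z3 : cnt side σ b .blank = 0 := by omega
  replace h : 3 * cnt side σ a .same + 2 ≤ N := by
    have hp := pot_eq (side := side) σ T hab
    have hv := val_eq (side := side) σ T hab
    omega
  clear hbal
  have hcl := closedSame_of_cnt hσ z1 z2
  obtain ⟨p, hpb⟩ := hside b
  have hpk := kind_eq_home_of_size (side := side) (σ := σ) (by unfold size; omega) hpb
  obtain ⟨q, hqm⟩ := Finset.card_pos.1 ha
  obtain ⟨r, hrm, hqr⟩ := hcl q hqm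
  have hqr' : r ≠ q := by rintro rfl; exact nx_ne_self_of_same hqm hqr
  have hpA : ∀ i ∈ slots side σ a .same, i ≠ p := by
    rintro i hi rfl
    rw [mem_slots, hpb, hab] at hi
    simp at hi
  have hcard : 2 ≤ cnt side σ a .same := Finset.one_lt_card.2 ⟨q, hqm, r, hrm, hqr'.symm⟩
  obtain ⟨u, hum, huq, hu⟩ : ∃ u ∈ slots side σ a .same, u ≠ q ∧ (cnt side σ a .same = 2 ∨
      u ≠ r ∧ (cnt side σ a .same = 3 ∨
        ∃ v ∈ slots side σ a .same, v ≠ q ∧ v ≠ r ∧ v ≠ u ∧ σ.nx v = some u)) := by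
    by_cases h2 : cnt side σ a .same = 2
    · exact ⟨r, hrm, hqr', .inl h2⟩
    · obtain ⟨u, hu, h1, h2, h3⟩ := exists_third (A := slots side σ a .same)
        (fun i hi => nx_ne_self_of_same hi) hσ.1 hcl hqr
        (show 3 ≤ cnt side σ a .same by omega)
      exact ⟨u, hu, h1, .inr ⟨h2, h3⟩⟩
  have hq := (mem_slots side).1 hqm
  have hu' := (mem_slots side).1 hum
  obtain ⟨hV, hE, hsg, -, hH, k⟩ := star_blank_same hσ hab hd hs hq.1 hq.2
  have hnx : ∀ i, i ≠ q → (σ.star q).nx i = σ.nx i := fun i hi => by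
    simp [star, Function.update_of_ne hi]
  obtain ⟨τ, ⟨hVτ, hEτ, hhd, hsgτ, h1, h2, h3, hG⟩, k'⟩ := detour (p := p) (q := u) hV hab hsg hpb
    (by rw [hnx p (hpA q hqm).symm]; exact hpk) hu'.1 (by rw [hnx u huq]; exact hu'.2)
  have hTτ := detour_hitting hab hpb hu'.1 (by rw [hnx u huq]; exact hu'.2)
    (not_cross_of_cnt hab (by omega) (by omega)) h1 h2 h3
  have hhdτ : τ.hd = some r := by rw [hhd]; simpa [star] using hqr
  have hr := (mem_slots side).1 hrm
  obtain ⟨H, e, φ, hR⟩ := exists_runResult hVτ hTτ hab hhdτ (by rw [hr.1, hsgτ])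
  have hp' := pot_eq (side := side) φ (∅ \ H) hab
  rw [Finset.empty_sdiff, Finset.card_empty] at hp'
  have hTφ := hR.hitting
  rw [Finset.empty_sdiff] at hTφ
  have hw' := hR.ext_eq.trans (hEτ.trans (hE.trans hw))
  have b1 := hR.one_le
  have b2 := extCnt_eq_zero (side := side) hw' a
  have b3 := extCnt_eq_zero (side := side) hw' b
  have b4 := hR.cross
  have b6 := hR.bal
  rw [b2, b3] at b6 hp'
  have hroom : 4 + H.card ≤ N := by omega
  refine .of_star (i := q) (by omega) (by rw [hq.1, hs]) (hG (N - 1 - 3) _ (by omega)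
    (hR.good _ (N - 1 - 3 - H.card) (by omega) (IH _ (by omega) _ _ hR.valid hTφ ?_)))
  rcases hu with hu2 | ⟨hur, hu⟩
  · rcases hR.ends with ⟨y, hy⟩ | ⟨y, hy⟩ | hy | hy
    · omega
    · omega
    · exact .blankPure hy.1 hw' hab (by omega) (by omega) (by omega)
    · exact .blankPure hy.1 hw' hab (by omega) (by omega) (by omega)
  · have hτr : τ.nx r = σ.nx r := by rw [h1 r (hpA r hrm) hur.symm, hnx r hqr']
    have hre : r = e := by
      by_contra hre
      obtain ⟨t, ht, e'⟩ := hR.run.hd_mem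
      rw [hhdτ, Option.some.injEq] at e'
      have := (hR.run.step r (e' ▸ ht) hre).1
      rw [hτr, hr.2] at this
      simp at this
    have hke : kind side e (τ.nx e) = .same := by rw [← hre, hτr]; exact hr.2
    have hH1 : H.card ≤ 1 := by
      refine Finset.card_le_card (t := {r}) (hR.run.minimal {r} (fun t ht => ?_) ?_)
      · rw [hhdτ, Option.some.injEq] at ht
        simp [ht]
      · intro d hd hde
        exact absurd ((Finset.mem_singleton.1 hd).trans hre) hde
    rcases hR.ends with ⟨y, hy⟩ | ⟨y, hy⟩ | hy | hy
    · rcases hu with hu3 | ⟨v, hvm, hvq, hvr, hvu, hvn⟩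
      · exact .pure hy.1 hw' hab hy.2.1 hy.2.2.1 (by omega) (by omega) (by omega) (by omega)
          (fun _ => by omega)
      · have hφs := slots_same_fill hR.run a
        rw [← hR.eq] at hφs
        have hv := (mem_slots side).1 hvm
        have hτv : τ.nx v = some u := by rw [h1 v (hpA v hvm) hvu, hnx v hvq, hvn]
        have hvτ : kind side v (τ.nx v) = .same := by rw [hτv, ← hvn]; exact hv.2
        have hvφ : v ∈ slots side φ a .same := by
          rw [hφs, Finset.mem_erase, ← hre]
          exact ⟨hvr, (mem_slots side).2 ⟨hv.1, hvτ⟩⟩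
        have hvH : v ∉ H := by
          intro hvH
          have := (hR.run.step v hvH (by rw [← hre]; exact hvr)).1
          rw [hvτ] at this
          simp at this
        -- The content of `v` is bound for `u`, which after the detour holds a symbol of the other
        -- side.
        have hncl : ¬ ClosedSame side φ a := by
          intro hcl
          obtain ⟨w, hwm, e'⟩ := hcl v hvφ
          rw [hR.eq] at e'
          simp only [fill, hvH, if_false] at e'
          rw [hτv, Option.some.injEq] at e'
          rw [hφs, Finset.mem_erase, mem_slots, ← e', h2] at hwm
          have := (kind_eq_same side).1 hwm.2.2
          simp only [Option.some.injEq] at this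
          obtain ⟨j, hj, -, hjs⟩ := this
          rw [← hj, hpb, hu'.1, hab] at hjs
          simp at hjs
        have h4 : 4 ≤ cnt side σ a .same := by
          have hsub : ({q, r, u, v} : Finset ι) ⊆ slots side σ a .same := by
            intro i hi
            simp only [Finset.mem_insert, Finset.mem_singleton] at hi
            rcases hi with rfl | rfl | rfl | rfl <;> assumption
          have := Finset.card_le_card hsub
          rw [Finset.card_insert_of_notMem, Finset.card_insert_of_notMem,
            Finset.card_insert_of_notMem, Finset.card_singleton] at this
          · exact this
          · simp [Ne.symm hvu]
          · simp [Ne.symm hur, Ne.symm hvr]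
          · simp [Ne.symm hqr', Ne.symm huq, Ne.symm hvq]
        have hv' : val side φ ∅ = pot side φ ∅ + cnt side φ a .same + 1 := by
          rw [val_eq φ _ hab]; omega
        exact .fwdFar hy.1 hw' hab hy.2.1 hy.2.2.1 (by omega) (by omega) (by omega) (by omega)
          (by omega) (fun _ => by omega) (fun _ h => absurd h hncl)
    · omega
    · rw [hke] at hy; simp at hy
    · rw [hke] at hy; simp at hy

set_option maxHeartbeats 1000000 in
-- Merely lifting a symbol would lead to a far state with empty `T`, one move too expensive. Two
-- moves are therefore planned together: the symbol lifted from `q` is parked at once in a crossed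
-- slot `p`, and `q` is chosen so that the ensuing run misses `p`. Thus `p` stays in `T` and remains
-- useful.
theorem good_blankOne_untied (IH : ∀ M < N, Claim side M) (hσ : σ.Valid) (hT : Hitting side σ ∅)
    (hd : σ.hd = none) (hw : σ.ext = ∅) {a b : Bool} (hab : b = !a)
    (hs : σ.sg = a) (hb : cnt side σ b .same = 0) (ha : 2 ≤ cnt side σ a .same)
    (hc : 0 < cnt side σ b .cross) (h : val side σ ∅ + 1 ≤ N) : Good side σ N := by
  have hba : a = !b := by simp [hab]
  have hbal := balance_both (side := side) hσ hab
  rw [hdCnt_none hd a, hdCnt_none hd b, extCnt_eq_zero hw a, extCnt_eq_zero hw b] at hbal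
  have z1 : cnt side σ a .cross = cnt side σ b .cross := by omega
  have z2 : cnt side σ a .blank = 0 := by omega
  have z3 : cnt side σ b .blank = 0 := by omega
  replace h : 3 * cnt side σ a .same + 2 * cnt side σ b .cross + 1 ≤ N := by
    have hp := pot_eq (side := side) σ ∅ hab
    have hv := val_eq (side := side) σ ∅ hab
    omega
  clear hbal
  obtain ⟨p, hpb, hpk⟩ := exists_of_cnt_pos hc
  obtain ⟨x, hpx, hxs⟩ := (kind_eq_cross side).1 hpk
  have hxa : side x = a := by rw [hxs, hpb, hba]
  -- Only the path from the destination of the content of `p` to the first uncrossed slot `q₁` is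
  -- wanted. The sign is set artificially to make the run available.
  obtain ⟨D, q₁, hD, -⟩ := exists_run (side := side) (σ := ⟨(σ.star p).nx, (σ.star p).hd, a⟩)
    (hσ.star p) (t := x) (by simpa [star] using hpx) hxa
  have hDx : x ∈ D := by
    obtain ⟨t, ht, e⟩ := hD.hd_mem
    simp only [star, hpx, Option.some.injEq] at e
    exact e ▸ ht
  have hq₁p : q₁ ≠ p := by
    intro hqp
    have := hT.2 D (fun c hc => by
      refine ⟨?_, by simp, ?_⟩
      · by_cases hcp : c = p
        · rw [hcp]; exact hpk
        · simpa [star, Function.update_of_ne hcp] using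
            (hD.step c hc (by rw [hqp]; exact hcp)).1
      · by_cases hcp : c = p
        · exact ⟨x, hDx, by rw [hcp, hpx]⟩
        · simpa [star, Function.update_of_ne hcp] using
            (hD.step c hc (by rw [hqp]; exact hcp)).2)
    rw [this] at hDx
    simp at hDx
  have hpD : p ∉ D := by
    intro hpD
    have := (hD.step p hpD hq₁p.symm).1
    simp [star, hd] at this
  have hDstep : ∀ c ∈ D, c ≠ q₁ →
      kind side c (σ.nx c) = .cross ∧ ∃ c' ∈ D, σ.nx c = some c' := by
    intro c hc hcq
    have hcp : c ≠ p := by rintro rfl; exact hpD hc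
    simpa [star, Function.update_of_ne hcp] using hD.step c hc hcq
  have hq₁k : kind side q₁ (σ.nx q₁) = .same ∨ kind side q₁ (σ.nx q₁) = .blank := by
    simpa [star, Function.update_of_ne hq₁p] using hD.end_kind
  have hq₁ : q₁ ∈ slots side σ a .same := by
    rw [mem_slots]
    rcases Bool.eq_or_eq_not (side q₁) a with hs1 | hs1
    · exact ⟨hs1, hq₁k.resolve_right (kind_ne_of_cnt z2 hs1)⟩
    · exfalso
      rw [← hab] at hs1
      rcases hq₁k with h | h
      · exact kind_ne_of_cnt hb hs1 h
      · exact kind_ne_of_cnt z3 hs1 h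
  have hne : ((slots side σ a .same).erase q₁).Nonempty := by
    rw [← Finset.card_pos, Finset.card_erase_of_mem hq₁]
    have : 2 ≤ (slots side σ a .same).card := ha
    omega
  -- Slot `q₁` is excluded since the run will fill it; among the others `q` is chosen so that the
  -- rest is not closed.
  obtain ⟨q, hqm, hqc⟩ := exists_erase_not_closed hne (f := σ.nx)
    (fun i hi => nx_ne_self_of_same (Finset.mem_of_mem_erase hi))
  rw [Finset.mem_erase] at hqm
  have hq := (mem_slots side).1 hqm.2
  have hqp : q ≠ p := by
    rintro rfl
    rw [hpb, hab] at hq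
    simp at hq
  obtain ⟨hV, hE, hsg, ⟨y, hy, hys⟩, hH, k⟩ := star_blank_same hσ hab hd hs hq.1 hq.2
  have hk' : kind side p (σ.star q).hd = .cross := by
    rw [kind_eq_cross]; exact ⟨y, hy, by rw [hys, hpb, hba]⟩
  obtain ⟨⟨hV2, hE2, hsg2, hhd2⟩, -, k2⟩ := star_result hV hba hpb hsg (κ := .cross)
    (by simpa [star, Function.update_of_ne hqp.symm] using hpk) hk'
  simp at k2
  have hT2 : Hitting side ((σ.star q).star p) {p} := by
    simpa using (hH ∅ hT).star_insert hk'
  have hnx : ∀ i, i ≠ p → i ≠ q → ((σ.star q).star p).nx i = σ.nx i := by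
    intro i hip hiq
    simp [star, Function.update_of_ne hip, Function.update_of_ne hiq]
  have hhdx : ((σ.star q).star p).hd = some x := by
    rw [hhd2]; simpa [star, Function.update_of_ne hqp.symm] using hpx
  have hnq : ((σ.star q).star p).nx q = none := by
    simp [star, Function.update_of_ne hqp, hd]
  have hnp : kind side p (((σ.star q).star p).nx p) = .cross := by
    simpa [star] using hk'
  set τ := (σ.star q).star p with hτ
  clear_value τ
  have hDq : q ∉ D := by
    intro hqD
    have := (hDstep q hqD hqm.1).1
    rw [hq.2] at this
    simp at this
  have hnD : ∀ c ∈ D, τ.nx c = σ.nx c := by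
    intro c hc
    exact hnx c (by rintro rfl; exact hpD hc) (by rintro rfl; exact hDq hc)
  obtain ⟨H, e, φ, hR⟩ := exists_runResult hV2 hT2 hab hhdx (by rw [hxa, hsg2])
  have hHx : x ∈ H := by
    obtain ⟨t, ht, e'⟩ := hR.run.hd_mem
    rw [hhdx, Option.some.injEq] at e'
    exact e' ▸ ht
  -- Otherwise `D` and the run would share a closed set of crossed slots containing `x`, contrary to
  -- the empty hitting set.
  have heq : e = q₁ := by
    by_contra heq
    have := hT.2 (D ∩ H) (fun c hc => by
      rw [Finset.mem_inter] at hc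
      have h1 := hnD c hc.1
      have hcq : c ≠ q₁ := by
        rintro rfl
        have := (hR.run.step c hc.2 (Ne.symm heq)).1
        rw [h1, ((mem_slots side).1 hq₁).2] at this
        simp at this
      have h2 := hDstep c hc.1 hcq
      have hce : c ≠ e := by
        rintro rfl
        have := hR.run.end_kind
        rw [h1, h2.1] at this
        simp at this
      obtain ⟨c', hc', e'⟩ := h2.2
      obtain ⟨c'', hc'', e''⟩ := (hR.run.step c hc.2 hce).2
      rw [h1, e', Option.some.injEq] at e''
      exact ⟨h2.1, by simp, c', Finset.mem_inter.2 ⟨hc', e'' ▸ hc''⟩, e'⟩)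
    have hx2 := Finset.mem_inter.2 ⟨hDx, hHx⟩
    rw [this] at hx2
    simp at hx2
  have hpH : p ∉ H := by
    refine fun hpH => hpD (hR.run.minimal D ?_ ?_ hpH)
    · intro t ht
      rw [hhdx, Option.some.injEq] at ht
      exact ht ▸ hDx
    · intro d hdD hde d' hd'
      obtain ⟨c, hc, e'⟩ := (hDstep d hdD (heq ▸ hde)).2
      rw [hnD d hdD, e', Option.some.injEq] at hd'
      exact hd' ▸ hc
  have hTφ := hR.hitting
  rw [show ({p} : Finset ι) \ H = {p} by simpa using hpH] at hTφ
  have hp' := pot_eq (side := side) φ {p} hab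
  rw [Finset.card_singleton] at hp'
  have hke : kind side e (τ.nx e) = .same := by
    rw [hnD e (heq ▸ hD.end_mem), heq]; exact ((mem_slots side).1 hq₁).2
  have hw' := hR.ext_eq.trans (hE2.trans (hE.trans hw))
  have b1 := hR.one_le
  have b2 := extCnt_eq_zero (side := side) hw' a
  have b3 := extCnt_eq_zero (side := side) hw' b
  have b4 := hR.cross
  have b6 := hR.bal
  rw [b2, b3] at b6 hp'
  have hroom : 2 + H.card ≤ N := by omega
  refine .of_star (i := q) (by omega) (by rw [hq.1, hs]) (.of_star (i := p) (by omega)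
    (by rw [hpb, hsg]) (hτ ▸ hR.good _ (N - 1 - 1 - H.card) (by omega)
      (IH _ (by omega) _ _ hR.valid hTφ ?_)))
  have hpc : 0 < cnt side φ b .cross := by
    refine cnt_pos hpb ?_
    rw [hR.eq]
    simpa [fill, hpH] using hnp
  rcases hR.ends with ⟨y, hy⟩ | ⟨y, hy⟩ | hy | hy
  · by_cases hS2 : cnt side σ a .same = 2
    · exact .pure hy.1 hw' hab hy.2.1 hy.2.2.1 (by omega) (by omega) (by omega) (by omega)
        (fun h0 => by simp at h0)
    · have hφs := slots_same_fill hR.run a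
      rw [← hR.eq] at hφs
      have hsub : ∀ i ∈ slots side φ a .same, i ∈ slots side σ a .same ∧ i ≠ q ∧ i ≠ q₁ ∧
          φ.nx i = σ.nx i := by
        intro i hi
        have hi' := hi
        rw [hφs, Finset.mem_erase, heq, mem_slots] at hi
        have hip : i ≠ p := by
          rintro rfl
          rw [hnp] at hi
          simp at hi
        have hiq : i ≠ q := by
          rintro rfl
          rw [hnq] at hi
          simp at hi
        have hiH : i ∉ H := by
          intro hiH
          have := (hR.run.step i hiH (heq ▸ hi.1)).1
          rw [hi.2.2] at this
          simp at this
        have h1 := hnx i hip hiq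
        refine ⟨(mem_slots side).2 ⟨hi.2.1, h1 ▸ hi.2.2⟩, hiq, hi.1, ?_⟩
        rw [hR.eq]
        simpa [fill, hiH] using h1
      rcases hqc with hqc | ⟨q', hq'm, hq'q, hq'c⟩
      · exfalso
        have h1 := congrArg Finset.card hqc
        rw [Finset.card_erase_of_mem hq₁, Finset.card_singleton] at h1
        have : cnt side σ a .same - 1 = 1 := h1
        omega
      · rw [Finset.mem_erase] at hq'm
        have hq' := (mem_slots side).1 hq'm.2
        have hq'p : q' ≠ p := by
          rintro rfl
          rw [hpk] at hq'
          simp at hq'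
        have hncl : ¬ ClosedSame side φ a := by
          intro hcl
          have hm : q' ∈ slots side φ a .same := by
            rw [hφs, Finset.mem_erase, heq, mem_slots, hnx q' hq'p hq'q]
            exact ⟨hq'm.1, hq'⟩
          obtain ⟨r, hr, e'⟩ := hcl q' hm
          rw [(hsub q' hm).2.2.2] at e'
          have hr' := hsub r hr
          exact hr'.2.1 (hq'c r (Finset.mem_erase.2 ⟨hr'.2.2.1, hr'.1⟩) e')
        have hv' : val side φ {p} = pot side φ {p} + cnt side φ a .same + 1 := by
          rw [val_eq φ _ hab]; omega
        exact .fwdFar hy.1 hw' hab hy.2.1 hy.2.2.1 (by omega) (by omega) (by omega) (by omega)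
          (by omega) (fun h0 => by simp [hncl] at h0) (fun h0 => by simp at h0)
  · omega
  · rw [hke] at hy; simp at hy
  · rw [hke] at hy; simp at hy

/-- Outside the untied case, lifting one well-chosen symbol suffices: a nonempty `T` provides the
entry on `b`, and a single `same` content leaves a pure state. -/
theorem good_blankOne (IH : ∀ M < N, Claim side M) (hσ : σ.Valid) (hT : Hitting side σ T)
    (hd : σ.hd = none) (hw : σ.ext = ∅) {a b : Bool} (hab : b = !a)
    (hs : σ.sg = a) (hb : cnt side σ b .same = 0) (ha : 0 < cnt side σ a .same)
    (hc : 0 < cnt side σ b .cross) (h : val side σ T + 1 ≤ N) : Good side σ N := by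
  by_cases hun : T.card = 0 ∧ 2 ≤ cnt side σ a .same
  · obtain ⟨h0, h2⟩ := hun
    rw [Finset.card_eq_zero] at h0
    subst h0
    exact good_blankOne_untied IH hσ hT hd hw hab hs hb h2 hc h
  have hbal := balance_both (side := side) hσ hab
  have hh1 := hdCnt_none (side := side) hd a
  have hh2 := hdCnt_none (side := side) hd b
  have w1 := extCnt_eq_zero (side := side) hw a
  have w2 := extCnt_eq_zero (side := side) hw b
  have hp := pot_eq (side := side) σ T hab
  have hv : val side σ T = pot side σ T + cnt side σ a .same := by
    rw [val_eq σ T hab]; omega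
  obtain ⟨q, hqm, hqc⟩ := exists_erase_not_closed (f := σ.nx) (Finset.card_pos.1 ha)
    (fun i hi => nx_ne_self_of_same hi)
  have hq := (mem_slots side).1 hqm
  obtain ⟨hV, hE, hsg, ⟨y, hy, hys⟩, hH, k⟩ := star_blank_same hσ hab hd hs hq.1 hq.2
  have hp' := pot_eq (side := side) (σ.star q) T hab
  refine .of_star (i := q) (by omega) (by rw [hq.1, hs]) (IH _ (by omega) _ _ hV (hH T hT) ?_)
  rcases hqc with hqc | ⟨q', hq'm, hq'q, hq'c⟩
  · have h1 : cnt side σ a .same = 1 := by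
      have := congrArg Finset.card hqc
      rwa [Finset.card_singleton] at this
    exact .pure hy (hE.trans hw) hab hys hsg (by omega) (by omega) (by omega) (by omega)
      (fun _ => by omega)
  · have h2 : 2 ≤ cnt side σ a .same := Finset.one_lt_card.2 ⟨q', hq'm, q, hqm, hq'q⟩
    have hncl := not_closedSame_star hq'm hq'q hq'c (by rw [hd]; simp)
    have hv' : val side (σ.star q) T = pot side (σ.star q) T + cnt side (σ.star q) a .same + 1 := by
      rw [val_eq _ T hab]; omega
    have hT0 : T.card ≠ 0 := fun h0 => hun ⟨h0, h2⟩
    exact .fwdFar hy (hE.trans hw) hab hys hsg (by omega) (by omega) (by omega) (by omega)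
      (by omega) (fun h0 => absurd h0 (by simp [hncl, hT0])) (fun h0 => absurd h0 hT0)

end SortState

/-! ### The fetch step and the end of the induction -/

namespace SortState

variable {ι : Type*} [Fintype ι] [DecidableEq ι] {side : ι → Bool}
variable {N : ℕ} {σ : SortState ι} {T : Finset ι}

/-- The cases for a blank head and no outside symbols, in one statement. -/
theorem Cap.of_blank (hd : σ.hd = none) (hw : σ.ext = ∅) {a b : Bool}
    (hab : b = !a) (hs : σ.sg = a) (hp : pot side σ T ≤ N)
    (h2 : 0 < cnt side σ a .same + cnt side σ b .same → val side σ T + 2 ≤ N)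
    (hboth : 0 < cnt side σ a .same → 0 < cnt side σ b .same → size side σ a ≤ size side σ b →
      val side σ T + 3 ≤ N)
    (hsolo : cnt side σ a .same = 0 → cnt side σ a .cross = 0 → 0 < cnt side σ b .same →
      val side σ T + 3 ≤ N) : Cap side σ T N := by
  have hba : a = !b := by simp [hab]
  rcases Nat.eq_zero_or_pos (cnt side σ a .same) with ha | ha
  · rcases Nat.eq_zero_or_pos (cnt side σ b .same) with hb | hb
    · exact .blankPure hd hw hab ha hb hp
    · have := h2 (by omega)
      rcases Nat.eq_zero_or_pos (cnt side σ a .cross) with hc | hc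
      · exact .blankSoloOpp hd hw hba hs ha hb hc (hsolo ha hc hb)
      · exact .blankOneOpp hd hw hba hs ha hb hc (by omega) (fun _ => this)
  · have := h2 (by omega)
    rcases Nat.eq_zero_or_pos (cnt side σ b .same) with hb | hb
    · rcases Nat.eq_zero_or_pos (cnt side σ b .cross) with hc | hc
      · exact .blankSolo hd hw hab hs hb ha hc this
      · exact .blankOne hd hw hab hs hb ha hc (by omega)
    · exact .blankBoth hd hw hab hs ha hb this (hboth ha hb)

set_option maxHeartbeats 1000000 in
/-- After a run from a state with entry costs, the remaining bound is enough. -/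
theorem Cap.of_run {φ : SortState ι} {H : Finset ι} {e z : ι} {a b : Bool} (hσ : σ.Valid)
    (hd : σ.hd = some z) (hz : side z = a) (hab : b = !a)
    (hR : RunResult side σ T a b H e φ)
    (h : val side σ T + entry side σ T a + entry side σ T b ≤ N) :
    H.card ≤ N ∧ Cap side φ (T \ H) (N - H.card) := by
  have hba : a = !b := by simp [hab]
  have hh := hdCnt_some (side := side) hd hz
  have hh1 := hh.1
  have hh2 := hh.2 b hab
  have hbal := balance_both (side := side) hσ hab
  have hp := pot_eq (side := side) σ T hab
  have hv := val_eq (side := side) σ T hab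
  have hp' := pot_eq (side := side) φ (T \ H) hab
  have hv' := val_eq (side := side) φ (T \ H) hab
  have b1 := hR.one_le
  have b2 := hR.ext_a
  have b3 := hR.ext_b
  have b4 := hR.cross
  have b5 := hR.card_le
  have b6 := hR.bal
  -- Apart from `T`, the run lowers `pot` by one more than its moves; the slots it fills alternate
  -- between the sides, so the difference of the sizes changes by at most one.
  have hval : val side φ (T \ H) + H.card + T.card ≤ val side σ T + (T \ H).card := by
    clear h
    rcases hR.ends with ⟨y, hy⟩ | ⟨y, hy⟩ | hy | hy <;> omega
  refine ⟨by omega, ?_⟩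
  have hent : entry side φ (T \ H) a + entry side φ (T \ H) b + (T \ H).card ≤
      entry side σ T a + entry side σ T b + T.card := by
    refine entry_add_card_le hab ?_ ?_ Finset.sdiff_subset
    all_goals clear hp hv hp' hv' hval h b4 b6 hbal
    all_goals rcases hR.ends with ⟨y, hy⟩ | ⟨y, hy⟩ | hy | hy <;> omega
  have hsum : val side φ (T \ H) + entry side φ (T \ H) true + entry side φ (T \ H) false ≤
      N - H.card := by
    rw [add_assoc, entry_add _ _ hab]
    clear hp hv hp' hv' b4 b6 hbal
    omega
  rcases Finset.eq_empty_or_nonempty φ.ext with h0 | h0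
  · have w1 := extCnt_eq_zero (side := side) h0 a
    have w2 := extCnt_eq_zero (side := side) h0 b
    have sa : 0 < cnt side σ a .same + cnt side σ a .blank → entry side σ T a = 1 := entry_eq_one
    have sb : 0 < cnt side σ b .same + cnt side σ b .blank → entry side σ T b = 1 := entry_eq_one
    rcases hR.ends with ⟨y, hy⟩ | ⟨y, hy⟩ | hy | hy
    · exact .of_entry hR.valid hR.hitting hy.1 (by rw [hy.2.1, hy.2.2.1, hab]; simp) h0 hsum
    · exact .of_entry hR.valid hR.hitting hy.1 (by rw [hy.2.1, hy.2.2.1, hab]) h0 hsum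
    · clear hsum hent hval
      have ea := sa (by clear hv hv' hp hp'; omega)
      have d1 : val side σ T = pot side σ T + (cnt side φ a .same + 1 - cnt side φ b .same) +
          (cnt side φ b .same - (cnt side φ a .same + 1)) := by
        clear h hp hp' hv' sa sb; omega
      have d2 : val side φ (T \ H) = pot side φ (T \ H) + (cnt side φ a .same - cnt side φ b .same) +
          (cnt side φ b .same - cnt side φ a .same) := by
        clear h hp hp' hv sa sb d1; omega
      have d3 : pot side φ (T \ H) + H.card + 1 + T.card = pot side σ T + (T \ H).card := by
        clear h hv hv' sa sb d1 d2; omega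
      have d4 : 0 < cnt side φ b .same → entry side σ T b = 1 := fun h1 =>
        sb (by clear hv hv' hp hp' d1 d2 d3 sa sb; omega)
      have d5 : size side φ b ≤ size side φ a → cnt side φ b .same ≤ cnt side φ a .same := by
        unfold size; clear hv hv' hp hp' d1 d2 d3 sa sb d4; omega
      obtain ⟨hn, hs, -⟩ := hy
      clear hv hv' hp hp' sa sb hbal b4 b6 b2 b3 w1 w2 hh1 hh2
      refine .of_blank hn h0 hba hs (by clear d4 d5; omega) (fun h1 => ?_) (fun h1 h2 h3 => ?_)
        (fun h1 h2 h3 => ?_)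
      · by_cases h2 : 0 < cnt side φ b .same
        · have := d4 h2
          clear d4 d5; omega
        · clear d4 d5; omega
      · have := d4 h1
        have := d5 h3
        clear d4 d5 h3; omega
      · clear d4 d5; omega
    · clear hsum hent hval
      have eb := sb (by clear hv hv' hp hp'; omega)
      have d1 : val side σ T = pot side σ T + (cnt side φ a .same - cnt side φ b .same) +
          (cnt side φ b .same - cnt side φ a .same) := by
        clear h hp hp' hv' sa sb; omega
      have d2 : val side φ (T \ H) = pot side φ (T \ H) + (cnt side φ a .same - cnt side φ b .same) +
          (cnt side φ b .same - cnt side φ a .same) := by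
        clear h hp hp' hv sa sb d1; omega
      have d3 : pot side φ (T \ H) + H.card + 1 + T.card = pot side σ T + (T \ H).card := by
        clear h hv hv' sa sb d1 d2; omega
      have d4 : 0 < cnt side φ a .same → entry side σ T a = 1 := fun h1 =>
        sa (by clear hv hv' hp hp' d1 d2 d3 sa sb; omega)
      have d5 : val side φ (T \ H) + H.card + 1 + T.card = val side σ T + (T \ H).card := by
        clear h hv hv' hp hp' sa sb; omega
      obtain ⟨hn, hs, -⟩ := hy
      clear hv hv' hp hp' sa sb hbal b4 b6 b2 b3 w1 w2 hh1 hh2 d2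
      refine .of_blank hn h0 hab hs (by clear d4; omega) (fun h1 => ?_) (fun h1 h2 h3 => ?_)
        (fun h1 h2 h3 => ?_)
      · clear d1 d3 d4; omega
      · have := d4 h1
        clear d1 d3 d4 h3; omega
      · clear d1 d3 d4
        -- A saved entry on `a` means that `T` had an element there. No crossed slot of `a` is left,
        -- so the run passed it and `T` became smaller.
        by_cases he : entry side σ T a = 0
        · unfold entry at he
          simp only [ite_eq_left_iff, one_ne_zero, imp_false, not_not] at he
          obtain ⟨-, t, ht, hta⟩ := he
          have := hR.card_lt t ht (by
            by_contra hn
            exact kind_ne_of_cnt h2 hta (hR.hitting.1 t (Finset.mem_sdiff.2 ⟨ht, hn⟩)))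
          omega
        · omega
  · exact .outside (hR.head_side hab) h0 hsum

/-- The induction step for fetching an outside symbol. -/
theorem good_outside_blank (IH : ∀ M < N, Claim side M) (hside : ∀ a, ∃ i, side i = a)
    (hσ : σ.Valid) (hT : Hitting side σ T) (hd : σ.hd = none) (hw : σ.ext.Nonempty)
    (h : val side σ T + entry side σ T true + entry side σ T false ≤ N) : Good side σ N := by
  refine .fetch hd hw fun z hz s => ?_
  obtain ⟨a, b, hab, hza⟩ : ∃ a b, b = (!a) ∧ side z = a := ⟨side z, _, rfl, rfl⟩
  obtain ⟨⟨hV, hTψ, hE⟩, hc, f⟩ := fetch_result hσ hT hd hab hz hza s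
  have hent : ∀ c, entry side ⟨σ.nx, some z, s⟩ T c = entry side σ T c := fun _ => rfl
  -- An outside symbol and a head symbol have the same price.
  have hval : val side ⟨σ.nx, some z, s⟩ T = val side σ T := by
    have hh1 := hdCnt_none (side := side) hd a
    have hh2 := hdCnt_none (side := side) hd b
    rw [val_eq _ _ hab, val_eq _ _ hab, pot_eq _ _ hab, pot_eq _ _ hab]
    simp only [hc]
    omega
  rcases Bool.eq_or_eq_not s a with hs | hs
  · obtain ⟨H, e, φ, hR⟩ := exists_runResult hV hTψ hab (t := z) rfl (by rw [hza, hs])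
    obtain ⟨h1, h2⟩ := Cap.of_run (N := N) hV rfl hza hab hR (by
      rw [hent, hent, hval, add_assoc, ← entry_add _ _ hab, ← add_assoc]; exact h)
    have := hR.one_le
    exact hR.good _ (N - H.card) (by omega) (IH _ (by omega) _ _ hR.valid hR.hitting h2)
  · have hsz : side z = !s := by rw [hza, hs]; simp
    refine good_of_head IH hside hV hTψ (x := z) rfl ?_
    rcases Finset.eq_empty_or_nonempty (⟨σ.nx, some z, s⟩ : SortState ι).ext with h0 | h0
    · exact .of_entry hV hTψ rfl hsz h0 (by rw [hent, hent, hval]; exact h)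
    · refine .outside (fun x hx => ?_) h0 (by rw [hent, hent, hval]; exact h)
      rw [← Option.some_injective _ hx]
      exact hsz

theorem claim (hside : ∀ a, ∃ i, side i = a) (N : ℕ) : Claim side N := by
  induction N using Nat.strong_induction_on with
  | _ N IH =>
  intro σ T hσ hT hcap
  cases hd : σ.hd with
  | some x => exact good_of_head IH hside hσ hT hd hcap
  | none =>
    cases hcap with
    | outside hd' hw h => exact good_outside_blank IH hside hσ hT hd hw h
    | blankPure _ hw hab ha hb h => exact good_blankPure IH hσ hT hd hw hab ha hb h
    | blankOne _ hw hab hs hb ha hc h => exact good_blankOne IH hσ hT hd hw hab hs hb ha hc h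
    | blankOneOpp _ hw hab hs hb ha hc h h' =>
      exact good_blankOneOpp IH hσ hT hd hw hab hs hb ha hc h h'
    | blankSolo _ hw hab hs hb ha hc h => exact good_blankSolo IH hside hσ hd hw hab hs hb ha hc h
    | blankSoloOpp _ hw hab hs hb ha hc h =>
      exact good_blankSoloOpp IH hside hσ hd hw hab hs hb ha hc h
    | blankBoth _ hw hab hs ha hb h h' => exact good_blankBoth IH hσ hT hd hw hab hs ha hb h h'
    | pure hd' => simp [hd] at hd'
    | solo hd' => simp [hd] at hd'
    | fwdFar hd' => simp [hd] at hd'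
    | fwdNear hd' => simp [hd] at hd'
    | backFar hd' => simp [hd] at hd'
    | backNear hd' => simp [hd] at hd'
    | both hd' => simp [hd] at hd'

end SortState

/-! ### The number of star moves from an arbitrary state -/

namespace SortState

variable {ι : Type*} [Fintype ι] [DecidableEq ι] {side : ι → Bool}
variable {σ : SortState ι}

theorem hitting_crossed (σ : SortState ι) :
    Hitting side σ {i | kind side i (σ.nx i) = .cross} := by
  refine ⟨fun t ht => by simpa using ht, fun C hC => ?_⟩
  rw [Finset.eq_empty_iff_forall_notMem]
  intro c hc
  obtain ⟨h1, h2, -⟩ := hC c hc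
  exact h2 (by simpa using h1)

theorem card_crossed (σ : SortState ι) {a b : Bool} (hab : b = !a) :
    ({i | kind side i (σ.nx i) = .cross} : Finset ι).card =
      cnt side σ a .cross + cnt side σ b .cross := by
  rw [← Finset.card_filter_add_card_filter_not (s := {i | kind side i (σ.nx i) = .cross})
    (fun t => side t = a)]
  unfold cnt slots
  congr 2
  · ext i; simp [and_comm]
  · ext i; simp [hab, Bool.eq_not, and_comm]

/-- With sides of almost equal size, twice the number of slots plus four star moves are enough, and
one move can be saved if there are outside symbols. -/
theorem good_of_card (hside : ∀ a, ∃ i, side i = a) (hσ : σ.Valid) {K : ℕ}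
    (hK : Fintype.card ι = K)
    (hbal : ({i | side i = true} : Finset ι).card ≤ ({i | side i = false} : Finset ι).card + 1)
    (hbal' : ({i | side i = false} : Finset ι).card ≤ ({i | side i = true} : Finset ι).card + 1) :
    Good side σ (2 * K + 4) ∧ (σ.ext.Nonempty → Good side σ (2 * K + 3)) := by
  have hT := hitting_crossed (side := side) σ
  have hTc := card_crossed (side := side) σ (a := true) (b := false) rfl
  set T : Finset ι := {i | kind side i (σ.nx i) = .cross} with hTdef
  clear_value T
  have c1 := card_side (side := side) σ true
  have c2 := card_side (side := side) σ false
  have hKs : K = ({i | side i = true} : Finset ι).card + ({i | side i = false} : Finset ι).card := by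
    rw [← hK, ← Finset.card_univ,
      ← Finset.card_filter_add_card_filter_not (s := Finset.univ) (fun i => side i = true)]
    simp
  -- By `balance` there are as many blank slots as outside and head symbols together, so `pot` is
  -- twice the number of unsorted slots. The difference of the sizes exceeds one only at the expense
  -- of unsorted slots on the smaller side.
  have hv : val side σ T ≤ 2 * K + 1 := by
    have b := balance_both (side := side) hσ (a := true) (b := false) rfl
    have hp := pot_eq (side := side) σ T (a := true) (b := false) rfl
    have hv := val_eq (side := side) σ T (a := true) (b := false) rfl
    omega
  have hent : ∀ a, val side σ T + entry side σ T a + entry side σ T (!a) ≤ 2 * K + 3 := by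
    intro a
    have e1 := entry_le_one (side := side) σ T a
    have e2 := entry_le_one (side := side) σ T (!a)
    omega
  have hcl := fun N => claim (side := side) hside N
  have hhead : ∀ x, σ.hd = some x → Good side σ (2 * K + 3) := by
    intro x hd
    rcases Bool.eq_or_eq_not (side x) σ.sg with hs | hs
    · obtain ⟨H, e, φ, hR⟩ := exists_runResult hσ hT (a := side x) rfl hd hs
      obtain ⟨h1, h2⟩ := Cap.of_run hσ hd rfl rfl hR (hent _)
      exact hR.good _ (2 * K + 3 - H.card) (by omega) (hcl _ _ _ hR.valid hR.hitting h2)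
    · rcases Finset.eq_empty_or_nonempty σ.ext with h0 | h0
      · exact hcl _ σ T hσ hT (.of_entry hσ hT hd hs h0 (hent true))
      · refine hcl _ σ T hσ hT (.outside (fun y hy => ?_) h0 (hent true))
        rw [hd, Option.some.injEq] at hy
        rw [← hy, hs]
  have hw : σ.ext.Nonempty → Good side σ (2 * K + 3) := by
    intro h0
    cases hd : σ.hd with
    | none => exact hcl _ σ T hσ hT (.outside (by simp [hd]) h0 (hent true))
    | some x => exact hhead x hd
  refine ⟨?_, hw⟩
  rcases Finset.eq_empty_or_nonempty σ.ext with h0 | h0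
  · cases hd : σ.hd with
    | none =>
      exact hcl _ σ T hσ hT (.of_blank hd h0 (a := σ.sg) rfl rfl (by unfold val at hv; omega)
        (fun _ => by omega) (fun _ _ _ => by omega) (fun _ _ _ => by omega))
    | some x => exact (hhead x hd).mono (by omega)
  · exact (hw h0).mono (by omega)

end SortState

/-! ### Walks in the oriented graph -/

section Walks

variable {V : Type*} {D : Digraph V}

theorem HasDirectedWalk.trans {p q : ℕ} {u v w : V} (h : HasDirectedWalk D p u v)
    (h' : HasDirectedWalk D q v w) : HasDirectedWalk D (p + q) u w := by
  induction h with
  | nil u => simpa using h'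
  | @cons m _ _ _ h _ ih => rw [Nat.add_right_comm]; exact .cons h (ih h')

end Walks

/-! ### Indices in a clique -/

/-- The arcs of the tournament on the ranks of the heads in a clique. -/
def RankArc (i j : ℕ) : Prop := (i % 2 = j % 2 ∧ j < i) ∨ (i % 2 ≠ j % 2 ∧ i < j)

/-- The distance in the tournament on the ranks `0, …, m` is at most `2`, with one exception. -/
theorem rankArc_path {m i j : ℕ} (hm : 2 ≤ m) (hi : i ≤ m) (hj : j ≤ m) (hij : i ≠ j) :
    RankArc i j ∨ (∃ l ≤ m, RankArc i l ∧ RankArc l j) ∨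
      (m % 2 = 1 ∧ i = m ∧ j = 0 ∧
        ∃ l ≤ m, ∃ l' ≤ m, RankArc i l ∧ RankArc l l' ∧ RankArc l' j) := by
  unfold RankArc
  rcases Nat.lt_or_gt_of_ne hij with h | h
  · by_cases hp : i % 2 = j % 2
    -- One step up changes the parity, after which the larger rank `j` is reached upwards.
    · exact .inr (.inl ⟨i + 1, by omega, by omega, by omega⟩)
    · exact .inl (by omega)
  · by_cases hp : i % 2 = j % 2
    · exact .inl (by omega)
    · by_cases hj0 : j = 0
      · by_cases him : i = m
        -- For odd `m` the path is `m`, 1, 2, 0; the detour over `i + 1` is not available at the top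
        -- rank, nor the one over `j - 1` at the bottom.
        · exact .inr (.inr ⟨by omega, him, hj0, 1, by omega, 2, by omega, by omega, by omega,
            by omega⟩)
        · exact .inr (.inl ⟨i + 1, by omega, by omega, by omega⟩)
      · exact .inr (.inl ⟨j - 1, by omega, by omega, by omega⟩)

/-- At most `(m + 1) / 2` of the ranks `0, …, m` are not reached from `i` by an arc. -/
theorem card_not_rankArc_le {m i : ℕ} (hi : i ≤ m) {s : Finset ℕ} (hs : ∀ j ∈ s, j ≤ m ∧ j ≠ i)
    (hn : ∀ j ∈ s, ¬ RankArc i j) : s.card ≤ (m + 1) / 2 := by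
  -- The ranks not reached are `i - 1`, `i - 3`, … below and `i + 2`, `i + 4`, … above.
  have hsub : s ⊆ (Finset.range ((i + 1) / 2)).image (fun t => i - 1 - 2 * t) ∪
      (Finset.range ((m - i) / 2)).image (fun t => i + 2 + 2 * t) := by
    intro j hj
    have h1 := hs j hj
    have h2 := hn j hj
    unfold RankArc at h2
    simp only [Finset.mem_union, Finset.mem_image, Finset.mem_range]
    rcases Nat.lt_or_gt_of_ne h1.2 with h | h
    · exact .inl ⟨(i - 1 - j) / 2, by omega, by omega⟩
    · exact .inr ⟨(j - i - 2) / 2, by omega, by omega⟩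
  refine (Finset.card_le_card hsub).trans ((Finset.card_union_le _ _).trans ?_)
  have h1 := Finset.card_image_le (s := Finset.range ((i + 1) / 2)) (f := fun t => i - 1 - 2 * t)
  have h2 := Finset.card_image_le (s := Finset.range ((m - i) / 2)) (f := fun t => i + 2 + 2 * t)
  rw [Finset.card_range] at h1 h2
  omega

/-! ### Signs of extended labels and replacement of the head -/

namespace NKNode

variable {n k : ℕ}

theorem mem_missing {u : NKNode n k} {s : Fin n} : s ∈ u.missing ↔ ∀ i, u i ≠ s := by
  simp [missing]

theorem isEven_iff_of_sign {u w : NKNode n k}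
    (h : Equiv.Perm.sign w.extended = - Equiv.Perm.sign u.extended) :
    w.IsEven ↔ ¬ u.IsEven := by
  unfold IsEven
  rw [h]
  rcases Int.units_eq_one_or (Equiv.Perm.sign u.extended) with h | h <;> rw [h] <;> decide

variable [NeZero k]

theorem missing_swapHead (u : NKNode n k) (i : Fin k) : (u.swapHead i).missing = u.missing := by
  ext s
  simp only [mem_missing, swapHead, Function.Embedding.trans_apply, Equiv.coe_toEmbedding]
  exact ⟨fun h j => by simpa using h (Equiv.swap 0 i j), fun h j => h _⟩

/-- The missing symbols are the same, so the extended label changes by a transposition of two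
positions. -/
theorem isEven_swapHead (u : NKNode n k) {i : Fin k} (hi : i ≠ 0) :
    (u.swapHead i).IsEven ↔ ¬ u.IsEven := by
  apply isEven_iff_of_sign
  have hkn := u.le_of_node
  have hne : Fin.castLE hkn 0 ≠ Fin.castLE hkn i := by
    intro h
    exact hi (Fin.castLE_injective hkn h).symm
  have : (u.swapHead i).extended =
      u.extended * Equiv.swap (Fin.castLE hkn 0) (Fin.castLE hkn i) := by
    ext j : 1
    simp only [extended, Equiv.Perm.mul_apply, Equiv.ofBijective_apply]
    by_cases hj : (j : ℕ) < k
    · obtain ⟨j, rfl⟩ : ∃ j' : Fin k, j = Fin.castLE hkn j' := ⟨⟨j, hj⟩, rfl⟩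
      have h1 : Equiv.swap (Fin.castLE hkn 0) (Fin.castLE hkn i) (Fin.castLE hkn j) =
          Fin.castLE hkn (Equiv.swap 0 i j) := by
        simp only [Equiv.swap_apply_def]
        split_ifs <;> simp_all
      rw [h1]
      simp [extendedFun, swapHead]
    · have h1 : Equiv.swap (Fin.castLE hkn 0) (Fin.castLE hkn i) j = j := by
        apply Equiv.swap_apply_of_ne_of_ne
        · rintro rfl; exact hj (by simp [Nat.pos_of_ne_zero (NeZero.ne k)])
        · rintro rfl; exact hj (by simp)
      rw [h1]
      simp only [extendedFun, hj, dif_neg, not_false_eq_true]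
      congr 1
      simp only [missing_swapHead]
  rw [this, Equiv.Perm.sign_mul, Equiv.Perm.sign_swap hne]
  simp

/-- The symbols that do not occur in `u` except possibly at the head. -/
def free (u : NKNode n k) : Finset (Fin n) := {s | ∀ i, i ≠ 0 → u i ≠ s}

theorem mem_free {u : NKNode n k} {s : Fin n} : s ∈ u.free ↔ ∀ i, i ≠ 0 → u i ≠ s := by
  simp [free]

theorem free_eq (u : NKNode n k) : u.free = insert (u 0) u.missing := by
  ext s
  simp only [mem_free, Finset.mem_insert, mem_missing]
  constructor
  · intro h
    by_cases h0 : s = u 0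
    · exact .inl h0
    · refine .inr fun i => ?_
      by_cases hi : i = 0
      · rw [hi]; exact Ne.symm h0
      · exact h i hi
  · rintro (rfl | h) i hi
    · exact fun e => hi (u.injective e)
    · exact h i

theorem card_free (u : NKNode n k) : u.free.card = n - k + 1 := by
  rw [free_eq, Finset.card_insert_of_notMem (by simp [mem_missing]), card_missing]

theorem head_mem_free (u : NKNode n k) : u 0 ∈ u.free := by
  rw [free_eq]; exact Finset.mem_insert_self _ _

/-- The word `u` with its head replaced by a free symbol. -/
def setHead (u : NKNode n k) (s : Fin n) (hs : s ∈ u.free) : NKNode n k where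
  toFun := Function.update u 0 s
  inj' := by
    intro i j hij
    rw [mem_free] at hs
    simp only [Function.update_apply] at hij
    split_ifs at hij with h1 h2 h2
    · rw [h1, h2]
    · exact absurd hij.symm (hs j h2)
    · exact absurd hij (hs i h1)
    · exact u.injective hij

theorem setHead_zero (u : NKNode n k) {s : Fin n} (hs : s ∈ u.free) : u.setHead s hs 0 = s := by
  change Function.update (u : Fin k → Fin n) 0 s 0 = s
  exact Function.update_self ..

theorem setHead_of_ne (u : NKNode n k) {s : Fin n} (hs : s ∈ u.free) {i : Fin k} (hi : i ≠ 0) :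
    u.setHead s hs i = u i := by
  change Function.update (u : Fin k → Fin n) 0 s i = u i
  exact Function.update_of_ne hi ..

theorem missing_setHead (u : NKNode n k) {s : Fin n} (hs : s ∈ u.free) :
    (u.setHead s hs).missing = u.free.erase s := by
  ext t
  simp only [mem_missing, Finset.mem_erase, mem_free]
  constructor
  · intro h
    refine ⟨fun e => h 0 (by rw [setHead_zero, e]), fun i hi => ?_⟩
    rw [← setHead_of_ne u hs hi]
    exact h i
  · rintro ⟨h1, h2⟩ i
    by_cases hi : i = 0
    · rw [hi, setHead_zero]; exact Ne.symm h1
    · rw [setHead_of_ne u hs hi]; exact h2 i hi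

/-- Replacing the head by the next larger free symbol changes the sign. -/
theorem isEven_setHead_succ (u : NKNode n k) {x y : Fin n} (hx : x ∈ u.free) (hy : y ∈ u.free)
    (hxy : x < y) (hadj : ∀ z ∈ u.free, ¬ (x < z ∧ z < y)) :
    (u.setHead y hy).IsEven ↔ ¬ (u.setHead x hx).IsEven := by
  apply isEven_iff_of_sign
  have : (u.setHead y hy).extended = Equiv.swap x y * (u.setHead x hx).extended := by
    ext j : 1
    simp only [extended, Equiv.Perm.mul_apply, Equiv.ofBijective_apply, extendedFun]
    by_cases hj : (j : ℕ) < k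
    · simp only [hj, dif_pos]
      by_cases h0 : (⟨j, hj⟩ : Fin k) = 0
      · rw [h0, setHead_zero, setHead_zero, Equiv.swap_apply_left]
      · rw [setHead_of_ne _ _ h0, setHead_of_ne _ _ h0, Equiv.swap_apply_of_ne_of_ne]
        · exact mem_free.1 hx _ h0
        · exact mem_free.1 hy _ h0
    · simp only [hj, dif_neg, not_false_eq_true]
      -- No free symbol lies between `x` and `y`, so interchanging them keeps the missing symbols in
      -- increasing order; uniqueness of the increasing enumeration then identifies the tails.
      have key := Finset.orderEmbOfFin_unique (s := (u.setHead y hy).missing)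
        (u.setHead y hy).card_missing
        (f := fun a => Equiv.swap x y
          ((u.setHead x hx).missing.orderEmbOfFin (u.setHead x hx).card_missing a)) ?_ ?_
      · exact (congrFun key _).symm
      · intro a
        have ha := Finset.orderEmbOfFin_mem _ (u.setHead x hx).card_missing a
        generalize (u.setHead x hx).missing.orderEmbOfFin (u.setHead x hx).card_missing a = t at ha
        rw [missing_setHead, Finset.mem_erase] at ha ⊢
        by_cases hty : t = y
        · subst hty
          rw [Equiv.swap_apply_right]
          exact ⟨hxy.ne, hx⟩
        · rw [Equiv.swap_apply_of_ne_of_ne ha.1 hty]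
          exact ⟨hty, ha.2⟩
      · intro a a' haa
        have ha := Finset.orderEmbOfFin_mem _ (u.setHead x hx).card_missing a
        have ha' := Finset.orderEmbOfFin_mem _ (u.setHead x hx).card_missing a'
        have hlt := ((u.setHead x hx).missing.orderEmbOfFin
          (u.setHead x hx).card_missing).strictMono haa
        show Equiv.swap x y _ < Equiv.swap x y _
        generalize (u.setHead x hx).missing.orderEmbOfFin (u.setHead x hx).card_missing a = t
          at ha hlt
        generalize (u.setHead x hx).missing.orderEmbOfFin (u.setHead x hx).card_missing a' = t'
          at ha' hlt
        rw [missing_setHead, Finset.mem_erase] at ha ha'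
        have h1 := hadj t ha.2
        have h2 := hadj t' ha'.2
        by_cases hty : t = y
        · subst hty
          rw [Equiv.swap_apply_right, Equiv.swap_apply_of_ne_of_ne ha'.1 hlt.ne']
          exact hxy.trans hlt
        · rw [Equiv.swap_apply_of_ne_of_ne ha.1 hty]
          by_cases hty' : t' = y
          · subst hty'
            rw [Equiv.swap_apply_right]
            exact lt_of_le_of_ne (not_lt.1 fun h => h1 ⟨h, hlt⟩) ha.1
          · rw [Equiv.swap_apply_of_ne_of_ne ha'.1 hty']
            exact hlt
  rw [this, Equiv.Perm.sign_mul, Equiv.Perm.sign_swap hxy.ne]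
  simp

end NKNode

/-! ### The tournament on a clique and the price of a fetch -/

namespace NKNode

variable {n k : ℕ} [NeZero k]

theorem setHead_self (u : NKNode n k) : u.setHead (u 0) u.head_mem_free = u := by
  ext i
  by_cases hi : i = 0
  · rw [hi, setHead_zero]
  · rw [setHead_of_ne _ _ hi]

/-- The free symbol of rank `i`. -/
noncomputable def freeSym (u : NKNode n k) (i : Fin (n - k + 1)) : Fin n :=
  u.free.orderEmbOfFin u.card_free i

theorem freeSym_mem (u : NKNode n k) (i : Fin (n - k + 1)) : u.freeSym i ∈ u.free :=
  Finset.orderEmbOfFin_mem _ _ _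

theorem freeSym_lt (u : NKNode n k) {i j : Fin (n - k + 1)} :
    u.freeSym i < u.freeSym j ↔ i < j :=
  (u.free.orderEmbOfFin u.card_free).lt_iff_lt

theorem exists_freeSym_eq (u : NKNode n k) {s : Fin n} (hs : s ∈ u.free) : ∃ i, u.freeSym i = s := by
  have : s ∈ Set.range (u.free.orderEmbOfFin u.card_free) := by
    rw [Finset.range_orderEmbOfFin]; exact hs
  exact this

/-- The node of rank `i` in the clique of `u`. -/
noncomputable def cliqueNode (u : NKNode n k) (i : Fin (n - k + 1)) : NKNode n k :=
  u.setHead (u.freeSym i) (u.freeSym_mem i)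

theorem isEven_cliqueNode (u : NKNode n k) (i : ℕ) (hi : i < n - k + 1) :
    (u.cliqueNode ⟨i, hi⟩).IsEven ↔ ((u.cliqueNode 0).IsEven ↔ i % 2 = 0) := by
  induction i with
  | zero => simp
  | succ i ih =>
    have h1 : u.freeSym ⟨i, by omega⟩ < u.freeSym ⟨i + 1, hi⟩ := by
      rw [freeSym_lt]; simp
    have h2 := isEven_setHead_succ u (u.freeSym_mem ⟨i, by omega⟩) (u.freeSym_mem ⟨i + 1, hi⟩) h1 (by
      intro z hz
      obtain ⟨j, rfl⟩ := u.exists_freeSym_eq hz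
      rw [freeSym_lt, freeSym_lt, Fin.lt_def, Fin.lt_def]
      simp only
      omega)
    have h3 := ih (by omega)
    have h4 : (i + 1) % 2 = 0 ↔ ¬ i % 2 = 0 := by omega
    unfold cliqueNode at h3 ⊢
    rw [h2, h3, h4]
    tauto

/-- Nodes of one clique have equal signs exactly when their ranks have equal parity, and heads are
ordered as ranks. -/
theorem cliqueArc_of_rankArc (u : NKNode n k) {i j : Fin (n - k + 1)} (h : RankArc i j) :
    CliqueArc (u.cliqueNode i) (u.cliqueNode j) := by
  have hij : i ≠ j := by
    rintro rfl
    unfold RankArc at h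
    omega
  have hsym : u.freeSym j ≠ u.freeSym i := fun e =>
    hij ((u.free.orderEmbOfFin u.card_free).injective e).symm
  refine ⟨⟨?_, fun l hl => ?_⟩, ?_⟩
  · rintro ⟨l, hl⟩
    unfold cliqueNode at hl
    rw [setHead_zero] at hl
    by_cases hl0 : l = 0
    · rw [hl0, setHead_zero] at hl
      exact hsym hl.symm
    · rw [setHead_of_ne _ _ hl0] at hl
      exact mem_free.1 (u.freeSym_mem j) l hl0 hl
  · unfold cliqueNode
    rw [setHead_of_ne _ _ hl, setHead_of_ne _ _ hl]
  · have h1 := isEven_cliqueNode u i i.2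
    have h2 := isEven_cliqueNode u j j.2
    have h3 : (u.cliqueNode i) 0 = u.freeSym i := setHead_zero ..
    have h4 : (u.cliqueNode j) 0 = u.freeSym j := setHead_zero ..
    have p1 : (i : ℕ) % 2 = (j : ℕ) % 2 ↔ ((i : ℕ) % 2 = 0 ↔ (j : ℕ) % 2 = 0) := by omega
    rw [h1, h2, h3, h4, freeSym_lt, freeSym_lt, Fin.lt_def, Fin.lt_def]
    unfold RankArc at h
    rw [p1] at h
    unfold Ne at h
    rw [p1] at h
    rcases h with ⟨hp, hl⟩ | ⟨hp, hl⟩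
    · exact .inl ⟨by rw [hp], hl⟩
    · refine .inr ⟨fun hc => hp ?_, hl⟩
      by_cases hE : (u.cliqueNode 0).IsEven
      · simpa only [hE, true_iff] using hc
      · simpa only [hE, false_iff, not_iff_not] using hc

theorem cliqueNode_walk (u : NKNode n k) (hm : 2 ≤ n - k) {i j : Fin (n - k + 1)} (hij : i ≠ j) :
    ∃ c, HasDirectedWalk (nkStarOrientation n k) c (u.cliqueNode i) (u.cliqueNode j) ∧
      (c ≤ 2 ∨ c ≤ 3 ∧ (n - k) % 2 = 1 ∧ (j : ℕ) = 0) := by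
  have arc : ∀ {i j : Fin (n - k + 1)}, RankArc i j →
      (nkStarOrientation n k).Adj (u.cliqueNode i) (u.cliqueNode j) := fun h =>
    .inr (u.cliqueArc_of_rankArc h)
  rcases rankArc_path hm (Nat.lt_succ_iff.1 i.2) (Nat.lt_succ_iff.1 j.2)
    (fun h => hij (Fin.ext h)) with h | ⟨l, hl, h1, h2⟩ | ⟨hm', -, hj, l, hl, l', hl', h1, h2, h3⟩
  · exact ⟨1, .cons (arc h) (.nil _), .inl (by omega)⟩
  · exact ⟨2, .cons (arc (j := ⟨l, by omega⟩) h1) (.cons (arc h2) (.nil _)), .inl le_rfl⟩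
  · exact ⟨3, .cons (arc (j := ⟨l, by omega⟩) h1) (.cons (arc (j := ⟨l', by omega⟩) h2)
      (.cons (arc h3) (.nil _))), .inr ⟨le_rfl, hm', hj⟩⟩

theorem exists_cliqueNode_eq (u : NKNode n k) {s : Fin n} (hs : s ∈ u.free) :
    ∃ i, u.freeSym i = s ∧ u.cliqueNode i = u.setHead s hs := by
  obtain ⟨i, rfl⟩ := u.exists_freeSym_eq hs
  exact ⟨i, rfl, rfl⟩

theorem setHead_walk (u : NKNode n k) (hm : 2 ≤ n - k) {s : Fin n} (hs : s ∈ u.free) :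
    ∃ c ≤ 2 + (n - k) % 2, HasDirectedWalk (nkStarOrientation n k) c u (u.setHead s hs) := by
  obtain ⟨j, hj, ej⟩ := u.exists_cliqueNode_eq hs
  obtain ⟨i, hi, ei⟩ := u.exists_cliqueNode_eq u.head_mem_free
  rw [setHead_self] at ei
  by_cases hij : i = j
  · exact ⟨0, by omega, by rw [← ej, ← hij, ei]; exact .nil _⟩
  · obtain ⟨c, h, hc⟩ := u.cliqueNode_walk hm hij
    rw [ei, ej] at h
    exact ⟨c, by omega, h⟩

/-- The cost of fetching one of `w` wanted symbols in a clique with `m + 1` nodes. -/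
def fetchCost (m w : ℕ) : ℕ := if (m + 1) / 2 < w then 1 else if w = 1 then 2 + m % 2 else 2

/-- More than (m+1)/2 wanted symbols cannot all miss the out-neighbours of the current rank.
Otherwise a path of length 2 works unless the target has rank 0 and m is odd, which two wanted
symbols allow to avoid. -/
theorem fetch_walk (u : NKNode n k) (hm : 2 ≤ n - k) {W : Finset (Fin n)} (hW : W ⊆ u.missing)
    (hne : W.Nonempty) :
    ∃ t ∈ W, ∃ ht : t ∈ u.free, ∃ c ≤ fetchCost (n - k) W.card,
      HasDirectedWalk (nkStarOrientation n k) c u (u.setHead t ht) := by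
  have hfree : ∀ t ∈ W, t ∈ u.free := fun t ht => by
    rw [free_eq]; exact Finset.mem_insert_of_mem (hW ht)
  have hmem : ∀ j, u.freeSym j ∈ W → ∀ c, c ≤ fetchCost (n - k) W.card →
      HasDirectedWalk (nkStarOrientation n k) c u (u.cliqueNode j) →
      ∃ t ∈ W, ∃ ht : t ∈ u.free, ∃ c ≤ fetchCost (n - k) W.card,
        HasDirectedWalk (nkStarOrientation n k) c u (u.setHead t ht) :=
    fun j hj c hc hw => ⟨_, hj, u.freeSym_mem j, c, hc, hw⟩
  obtain ⟨i, hi, ei⟩ := u.exists_cliqueNode_eq u.head_mem_free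
  rw [setHead_self] at ei
  set R : Finset (Fin (n - k + 1)) := {j | u.freeSym j ∈ W} with hR
  have hRc : R.card = W.card := by
    refine Finset.card_bij (fun j _ => u.freeSym j) ?_ ?_ ?_
    · intro j hj; simpa [hR] using hj
    · intro j _ l _ h; exact (u.free.orderEmbOfFin u.card_free).injective h
    · intro t ht
      obtain ⟨j, hj⟩ := u.exists_freeSym_eq (hfree t ht)
      exact ⟨j, by simp [hR, hj, ht], hj⟩
  have hRW : ∀ j ∈ R, u.freeSym j ∈ W := fun j hj => by simpa [hR] using hj
  have hiR : ∀ j ∈ R, i ≠ j := by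
    rintro j hj rfl
    have := hW (hRW i hj)
    rw [hi, mem_missing] at this
    exact this 0 rfl
  have hRpos : 0 < R.card := by rw [hRc]; exact Finset.card_pos.2 hne
  by_cases h1 : (n - k + 1) / 2 < W.card
  · obtain ⟨j, hj, hij⟩ : ∃ j ∈ R, RankArc i j := by
      by_contra hcon
      push Not at hcon
      have := card_not_rankArc_le (m := n - k) (i := i) (Nat.lt_succ_iff.1 i.2)
        (s := R.map Fin.valEmbedding) (by
          intro l hl
          obtain ⟨l', hl', rfl⟩ := Finset.mem_map.1 hl
          exact ⟨Nat.lt_succ_iff.1 l'.2, fun h => hiR l' hl' (Fin.ext h.symm)⟩) (by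
          intro l hl
          obtain ⟨l', hl', rfl⟩ := Finset.mem_map.1 hl
          exact hcon l' hl')
      rw [Finset.card_map] at this
      omega
    refine hmem j (hRW j hj) 1 (by simp [fetchCost, h1]) ?_
    have harc : (nkStarOrientation n k).Adj (u.cliqueNode i) (u.cliqueNode j) :=
      .inr (u.cliqueArc_of_rankArc hij)
    rw [ei] at harc
    exact .cons harc (.nil _)
  · by_cases h2 : W.card = 1
    · obtain ⟨j, hj⟩ := Finset.card_pos.1 hRpos
      obtain ⟨c, h, hc⟩ := u.cliqueNode_walk hm (hiR j hj)
      rw [ei] at h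
      exact hmem j (hRW j hj) c (by rw [fetchCost, if_neg h1, if_pos h2]; omega) h
    · obtain ⟨j, hj, hj0⟩ : ∃ j ∈ R, (j : ℕ) ≠ 0 := by
        obtain ⟨j, hj, l, hl, hjl⟩ := Finset.one_lt_card.1 (show 1 < R.card by omega)
        by_cases hj0 : (j : ℕ) = 0
        · exact ⟨l, hl, fun hl0 => hjl (Fin.ext (hj0.trans hl0.symm))⟩
        · exact ⟨j, hj, hj0⟩
      obtain ⟨c, h, hc⟩ := u.cliqueNode_walk hm (hiR j hj)
      rw [ei] at h
      exact hmem j (hRW j hj) c (by rw [fetchCost, if_neg h1, if_neg h2]; omega) h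

/-! ### From the sorting game to walks -/

/-- The positions other than the head. -/
abbrev Slot (k : ℕ) [NeZero k] : Type := {i : Fin k // i ≠ 0}

/-- The side of a slot: `true` for the left half, `false` for the right half. -/
def slotSide (i : Slot k) : Bool := decide ((i.1 : ℕ) ≤ k / 2)

open Classical in
/-- The slot in which the target `v` has the symbol `s`. -/
noncomputable def dest (v : NKNode n k) (s : Fin n) : Option (Slot k) :=
  if h : ∃ i : Slot k, v i.1 = s then some h.choose else none

theorem dest_eq_some {v : NKNode n k} {s : Fin n} {i : Slot k} :
    v.dest s = some i ↔ v i.1 = s := by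
  unfold dest
  split_ifs with h
  · rw [Option.some.injEq]
    constructor
    · rintro rfl; exact h.choose_spec
    · intro hi
      exact Subtype.ext (v.injective (h.choose_spec.trans hi.symm))
  · exact iff_of_false (by simp) fun hi => h ⟨i, hi⟩

open Classical in
/-- The state of the sorting game at the node `u` with the target `v`. -/
noncomputable def sortState (v u : NKNode n k) : SortState (Slot k) :=
  ⟨fun i => v.dest (u i.1), v.dest (u 0), decide u.IsEven⟩

theorem sortState_valid (v u : NKNode n k) : (v.sortState u).Valid := by
  refine ⟨fun i j t hi hj => ?_, fun i t hi ht => ?_⟩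
  · simp only [sortState, dest_eq_some] at hi hj
    exact Subtype.ext (u.injective (hi.symm.trans hj))
  · simp only [sortState, dest_eq_some] at hi ht
    exact i.2 (u.injective (hi.symm.trans ht))

theorem mem_ext_sortState {v u : NKNode n k} {t : Slot k} :
    t ∈ (v.sortState u).ext ↔ v t.1 ∈ u.missing := by
  simp only [SortState.mem_ext, sortState, Ne, dest_eq_some, mem_missing]
  constructor
  · rintro ⟨h1, h2⟩ i
    by_cases hi : i = 0
    · rw [hi]; exact fun h => h2 h.symm
    · exact fun h => h1 ⟨i, hi⟩ h.symm
  · intro h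
    exact ⟨fun i e => h i.1 e.symm, fun e => h 0 e.symm⟩

theorem sortState_swapHead (v u : NKNode n k) (i : Slot k) :
    v.sortState (u.swapHead i.1) = (v.sortState u).star i := by
  simp only [sortState, SortState.star, SortState.mk.injEq]
  refine ⟨?_, by simp [swapHead], ?_⟩
  · funext j
    by_cases hj : j = i
    · subst hj; simp [swapHead]
    · have h1 : j.1 ≠ i.1 := fun h => hj (Subtype.ext h)
      simp [swapHead, Function.update_of_ne hj, Equiv.swap_apply_of_ne_of_ne j.2 h1]
  · have := isEven_swapHead u i.2
    by_cases h : u.IsEven <;> simp [h, this]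

theorem starArc_of_side {v u : NKNode n k} {i : Slot k} (h : slotSide i = (v.sortState u).sg) :
    StarArc u (u.swapHead i.1) := by
  refine ⟨i.1, ⟨i.2, rfl⟩, ?_⟩
  simp only [slotSide, sortState, decide_eq_decide] at h
  by_cases he : u.IsEven
  · exact .inl ⟨he, i.2, h.2 he⟩
  · exact .inr ⟨he, not_le.1 fun h' => he (h.1 h')⟩

theorem sortState_setHead (v u : NKNode n k) {t : Slot k} (ht : v t.1 ∈ u.free) :
    ∃ s, v.sortState (u.setHead (v t.1) ht) = ⟨(v.sortState u).nx, some t, s⟩ := by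
  refine ⟨(v.sortState (u.setHead (v t.1) ht)).sg, ?_⟩
  simp only [sortState, SortState.mk.injEq, and_true]
  refine ⟨?_, ?_⟩
  · funext i
    rw [setHead_of_ne _ _ i.2]
  · rw [setHead_zero, dest_eq_some]

/-- The cost of the clique moves for fetching `w` symbols. -/
def cliqueCost (m w : ℕ) : ℕ := w + min w ((m + 1) / 2) + if w = 0 then 0 else m % 2

/-- `cliqueCost` sums the fetches down to none: one arc each, a second one for each of the last
(m+1)/2, and a third for the very last symbol if m is odd. -/
theorem fetchCost_add_le (m w : ℕ) :
    fetchCost m (w + 1) + cliqueCost m w ≤ cliqueCost m (w + 1) := by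
  unfold fetchCost cliqueCost
  rw [if_neg w.succ_ne_zero, Nat.min_def, Nat.min_def]
  split_ifs <;> omega

/-- At a fetch the cheapest wanted symbol is taken and the strategy is continued for the sign that
results. When all slots are sorted, at most 2 + (n-k) % 2 clique arcs put the right head in place.
-/
theorem walk_of_good (hm : 2 ≤ n - k) (v : NKNode n k) {σ : SortState (Slot k)} {N : ℕ}
    (h : SortState.Good slotSide σ N) (u : NKNode n k) (hu : v.sortState u = σ) :
    ∃ c ≤ N + cliqueCost (n - k) σ.ext.card + (2 + (n - k) % 2),
      HasDirectedWalk (nkStarOrientation n k) c u v := by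
  induction h generalizing u with
  | @done σ N h =>
    have htail : ∀ i, i ≠ 0 → v i = u i := by
      intro i hi
      have := h ⟨i, hi⟩
      rw [← hu] at this
      exact dest_eq_some.1 this
    have hfree : v 0 ∈ u.free := mem_free.2 fun i hi e =>
      hi (v.injective ((htail i hi).trans e))
    have hv : v = u.setHead (v 0) hfree := by
      ext i
      by_cases hi : i = 0
      · rw [hi, setHead_zero]
      · rw [setHead_of_ne _ _ hi, htail i hi]
    obtain ⟨c, hc, hw⟩ := u.setHead_walk hm hfree
    rw [← hv] at hw
    exact ⟨c, by omega, hw⟩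
  | @star σ N i hi _ ih =>
    subst hu
    obtain ⟨c, hc, hw⟩ := ih (u.swapHead i.1) (sortState_swapHead v u i)
    rw [SortState.ext_star] at hc
    exact ⟨c + 1, by omega, .cons (.inl (starArc_of_side hi)) hw⟩
  | @fetch σ N hd hne _ ih =>
    subst hu
    have hinj : Function.Injective fun t : Slot k => v t.1 := fun i j h =>
      Subtype.ext (v.injective h)
    obtain ⟨s, hs, hsf, c, hc, hw⟩ := u.fetch_walk hm
      (W := (v.sortState u).ext.image fun t => v t.1) (by
        intro s hs
        obtain ⟨t, ht, rfl⟩ := Finset.mem_image.1 hs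
        exact mem_ext_sortState.1 ht) (hne.image _)
    obtain ⟨t, ht, rfl⟩ := Finset.mem_image.1 hs
    rw [Finset.card_image_of_injective _ hinj] at hc
    obtain ⟨sg, hst⟩ := sortState_setHead v u hsf
    obtain ⟨c', hc', hw'⟩ := ih t ht sg _ hst
    have hcard : (⟨(v.sortState u).nx, some t, sg⟩ : SortState (Slot k)).ext.card + 1 =
        (v.sortState u).ext.card := by
      have : (⟨(v.sortState u).nx, some t, sg⟩ : SortState (Slot k)).ext =
          (v.sortState u).ext.erase t := by
        ext l
        simp only [SortState.mem_ext, Finset.mem_erase, hd]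
        constructor
        · rintro ⟨h1, h2⟩; exact ⟨fun h => h2 (by rw [h]), h1, by simp⟩
        · rintro ⟨h1, h2, -⟩; exact ⟨h2, fun h => h1 (Option.some_injective _ h).symm⟩
      rw [this, Finset.card_erase_add_one ht]
    have := fetchCost_add_le (n - k)
      (⟨(v.sortState u).nx, some t, sg⟩ : SortState (Slot k)).ext.card
    rw [hcard] at this
    exact ⟨c + c', by omega, hw.trans hw'⟩

theorem card_slot_left : ({i : Slot k | slotSide i = true} : Finset (Slot k)).card = k / 2 := by
  have hk := Nat.pos_of_ne_zero (NeZero.ne k)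
  rw [← Finset.card_image_of_injective (f := fun i : Slot k => (i.1 : ℕ)) _
    (fun i j h => Subtype.ext (Fin.ext h))]
  have : ({i : Slot k | slotSide i = true} : Finset (Slot k)).image (fun i => (i.1 : ℕ)) =
      Finset.Icc 1 (k / 2) := by
    ext x
    simp only [Finset.mem_image, Finset.mem_filter, Finset.mem_univ, true_and, slotSide,
      decide_eq_true_eq, Finset.mem_Icc]
    constructor
    · rintro ⟨i, h, rfl⟩
      refine ⟨Nat.one_le_iff_ne_zero.2 fun h0 => i.2 (Fin.ext (by simpa using h0)), h⟩
    · rintro ⟨h1, h2⟩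
      refine ⟨⟨⟨x, by omega⟩, fun h0 => ?_⟩, h2, rfl⟩
      have := congrArg Fin.val h0
      simp at this
      omega
  rw [this, Nat.card_Icc]
  omega

theorem card_slot : Fintype.card (Slot k) = k - 1 := by
  rw [Fintype.card_subtype_compl, Fintype.card_fin, Fintype.card_subtype_eq]

theorem card_slot_right :
    ({i : Slot k | slotSide i = false} : Finset (Slot k)).card = k - 1 - k / 2 := by
  have h := Finset.card_filter_add_card_filter_not (s := (Finset.univ : Finset (Slot k)))
    (fun i => slotSide i = true)
  rw [card_slot_left, Finset.card_univ, card_slot] at h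
  simp only [Bool.not_eq_true] at h
  omega

/-- The star move saved in the presence of outside symbols makes up for the parity terms of the
clique cost: for k > n/2, n-k odd and n-k outside symbols, the sum equals the bound. -/
theorem exists_walk (hk : 3 ≤ k) (hnk : k + 2 ≤ n) (u v : NKNode n k) :
    ∃ c ≤ (n + k) / 2 + 2 * k + 6 - nkDelta n k,
      HasDirectedWalk (nkStarOrientation n k) c u v := by
  have hside : ∀ a, ∃ i : Slot k, slotSide i = a := by
    intro a
    cases a
    · obtain ⟨i, hi⟩ := Finset.card_pos.1
        (show 0 < ({i : Slot k | slotSide i = false} : Finset (Slot k)).card by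
          rw [card_slot_right]; omega)
      exact ⟨i, by simpa using hi⟩
    · obtain ⟨i, hi⟩ := Finset.card_pos.1
        (show 0 < ({i : Slot k | slotSide i = true} : Finset (Slot k)).card by
          rw [card_slot_left]; omega)
      exact ⟨i, by simpa using hi⟩
  obtain ⟨hG, hG'⟩ := SortState.good_of_card hside (v.sortState_valid u) card_slot
    (by rw [card_slot_left, card_slot_right]; omega)
    (by rw [card_slot_left, card_slot_right]; omega)
  have hw1 : (v.sortState u).ext.card ≤ k - 1 := by
    rw [← card_slot]; exact Finset.card_le_univ _
  have hw2 : (v.sortState u).ext.card ≤ n - k := by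
    rw [← u.card_missing]
    refine Finset.card_le_card_of_injOn (fun t => v t.1) (fun t ht => mem_ext_sortState.1 ht) ?_
    exact fun i _ j _ h => Subtype.ext (v.injective h)
  rcases Finset.eq_empty_or_nonempty (v.sortState u).ext with h0 | h0
  · obtain ⟨c, hc, hw⟩ := walk_of_good (by omega) v hG u rfl
    refine ⟨c, hc.trans ?_, hw⟩
    rw [h0, Finset.card_empty]
    unfold cliqueCost nkDelta
    split_ifs <;> omega
  · obtain ⟨c, hc, hw⟩ := walk_of_good (by omega) v (hG' h0) u rfl
    refine ⟨c, hc.trans ?_, hw⟩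
    unfold cliqueCost nkDelta
    split_ifs <;> omega

/-! ### Every edge receives exactly one direction -/

theorem StarEdge.not_cliqueEdge {u v : NKNode n k} {i : Fin k} (h : StarEdge u v i) :
    ¬ CliqueEdge u v := by
  rintro ⟨h1, -⟩
  exact h1 ⟨i, by rw [h.2]; simp [swapHead]⟩

theorem StarEdge.label_unique {u v : NKNode n k} {i j : Fin k} (hi : StarEdge u v i)
    (hj : StarEdge u v j) : i = j := by
  have := DFunLike.congr_fun (hi.2.symm.trans hj.2) 0
  simpa [swapHead] using this

theorem isOrientationOf_nkStarOrientation :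
    IsOrientationOf (nkStarOrientation n k) (nkStarGraph n k) := by
  refine ⟨?_, ?_⟩
  · rintro u v (⟨i, hi, -⟩ | ⟨h, -⟩)
    · exact .inl ⟨i, hi⟩
    · exact .inr h
  · rintro u v (⟨i, hi⟩ | h)
    · have hc : ¬ CliqueArc u v := fun h => hi.not_cliqueEdge h.1
      have hc' : ¬ CliqueArc v u := fun h => hi.symm.not_cliqueEdge h.1
      have hE : v.IsEven ↔ ¬ u.IsEven := by rw [hi.2]; exact isEven_swapHead u hi.1
      have hs : ∀ {x y : NKNode n k}, StarEdge x y i → (StarArc x y ↔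
          (x.IsEven ∧ (i : ℕ) ≤ k / 2) ∨ (¬ x.IsEven ∧ ¬ (i : ℕ) ≤ k / 2)) := by
        intro x y hxy
        constructor
        · rintro ⟨j, hj, h⟩
          obtain rfl := hj.label_unique hxy
          exact h.imp (fun h => ⟨h.1, h.2.2⟩) (fun h => ⟨h.1, not_le.2 h.2⟩)
        · rintro (h | h)
          · exact ⟨i, hxy, .inl ⟨h.1, hxy.1, h.2⟩⟩
          · exact ⟨i, hxy, .inr ⟨h.1, not_le.1 h.2⟩⟩
      have h1 := hs hi
      have h2 := hs hi.symm
      rw [hE] at h2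
      simp only [nkStarOrientation, hc, hc', or_false, h1, h2, Xor]
      by_cases hu : u.IsEven <;> by_cases hl : (i : ℕ) ≤ k / 2 <;> simp [hu, hl]
    · have hs : ¬ StarArc u v := fun ⟨i, hi, _⟩ => hi.not_cliqueEdge h
      have hs' : ¬ StarArc v u := fun ⟨i, hi, _⟩ => hi.not_cliqueEdge h.symm
      have hne : u 0 ≠ v 0 := fun e => h.1 ⟨0, e⟩
      have h1 : v 0 < u 0 ↔ ¬ u 0 < v 0 :=
        ⟨fun h => not_lt.2 h.le, fun h' => lt_of_le_of_ne (not_lt.1 h') hne.symm⟩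
      have h2 := h.symm
      simp only [nkStarOrientation, hs, hs', false_or, CliqueArc, h, h2, true_and, h1, Xor]
      by_cases hu : u.IsEven <;> by_cases hv : v.IsEven <;> by_cases hl : u 0 < v 0 <;>
        simp [hu, hv, hl]

end NKNode

theorem theorem1 (n k : ℕ) [NeZero k] (hk : 3 ≤ k) (hnk : k + 2 ≤ n) :
    IsOrientationOf (nkStarOrientation n k) (nkStarGraph n k) ∧
    IsStronglyConnected (nkStarOrientation n k) ∧
    directedDiam (nkStarOrientation n k) ≤
      (((n + k) / 2 + 2 * k + 6 - nkDelta n k : ℕ) : ℕ∞) ∧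
    orientedDiam (nkStarGraph n k) ≤
      (((n + k) / 2 + 2 * k + 6 - nkDelta n k : ℕ) : ℕ∞) := by
  have hor := NKNode.isOrientationOf_nkStarOrientation (n := n) (k := k)
  have hsc : IsStronglyConnected (nkStarOrientation n k) := fun u v => by
    obtain ⟨c, -, h⟩ := NKNode.exists_walk hk hnk u v
    exact ⟨c, h⟩
  have hdiam : directedDiam (nkStarOrientation n k) ≤
      (((n + k) / 2 + 2 * k + 6 - nkDelta n k : ℕ) : ℕ∞) := by
    refine iSup_le fun u => iSup_le fun v => ?_
    obtain ⟨c, hc, h⟩ := NKNode.exists_walk hk hnk u v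
    exact (iInf₂_le c h).trans (by exact_mod_cast hc)
  exact ⟨hor, hsc, hdiam, iInf_le_of_le _ (iInf_le_of_le hor (iInf_le_of_le hsc hdiam))⟩
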